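/- **Setting.** Let $n\ge 2$, let $\mathcal S_0$ be a compact smooth $n$-dimensional manifold with a smooth Riemannian metric $\sigma=(\sigma_{ij})$, Laplace–Beltrami operator $\Delta$ and scalar curvature $R$. Let $\mathcal G$ be a compact, connected, semi-simple Lie group with Lie algebra $\mathfrak g$, bracket $[\cdot,\cdot]$ and Cartan–Killing metric $\gamma$ (minus the Killing form). Let $E_0=(\mathcal S_0,\mathfrak g,\pi,\mathrm{Ad}(\mathcal G))$ be an adjoint bundle, i.e. a smooth vector bundle over $\mathcal S_0$ with fibre $\mathfrak g$ and structure group $\mathrm{Ad}(\mathcal G)$. Let $A=(A_i)$ be a smooth connection in $E_0$ with field strength $F_{ij}=\partial_iA_j-\partial_jA_i+[A_i,A_j]$, let $\varPhi$ be a smooth section of $E_0$ with covariant derivative $\varPhi_i=\partial_i\varPhi+[A_i,\varPhi]$, let $V$ be a smooth real function on the total space of $E_0$, and let $\alpha_1,\alpha_2>0$ and $m\ge 0$ be constants. Put $$Pv=-(n-1)\Delta v-\tfrac n2Rv+\alpha_1\tfrac n8F_{ij}F^{ij}v+\alpha_2\tfrac n4\gamma_{ab}\sigma^{ij}\varPhi^a_i\varPhi^b_jv+\alpha_2\tfrac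 n2mV(\varPhi)v ,$$ where $F_{ij}F^{ij}=\gamma_{ab}\sigma^{ik}\sigma^{jl}F^a_{ij}F^b_{kl}$. **Theorem.** Let $v\in C^\infty(\mathcal S_0,\mathbb C)$, $v\ne0$, and $\mu>0$ satisfy $Pv=\mu v$. Then there are smooth functions $w_i:(0,\infty)\to\mathbb C$ and real numbers $\varLambda_i$, $i=0,1,2,\dots$, such that: 1. in $(0,\infty)$, $$-\frac1{32}\frac{n^2}{n-1}\ddot w_i-\mu t^{2-\frac4n}w_i-nt^2\varLambda_iw_i=0,$$ and $$\int_0^\infty\bigl\{|\dot w_i|^2+(1+t^2+\mu t^{2-\frac4n})|w_i|^2\bigr\}\,dt<\infty;$$ 2. $\varLambda_0<\varLambda_1<\varLambda_2<\dots<0$ and $\lim_i\varLambda_i=0$; 3. the functions $u_i(t,x)=w_i(t)v(x)$ are smooth solutions in $(0,\infty)\times\mathcal S_0$ of the wave equation with $\varLambda=\varLambda_i$, $$\begin{aligned}&\frac1{32}\frac{n^2}{n-1}\ddot u-(n-1)t^{2-\frac4n}\Delta u-\frac n2t^{2-\frac4n}Ru+\alpha_1\frac n8t^{2-\frac4n}F_{ij}F^{ij}u\\&\quad+\alpha_2\frac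 n4t^{2-\frac4n}\gamma_{ab}\sigma^{ij}\varPhi^a_i\varPhi^b_ju+\alpha_2\frac n2m\,t^{2-\frac4n}V(\varPhi)u+nt^2\varLambda u=0;\end{aligned}$$ 4. with $\lambda_i=(-\varLambda_i)^{-\frac{n-1}n}$, the functions $\tilde w_i(t)=w_i\bigl(\lambda_i^{\frac n{4(n-1)}}t\bigr)$ form (a) a Markushevich basis of $L^2(\mathbb R_+,\mathbb C)$: their linear span is dense, and there are continuous linear functionals $\ell_i$ with $\ell_i(\tilde w_j)=\delta_{ij}$ such that every $f\in L^2(\mathbb R_+,\mathbb C)$ with $\ell_i(f)=0$ for all $i$ vanishes (so no $\tilde w_i$ can be dropped, and every $f$ is determined by its coordinates); (b) an unconditional Schauder basis of the Hilbert space $H$, the completion of $C^\infty_c((0,\infty),\mathbb C)$ under the norm of the scalar product $\langle w,\tilde w\rangle_1=\int_0^\infty\{\bar w'\tilde w'+t^2\bar w\tilde w\}\,dt$: every element of $H$ has a unique expansion $\sum_ic_i\tilde w_i$, and it converges unconditionally in $H$. -/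

import Mathlib

open Set Filter Topology MeasureTheory Bundle
open scoped Manifold ContDiff

noncomputable section

namespace GravityYM

/-! ### Riemannian geometry in charts -/

section Riemannian

variable {n : ℕ} {M : Type*} [TopologicalSpace M] [ChartedSpace (EuclideanSpace ℝ (Fin n)) M]

/-- The partial derivative `∂_i f` of a function on `ℝⁿ`. -/
def pd {F : Type*} [NormedAddCommGroup F] [NormedSpace ℝ F] (i : Fin n)
    (f : EuclideanSpace ℝ (Fin n) → F) (y : EuclideanSpace ℝ (Fin n)) : F :=
  fderiv ℝ f y (EuclideanSpace.single i 1)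

variable (M) in
/-- Smooth Riemannian metrics `σ` on `M`. -/
abbrev Metric [IsManifold (𝓡 n) ∞ M] : Type _ :=
  ContMDiffRiemannianMetric (𝓡 n) ∞ (EuclideanSpace ℝ (Fin n))
    (fun x : M => TangentSpace (𝓡 n) x)

/-- The `i`-th coordinate vector field of a chart `φ`, at the point of `M` with coordinates `y`. -/
def coordFrame (φ : OpenPartialHomeomorph M (EuclideanSpace ℝ (Fin n))) (i : Fin n)
    (y : EuclideanSpace ℝ (Fin n)) : TangentSpace (𝓡 n) (φ.symm y) :=
  mfderiv (𝓡 n) (𝓡 n) φ.symm y (EuclideanSpace.single i (1 : ℝ))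

variable [IsManifold (𝓡 n) ∞ M]

/-- The components `σ_ij` of the metric in the chart at `x`, as functions of the coordinates. -/
def metricCoeff (σ : Metric (n := n) M) (x : M) (y : EuclideanSpace ℝ (Fin n)) :
    Matrix (Fin n) (Fin n) ℝ :=
  Matrix.of fun i j => σ.inner ((chartAt (EuclideanSpace ℝ (Fin n)) x).symm y)
    (coordFrame (chartAt _ x) i y) (coordFrame (chartAt _ x) j y)

/-- The components `σ^ij` of the inverse metric in the chart at `x`. -/
def metricInv (σ : Metric (n := n) M) (x : M) (y : EuclideanSpace ℝ (Fin n)) :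
    Matrix (Fin n) (Fin n) ℝ :=
  (metricCoeff σ x y)⁻¹

/-- The Christoffel symbols `Γ^k_ij` in the chart at `x`. -/
def christoffel (σ : Metric (n := n) M) (x : M) (k i j : Fin n)
    (y : EuclideanSpace ℝ (Fin n)) : ℝ :=
  (1 / 2) * ∑ l, metricInv σ x y k l *
    (pd i (fun z => metricCoeff σ x z j l) y + pd j (fun z => metricCoeff σ x z i l) y
      - pd l (fun z => metricCoeff σ x z i j) y)

/-- The components `R_ij` of the Ricci tensor in the chart at `x`
(with the sign for which round spheres have positive curvature). -/
def ricci (σ : Metric (n := n) M) (x : M) (i j : Fin n) (y : EuclideanSpace ℝ (Fin n)) : ℝ :=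
  ∑ k, (pd k (christoffel σ x k i j) y - pd j (christoffel σ x k i k) y)
    + ∑ k, ∑ l, (christoffel σ x k k l y * christoffel σ x l i j y
      - christoffel σ x k j l y * christoffel σ x l i k y)

/-- The scalar curvature `R = σ^ij R_ij`. It does not depend on the chart; at `x` it is evaluated
in the chart at `x`. -/
def scalarCurvature (σ : Metric (n := n) M) (x : M) : ℝ :=
  let y := chartAt (EuclideanSpace ℝ (Fin n)) x x
  ∑ i, ∑ j, metricInv σ x y i j * ricci σ x i j y

/-- The Laplace-Beltrami operator `Δv = σ^ij (∂_i ∂_j v - Γ^k_ij ∂_k v)` on complex valued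
functions, evaluated at `x` in the chart at `x`. -/
def laplacian (σ : Metric (n := n) M) (v : M → ℂ) (x : M) : ℂ :=
  let y := chartAt (EuclideanSpace ℝ (Fin n)) x x
  let f := v ∘ (chartAt (EuclideanSpace ℝ (Fin n)) x).symm
  ∑ i, ∑ j, (metricInv σ x y i j : ℂ) *
    (pd i (pd j f) y - ∑ k, (christoffel σ x k i j y : ℂ) * pd k f y)

end Riemannian

/-! ### The gauge group and its Lie algebra

A Lie group `𝒢` is modelled on a vector space `𝔤`; the tangent space of `𝒢` at `1` is, in
Mathlib, a copy of `𝔤`, and carries the Lie bracket of left invariant vector fields. -/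

section LieGroup

/-- Finite dimensional real normed spaces are complete. -/
instance completeOfFiniteDimensional {𝔤 : Type*} [NormedAddCommGroup 𝔤] [NormedSpace ℝ 𝔤]
    [FiniteDimensional ℝ 𝔤] : CompleteSpace 𝔤 :=
  FiniteDimensional.complete ℝ 𝔤

/-- A smooth Lie group has the differentiability that Mathlib's Lie bracket asks for. -/
instance lieGroupMinSmoothness {𝔤 : Type*} [NormedAddCommGroup 𝔤] [NormedSpace ℝ 𝔤] {𝒢 : Type*}
    [TopologicalSpace 𝒢] [ChartedSpace 𝔤 𝒢] [Group 𝒢] [h : LieGroup 𝓘(ℝ, 𝔤) ∞ 𝒢] :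
    LieGroup 𝓘(ℝ, 𝔤) (minSmoothness ℝ 3) 𝒢 := by
  refine LieGroup.of_le (n := ∞) ?_
  rw [minSmoothness_of_isRCLikeNormedField]
  exact WithTop.coe_le_coe.2 (le_top : (3 : ℕ∞) ≤ ⊤)

variable {𝔤 : Type*} [NormedAddCommGroup 𝔤] [NormedSpace ℝ 𝔤] (𝒢 : Type*)
  [TopologicalSpace 𝒢] [ChartedSpace 𝔤 𝒢] [Group 𝒢]

/-- An element of the model space `𝔤` as an element of the Lie algebra `T_1 𝒢`. -/
def toLie (ξ : 𝔤) : GroupLieAlgebra 𝓘(ℝ, 𝔤) 𝒢 := ξ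

/-- The Lie bracket of the Lie algebra of `𝒢`, on the model space `𝔤`. -/
def bracket (ξ η : 𝔤) : 𝔤 :=
  (⁅toLie 𝒢 ξ, toLie 𝒢 η⁆ : GroupLieAlgebra 𝓘(ℝ, 𝔤) 𝒢)

variable {𝒢} in
/-- The adjoint action: `Ad g` is the derivative at `1` of the conjugation by `g`. -/
def Ad (g : 𝒢) (ξ : 𝔤) : 𝔤 :=
  mfderiv 𝓘(ℝ, 𝔤) 𝓘(ℝ, 𝔤) (fun h : 𝒢 => g * h * g⁻¹) 1 (toLie 𝒢 ξ)

/-- The Cartan-Killing metric `γ`: minus the Killing form, so that it is positive definite when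
`𝒢` is compact and semi-simple. -/
def killingMetric [FiniteDimensional ℝ 𝔤] [LieGroup 𝓘(ℝ, 𝔤) ∞ 𝒢] (ξ η : 𝔤) : ℝ :=
  -killingForm ℝ (GroupLieAlgebra 𝓘(ℝ, 𝔤) 𝒢) (toLie 𝒢 ξ) (toLie 𝒢 η)

end LieGroup

/-! ### Adjoint bundles, connections, Higgs fields -/

section Bundles

variable {n : ℕ} {M : Type*} [TopologicalSpace M] [ChartedSpace (EuclideanSpace ℝ (Fin n)) M]
  {𝔤 : Type*} [NormedAddCommGroup 𝔤] [NormedSpace ℝ 𝔤]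
  (𝒢 : Type*) [TopologicalSpace 𝒢] [ChartedSpace 𝔤 𝒢] [Group 𝒢]
  (E : M → Type*) [TopologicalSpace (TotalSpace 𝔤 E)]
  [∀ x, TopologicalSpace (E x)] [∀ x, AddCommGroup (E x)] [∀ x, Module ℝ (E x)]
  [FiberBundle 𝔤 E] [VectorBundle ℝ 𝔤 E]

variable (𝔤) in
/-- The vector bundle `E` with fibre `𝔤` has structure group `Ad(𝒢)`: it is an adjoint bundle
`(M, 𝔤, π, Ad(𝒢))`. -/
def IsAdjointBundle : Prop :=
  ∀ (e e' : Trivialization 𝔤 (TotalSpace.proj : TotalSpace 𝔤 E → M))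
    [MemTrivializationAtlas e] [MemTrivializationAtlas e'],
    ∀ x ∈ e.baseSet ∩ e'.baseSet, ∃ g : 𝒢, ∀ ξ : 𝔤, e.coordChangeL ℝ e' x ξ = Ad g ξ

variable {E} in
/-- The derivative at `x`, in the direction `X`, of `z ↦ T_z ξ`, where `T` is the transition
function from the trivialization `e` to `e'`. -/
def transitionDeriv (e e' : Trivialization 𝔤 (TotalSpace.proj : TotalSpace 𝔤 E → M))
    [MemTrivializationAtlas e] [MemTrivializationAtlas e'] (x : M) (X : TangentSpace (𝓡 n) x)
    (ξ : 𝔤) : 𝔤 :=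
  mfderiv (𝓡 n) 𝓘(ℝ, 𝔤) (fun z => (e.coordChangeL ℝ e' z ξ : 𝔤)) x X

variable (n 𝔤) in
/-- A smooth connection `A = (A^a_i)` in the adjoint bundle `E`: in each local trivialization a
smooth `𝔤`-valued 1-form, with the gauge transformation law between two trivializations. If `T` is
the transition function, the law reads `[A', T ξ] = T [A, ξ] - (dT) ξ`, so that
`ds + [A, s]` defines a covariant derivative of the sections `s` of `E`. -/
structure GaugeConnection where
  /-- the `𝔤`-valued 1-form that represents the connection in a trivialization -/
  form : Trivialization 𝔤 (TotalSpace.proj : TotalSpace 𝔤 E → M) →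
    (x : M) → TangentSpace (𝓡 n) x →L[ℝ] 𝔤
  smooth : ∀ (e : Trivialization 𝔤 (TotalSpace.proj : TotalSpace 𝔤 E → M))
    [MemTrivializationAtlas e],
    ∀ φ ∈ IsManifold.maximalAtlas (𝓡 n) ∞ M, ∀ i : Fin n,
      ContDiffOn ℝ ∞ (fun y => form e (φ.symm y) (coordFrame φ i y))
        (φ.target ∩ φ.symm ⁻¹' e.baseSet)
  gauge : ∀ (e e' : Trivialization 𝔤 (TotalSpace.proj : TotalSpace 𝔤 E → M))
    [MemTrivializationAtlas e] [MemTrivializationAtlas e'],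
    ∀ x ∈ e.baseSet ∩ e'.baseSet, ∀ (X : TangentSpace (𝓡 n) x) (ξ : 𝔤),
      bracket 𝒢 (form e' x X) (e.coordChangeL ℝ e' x ξ) =
        e.coordChangeL ℝ e' x (bracket 𝒢 (form e x X) ξ)
          - transitionDeriv e e' x X ξ

variable {𝒢 E}

/-- The components `A_i ∈ 𝔤` of the connection in the chart and the trivialization at `x`. -/
def GaugeConnection.comp (A : GaugeConnection n 𝔤 𝒢 E) (x : M) (i : Fin n)
    (y : EuclideanSpace ℝ (Fin n)) : 𝔤 :=
  A.form (trivializationAt 𝔤 E x) ((chartAt (EuclideanSpace ℝ (Fin n)) x).symm y)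
    (coordFrame (chartAt _ x) i y)

/-- The field strength `F_ij = ∂_i A_j - ∂_j A_i + [A_i, A_j]`
in the chart and the trivialization at `x`. -/
def GaugeConnection.curvature (A : GaugeConnection n 𝔤 𝒢 E) (x : M) (i j : Fin n)
    (y : EuclideanSpace ℝ (Fin n)) : 𝔤 :=
  pd i (A.comp x j) y - pd j (A.comp x i) y + bracket 𝒢 (A.comp x i y) (A.comp x j y)

/-- The components `Φ^a` of a section of `E` in the chart and the trivialization at `x`. -/
def sectionComp (Φ : (x : M) → E x) (x : M) (y : EuclideanSpace ℝ (Fin n)) : 𝔤 :=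
  let z := (chartAt (EuclideanSpace ℝ (Fin n)) x).symm y
  (trivializationAt 𝔤 E x (TotalSpace.mk' 𝔤 z (Φ z))).2

/-- The covariant derivative `Φ_i = ∂_i Φ + [A_i, Φ]` in the chart and the trivialization
at `x`. -/
def GaugeConnection.covDeriv (A : GaugeConnection n 𝔤 𝒢 E) (Φ : (x : M) → E x) (x : M)
    (i : Fin n) (y : EuclideanSpace ℝ (Fin n)) : 𝔤 :=
  pd i (sectionComp Φ x) y + bracket 𝒢 (A.comp x i y) (sectionComp Φ x y)

variable [IsManifold (𝓡 n) ∞ M] [FiniteDimensional ℝ 𝔤]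
  [LieGroup 𝓘(ℝ, 𝔤) ∞ 𝒢]

variable (n 𝔤 𝒢 E) in
/-- The data of the wave equation: a Riemannian metric `σ`, a Yang-Mills connection `A`, a Higgs
field `Φ`, a potential `V`, the coupling constants `α₁, α₂ > 0` and the constant `m ≥ 0`. -/
structure Background where
  σ : Metric (n := n) M
  A : GaugeConnection n 𝔤 𝒢 E
  Φ : (x : M) → E x
  Φ_smooth : ContMDiff (𝓡 n) ((𝓡 n).prod 𝓘(ℝ, 𝔤)) ∞ (fun x => TotalSpace.mk' 𝔤 x (Φ x))
  V : TotalSpace 𝔤 E → ℝ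
  V_smooth : ContMDiff ((𝓡 n).prod 𝓘(ℝ, 𝔤)) 𝓘(ℝ, ℝ) ∞ V
  α₁ : ℝ
  α₂ : ℝ
  m : ℝ
  α₁_pos : 0 < α₁
  α₂_pos : 0 < α₂
  m_nonneg : 0 ≤ m

variable (B : Background n 𝔤 𝒢 E)

/-- `F_ij F^ij = γ_ab σ^ik σ^jl F^a_ij F^b_kl`. -/
def Background.yangMills (x : M) : ℝ :=
  let y := chartAt (EuclideanSpace ℝ (Fin n)) x x
  ∑ i, ∑ j, ∑ k, ∑ l, metricInv B.σ x y i k * metricInv B.σ x y j l *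
    killingMetric 𝒢 (B.A.curvature x i j y) (B.A.curvature x k l y)

/-- `γ_ab σ^ij Φ^a_i Φ^b_j`. -/
def Background.higgs (x : M) : ℝ :=
  let y := chartAt (EuclideanSpace ℝ (Fin n)) x x
  ∑ i, ∑ j, metricInv B.σ x y i j *
    killingMetric 𝒢 (B.A.covDeriv B.Φ x i y) (B.A.covDeriv B.Φ x j y)

/-- `V(Φ)`. -/
def Background.potential (x : M) : ℝ := B.V (TotalSpace.mk' 𝔤 x (B.Φ x))

/-- `(v, μ)` is a solution of the elliptic eigenvalue problem
`-(n-1) Δv - (n/2) R v + α₁ (n/8) F_ij F^ij v + α₂ (n/4) γ_ab σ^ij Φ^a_i Φ^b_j v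
  + α₂ (n/2) m V(Φ) v = μ v`. -/
structure Background.IsEigenpair (v : M → ℂ) (μ : ℝ) : Prop where
  smooth : ContMDiff (𝓡 n) 𝓘(ℝ, ℂ) ∞ v
  ne_zero : v ≠ 0
  eqn : ∀ x : M,
    -((n : ℂ) - 1) * laplacian B.σ v x - (n : ℂ) / 2 * (scalarCurvature B.σ x : ℂ) * v x
      + (B.α₁ : ℂ) * ((n : ℂ) / 8) * (B.yangMills x : ℂ) * v x
      + (B.α₂ : ℂ) * ((n : ℂ) / 4) * (B.higgs x : ℂ) * v x
      + (B.α₂ : ℂ) * ((n : ℂ) / 2) * (B.m : ℂ) * (B.potential x : ℂ) * v x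
    = (μ : ℂ) * v x

/-- `u = u(t, x)` is a smooth solution in `(0, ∞) × M` of the wave equation with cosmological
constant `Λ`. -/
structure Background.IsWaveSolution (Λ : ℝ) (u : ℝ → M → ℂ) : Prop where
  smooth : ContMDiffOn (𝓘(ℝ, ℝ).prod (𝓡 n)) 𝓘(ℝ, ℂ) ∞ (fun q : ℝ × M => u q.1 q.2)
    (Ioi 0 ×ˢ univ)
  eqn : ∀ t : ℝ, 0 < t → ∀ x : M,
    let τ : ℂ := ((t ^ (2 - 4 / (n : ℝ)) : ℝ) : ℂ)
    1 / 32 * ((n : ℂ) ^ 2 / ((n : ℂ) - 1)) * deriv (deriv fun s => u s x) t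
      - ((n : ℂ) - 1) * τ * laplacian B.σ (u t) x
      - (n : ℂ) / 2 * τ * (scalarCurvature B.σ x : ℂ) * u t x
      + (B.α₁ : ℂ) * ((n : ℂ) / 8) * τ * (B.yangMills x : ℂ) * u t x
      + (B.α₂ : ℂ) * ((n : ℂ) / 4) * τ * (B.higgs x : ℂ) * u t x
      + (B.α₂ : ℂ) * ((n : ℂ) / 2) * (B.m : ℂ) * τ * (B.potential x : ℂ) * u t x
      + (n : ℂ) * (t : ℂ) ^ 2 * (Λ : ℂ) * u t x
    = 0

end Bundles

/-! ### The implicit eigenvalue problem on the half line -/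

/-- `(w, Λ)` solves
`-(1/32) (n²/(n-1)) w'' - μ t^(2-4/n) w - n t² Λ w = 0` in `(0, ∞)`. -/
structure IsImplicitEigenpair (n : ℕ) (μ : ℝ) (w : ℝ → ℂ) (Λ : ℝ) : Prop where
  smooth : ContDiffOn ℝ ∞ w (Ioi 0)
  eqn : ∀ t : ℝ, 0 < t →
    -(1 / 32 * ((n : ℂ) ^ 2 / ((n : ℂ) - 1))) * deriv (deriv w) t
      - (μ : ℂ) * ((t ^ (2 - 4 / (n : ℝ)) : ℝ) : ℂ) * w t
      - (n : ℂ) * (t : ℂ) ^ 2 * (Λ : ℂ) * w t = 0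

/-- Finite energy: `∫_0^∞ {|w'|² + (1 + t² + μ t^(2-4/n)) |w|²} < ∞`. -/
def HasFiniteEnergy (n : ℕ) (μ : ℝ) (w : ℝ → ℂ) : Prop :=
  IntegrableOn (fun t : ℝ =>
    ‖deriv w t‖ ^ 2 + (1 + t ^ 2 + μ * t ^ (2 - 4 / (n : ℝ))) * ‖w t‖ ^ 2) (Ioi 0)

/-- The transformed function `w̃(t) = w(λ^(n/(4(n-1))) t)`, where `λ = (-Λ)^(-(n-1)/n)`. -/
def rescaled (n : ℕ) (Λ : ℝ) (w : ℝ → ℂ) (t : ℝ) : ℂ :=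
  w (((-Λ) ^ (-(((n : ℝ) - 1) / n))) ^ ((n : ℝ) / (4 * ((n : ℝ) - 1))) * t)

/-- `L²(ℝ₊, ℂ)`. -/
abbrev L2 : Type := Lp ℂ 2 (volume.restrict (Ioi (0 : ℝ)))

/-- The test functions `C_c^∞(ℝ₊, ℂ)`, extended by zero to `ℝ`. -/
def IsTest (φ : ℝ → ℂ) : Prop :=
  ContDiff ℝ ∞ φ ∧ HasCompactSupport φ ∧ tsupport φ ⊆ Ioi 0

/-- The pair `z ∈ L² × L²` is `(w', t w)`. The inner product of two such pairs in the Hilbert space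
`L² × L²` is `∫_0^∞ {conj(w') w̃' + t² conj(w) w̃}`. -/
def Represents (w : ℝ → ℂ) (z : WithLp 2 (L2 × L2)) : Prop :=
  (z.fst =ᵐ[volume.restrict (Ioi (0 : ℝ))] deriv w) ∧
    (z.snd =ᵐ[volume.restrict (Ioi (0 : ℝ))] fun t => (t : ℂ) * w t)

/-- The Hilbert space `H`, the completion of `C_c^∞(ℝ₊, ℂ)` under the norm of
`⟨w, w̃⟩₁ = ∫_0^∞ {conj(w') w̃' + t² conj(w) w̃}`. Since `w ↦ (w', t w)` is an isometry into the
complete space `L² × L²`, the completion is the closure of the image of `C_c^∞(ℝ₊, ℂ)`. -/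
def energySpace : Submodule ℂ (WithLp 2 (L2 × L2)) :=
  (Submodule.span ℂ {z | ∃ φ, IsTest φ ∧ Represents φ z}).topologicalClosure

/-- A basis in the sense of Markushevich: the linear span is dense, there are continuous coordinate
functionals, and a vector all of whose coordinates vanish is zero. -/
def IsMarkushevichBasis {X : Type*} [NormedAddCommGroup X] [NormedSpace ℂ X] (e : ℕ → X) : Prop :=
  (Submodule.span ℂ (range e)).topologicalClosure = ⊤ ∧
    ∃ f : ℕ → X →L[ℂ] ℂ, (∀ i j, f i (e j) = if i = j then 1 else 0) ∧
      ∀ x, (∀ i, f i x = 0) → x = 0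

end GravityYM

end

noncomputable section

namespace GravityYM

/-! With κ > 0, the substitution w(t) = u(t/κ), Λ = -κ⁻⁴, λ = κ^(4-4/n) turns the implicit problem
into a linear one on the half line: -a u'' + b t² u = λ μ t^p u with u(0) = 0, where b = n and p = 2
- 4/n lies in [0, 2). Dilation by κ is also the normalization that defines `rescaled`, so the
functions w̃_i are the eigenfunctions u_i themselves. Once the linear problem is solved, the wave
equation follows by separation of variables.

The linear problem lives in the Hilbert space of the form ∫ {a |u'|² + b t² |u|²}. Evaluation at t
is a bounded functional there, with a Hölder bound in t (`profile_sub_sq_le`). Since p < 2, the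
weight is o(t²), so multiplication by √(μ t^p) is compact into L² (`isCompactOperator_weightOp`),
and so is the solution operator `solOp`, whose form is ∫ μ t^p |u|². Its eigenvectors solve the
differential equation classically (`exists_deriv_of_eigen`) and vanish at 0, hence eigenvalues are
simple (`exists_smul_of_eigen`). The spectral theorem gives an orthonormal basis with λ_i increasing
to infinity (`nonempty_eigenbasis`). The norm with constants a, b is equivalent to that of H, so
this basis is an unconditional Schauder basis of H.

In L² the density of the span is inherited from test functions. The coordinate functionals are f ↦
λ_i ∫ μ t^p ū_i f, and the real issue is that they separate points: the functions μ t^p u_i must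
span a dense subspace of L². For a test function φ, the coefficients of φ in the eigenbasis decay
faster than any power of λ_i, because μ⁻¹t^(-p)(-a∂² + bt²) maps test functions to test functions
(`exists_coefficient_bound`). The norms of μ t^p u_i in L² grow at most polynomially in λ_i
(`fourth_moment`, `norm_weighted_le`), and the index i is at most polynomial in λ_i
(`card_le_of_eigen`). Hence the expansion of μ t^p φ in the functions μ t^p u_i converges absolutely
in L². As every test function has the form μ t^p φ, this gives `eq_zero_of_inner_weighted`. -/

/-- The product `L² × L²` with its Hilbert space structure. -/
abbrev L2Pair : Type := WithLp 2 (L2 × L2)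

/-! ### Indicator functions, and evaluation of a primitive as an inner product -/

/-- The indicator function of `(0, t]` as an element of `L²(ℝ₊)`. -/
def chi (t : ℝ) : L2 :=
  indicatorConstLp 2 (measurableSet_Ioc (a := (0 : ℝ)) (b := t))
    (ne_top_of_le_ne_top measure_Ioc_lt_top.ne (Measure.restrict_apply_le _ _)) 1

theorem inner_chi (t : ℝ) (f : L2) : inner ℂ (chi t) f = ∫ s in Ioc 0 t, f s := by
  rw [chi, L2.inner_indicatorConstLp_one, Measure.restrict_restrict measurableSet_Ioc,
    inter_eq_left.2 fun s hs => hs.1]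

/-- The difference is, up to sign, the indicator of a subset of (s, t] when s ≤ t. It is only a
subset because negative times are cut off, hence an inequality. All Hölder-1/2 bounds below come
from here. -/
theorem norm_chi_sub_sq_le (s t : ℝ) : ‖chi t - chi s‖ ^ 2 ≤ |t - s| := by
  wlog h : s ≤ t generalizing s t
  · rw [norm_sub_rev, abs_sub_comm]; exact this t s (le_of_not_ge h)
  have hm : MeasurableSet (Ioc (0 : ℝ) t \ Ioc 0 s) := measurableSet_Ioc.diff measurableSet_Ioc
  have hsub : Ioc (0 : ℝ) t \ Ioc 0 s ⊆ Ioc s t := fun x hx => by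
    simp only [Set.mem_sdiff, mem_Ioc, not_and, not_le] at hx ⊢
    exact ⟨hx.2 hx.1.1, hx.1.2⟩
  have hfin : (volume.restrict (Ioi (0 : ℝ))) (Ioc (0 : ℝ) t \ Ioc 0 s) ≤ ENNReal.ofReal (t - s) :=
    calc _ ≤ volume (Ioc (0 : ℝ) t \ Ioc 0 s) := Measure.restrict_apply_le _ _
      _ ≤ volume (Ioc s t) := measure_mono hsub
      _ = _ := Real.volume_Ioc
  have heq : chi t - chi s = indicatorConstLp 2 hm (ne_top_of_le_ne_top (by simp) hfin) (1 : ℂ) := by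
    apply Lp.ext
    filter_upwards [Lp.coeFn_sub (chi t) (chi s), indicatorConstLp_coeFn (p := 2) (hs := hm)
      (hμs := (ne_top_of_le_ne_top (by simp) hfin)) (c := (1 : ℂ)),
      indicatorConstLp_coeFn (p := 2) (c := (1 : ℂ)) (hs := measurableSet_Ioc (a := (0 : ℝ)) (b := t))
        (hμs := ne_top_of_le_ne_top measure_Ioc_lt_top.ne (Measure.restrict_apply_le
          (μ := volume) (Ioi (0 : ℝ)) _)),
      indicatorConstLp_coeFn (p := 2) (c := (1 : ℂ)) (hs := measurableSet_Ioc (a := (0 : ℝ)) (b := s))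
        (hμs := ne_top_of_le_ne_top measure_Ioc_lt_top.ne (Measure.restrict_apply_le
          (μ := volume) (Ioi (0 : ℝ)) _))] with x h1 h2 h3 h4
    rw [h1, h2, Pi.sub_apply, chi, chi, h3, h4]
    simp only [indicator, Set.mem_sdiff, mem_Ioc]
    by_cases hx : 0 < x <;> by_cases hxt : x ≤ t <;> by_cases hxs : x ≤ s <;> simp [hx, hxt, hxs]
    exact hxt (hxs.trans h)
  rw [heq, norm_indicatorConstLp (by simp) (by simp)]
  simp only [norm_one, one_mul]
  rw [← Real.rpow_natCast, ← Real.rpow_mul measureReal_nonneg]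
  rw [show (1 / (2 : ENNReal).toReal * ((2 : ℕ) : ℝ)) = 1 by norm_num, Real.rpow_one,
    abs_of_nonneg (sub_nonneg.2 h)]
  exact ENNReal.toReal_le_of_le_ofReal (sub_nonneg.2 h) hfin

theorem chi_of_nonpos {t : ℝ} (ht : t ≤ 0) : chi t = 0 := by
  apply Lp.ext
  filter_upwards [indicatorConstLp_coeFn (p := 2) (c := (1 : ℂ))
    (hs := measurableSet_Ioc (a := (0 : ℝ)) (b := t))
    (hμs := ne_top_of_le_ne_top measure_Ioc_lt_top.ne (Measure.restrict_apply_le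
      (μ := volume) (Ioi (0 : ℝ)) _)), Lp.coeFn_zero ℂ 2 (volume.restrict (Ioi (0 : ℝ)))]
    with x h1 h2
  rw [chi, h1, h2, Ioc_eq_empty (not_lt.2 ht)]
  simp

theorem continuous_chi : Continuous chi := by
  rw [continuous_iff_continuousAt]
  intro s
  rw [ContinuousAt, tendsto_iff_norm_sub_tendsto_zero]
  have h : Tendsto (fun t => Real.sqrt |t - s|) (𝓝 s) (𝓝 0) := by
    have : Continuous fun t : ℝ => Real.sqrt |t - s| := by fun_prop
    simpa using this.tendsto s
  exact squeeze_zero (fun _ => norm_nonneg _) (fun t => Real.le_sqrt_of_sq_le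
    (norm_chi_sub_sq_le s t)) h

/-- Multiplication of the two components of a pair by nonzero scalars. -/
def scaleEquiv (r s : ℂˣ) : L2Pair ≃L[ℂ] L2Pair :=
  (WithLp.prodContinuousLinearEquiv 2 ℂ L2 L2).trans
    (((ContinuousLinearEquiv.smulLeft r).prodCongr (ContinuousLinearEquiv.smulLeft s)).trans
      (WithLp.prodContinuousLinearEquiv 2 ℂ L2 L2).symm)

theorem scaleEquiv_fst (r s : ℂˣ) (z : L2Pair) : (scaleEquiv r s z).fst = (r : ℂ) • z.fst := rfl

theorem scaleEquiv_snd (r s : ℂˣ) (z : L2Pair) : (scaleEquiv r s z).snd = (s : ℂ) • z.snd := rfl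

/-- Convergence in L² forces almost everywhere convergence along a subsequence, so a pointwise limit
of representatives must be the L² limit. -/
theorem tendsto_Lp_ae_unique {α : Type*} [MeasurableSpace α] {m : Measure α} {f : ℕ → Lp ℂ 2 m}
    {g : Lp ℂ 2 m} {h : α → ℂ} {k : ℕ → α → ℂ} (hf : Tendsto f atTop (𝓝 g))
    (hk : ∀ n, f n =ᵐ[m] k n) (hh : ∀ x, Tendsto (fun n => k n x) atTop (𝓝 (h x))) :
    g =ᵐ[m] h := by
  obtain ⟨ns, hns, hae⟩ := (tendstoInMeasure_of_tendsto_Lp hf).exists_seq_tendsto_ae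
  filter_upwards [hae, ae_all_iff.2 hk] with x hx hkx
  simp only [hkx] at hx
  exact tendsto_nhds_unique hx ((hh x).comp hns.tendsto_atTop)

theorem isTest_integral_deriv {φ : ℝ → ℂ} (hφ : IsTest φ) (t : ℝ) :
    ∫ s in Ioc 0 t, deriv φ s = φ t := by
  have h0 : ∀ s, s ≤ 0 → φ s = 0 := fun s hs => by
    by_contra h
    exact absurd (hφ.2.2 (subset_tsupport φ h)) (not_lt.2 hs)
  rcases le_total t 0 with ht | ht
  · rw [Ioc_eq_empty (not_lt.2 ht), h0 t ht]; simp
  · rw [← intervalIntegral.integral_of_le ht, intervalIntegral.integral_deriv_eq_sub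
      (fun x _ => (hφ.1.differentiable (by simp)).differentiableAt)
      ((hφ.1.continuous_deriv (by simp)).intervalIntegrable _ _), h0 0 le_rfl, sub_zero]

theorem Represents.inner_chi {φ : ℝ → ℂ} (hφ : IsTest φ) {z : L2Pair} (hz : Represents φ z)
    (t : ℝ) : inner ℂ (chi t) z.fst = φ t := by
  rw [GravityYM.inner_chi, ← isTest_integral_deriv hφ t]
  have h : z.fst =ᵐ[volume.restrict (Ioc 0 t)] deriv φ :=
    ae_restrict_of_ae_restrict_of_subset (fun s hs => hs.1) hz.1
  exact integral_congr_ae h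

/-- The elements of the energy space are pairs `(w', t w)`. -/
theorem energySpace_snd {z : L2Pair} (hz : z ∈ energySpace) :
    z.snd =ᵐ[volume.restrict (Ioi (0 : ℝ))] fun t => (t : ℂ) * inner ℂ (chi t) z.fst := by
  let S : Submodule ℂ L2Pair :=
    { carrier := {z | z.snd =ᵐ[volume.restrict (Ioi (0 : ℝ))]
        fun t => (t : ℂ) * inner ℂ (chi t) z.fst}
      zero_mem' := by
        simp only [mem_ofPred_eq, WithLp.zero_snd, WithLp.zero_fst, inner_zero_right, mul_zero]
        exact Lp.coeFn_zero ℂ 2 (volume.restrict (Ioi (0 : ℝ)))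
      add_mem' := by
        intro x y hx hy
        simp only [mem_ofPred_eq, WithLp.add_snd, WithLp.add_fst] at hx hy ⊢
        filter_upwards [Lp.coeFn_add x.snd y.snd, hx, hy] with t h1 h2 h3
        rw [h1, Pi.add_apply, h2, h3, inner_add_right]; ring
      smul_mem' := by
        intro c x hx
        simp only [mem_ofPred_eq, WithLp.smul_snd, WithLp.smul_fst] at hx ⊢
        filter_upwards [Lp.coeFn_smul c x.snd, hx] with t h1 h2
        rw [h1, Pi.smul_apply, h2, inner_smul_right, smul_eq_mul]; ring }
  have hspan : Submodule.span ℂ {z : L2Pair | ∃ φ, IsTest φ ∧ Represents φ z} ≤ S := by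
    rw [Submodule.span_le]
    rintro z ⟨φ, hφ, hz⟩
    filter_upwards [hz.2] with t ht
    rw [ht, hz.inner_chi hφ]
  have hmem : z ∈ closure (Submodule.span ℂ {z : L2Pair | ∃ φ, IsTest φ ∧ Represents φ z} :
    Set L2Pair) := hz
  obtain ⟨x, hx, hlim⟩ := mem_closure_iff_seq_limit.1 hmem
  -- The second components converge in L², while for each fixed t the primitive of the first
  -- component converges because it is an inner product with a fixed vector.
  refine tendsto_Lp_ae_unique (f := fun n => (x n).snd)
    (((WithLp.sndL 2 ℂ L2 L2).continuous.tendsto z).comp hlim) (fun n => hspan (hx n)) ?_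
  intro t
  refine Tendsto.const_mul _ (Tendsto.inner tendsto_const_nhds ?_)
  exact ((WithLp.fstL 2 ℂ L2 L2).continuous.tendsto z).comp hlim

/-! ### Norms in L² and test functions -/

theorem norm_sq_L2 (f : L2) : ‖f‖ ^ 2 = ∫ t in Ioi (0 : ℝ), ‖f t‖ ^ 2 := by
  have h : ((‖f‖ ^ 2 : ℝ) : ℂ) = ((∫ t in Ioi (0 : ℝ), ‖f t‖ ^ 2 : ℝ) : ℂ) := by
    have h1 : ((‖f‖ ^ 2 : ℝ) : ℂ) = inner ℂ f f := by
      rw [inner_self_eq_norm_sq_to_K (𝕜 := ℂ) f]; push_cast; rfl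
    rw [h1, ← integral_complex_ofReal, L2.inner_def]
    refine integral_congr_ae (Eventually.of_forall fun t => ?_)
    simp [inner_self_eq_norm_sq_to_K]
  exact_mod_cast h

theorem integrable_norm_sq_L2 (f : L2) : IntegrableOn (fun t => ‖f t‖ ^ 2) (Ioi (0 : ℝ)) :=
  (memLp_two_iff_integrable_sq_norm (Lp.aestronglyMeasurable f)).1 (Lp.memLp f)

theorem norm_sq_toLp {f : ℝ → ℂ} (hf : MemLp f 2 (volume.restrict (Ioi (0 : ℝ)))) :
    ‖hf.toLp f‖ ^ 2 = ∫ t in Ioi (0 : ℝ), ‖f t‖ ^ 2 := by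
  rw [norm_sq_L2]
  refine integral_congr_ae ?_
  filter_upwards [hf.coeFn_toLp] with t ht
  rw [ht]

theorem memLp_two_of_norm_sq_le {f : ℝ → ℂ} {g : ℝ → ℝ}
    (hf : AEStronglyMeasurable f (volume.restrict (Ioi (0 : ℝ)))) (hg : IntegrableOn g (Ioi 0))
    (h : ∀ᵐ t ∂(volume.restrict (Ioi (0 : ℝ))), ‖f t‖ ^ 2 ≤ g t) :
    MemLp f 2 (volume.restrict (Ioi (0 : ℝ))) := by
  rw [memLp_two_iff_integrable_sq_norm hf]
  refine Integrable.mono' hg (hf.norm.pow 2) ?_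
  filter_upwards [h] with t ht
  rwa [Real.norm_of_nonneg (by positivity)]

theorem norm_sq_toLp_le {f : ℝ → ℂ} {g : ℝ → ℝ}
    (hf : MemLp f 2 (volume.restrict (Ioi (0 : ℝ)))) (hg : IntegrableOn g (Ioi 0))
    (h : ∀ᵐ t ∂(volume.restrict (Ioi (0 : ℝ))), ‖f t‖ ^ 2 ≤ g t) :
    ‖hf.toLp f‖ ^ 2 ≤ ∫ t in Ioi (0 : ℝ), g t := by
  rw [norm_sq_toLp]
  exact integral_mono_ae ((memLp_two_iff_integrable_sq_norm hf.1).1 hf) hg h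

theorem IsTest.memLp {φ : ℝ → ℂ} (hφ : IsTest φ) :
    MemLp φ 2 (volume.restrict (Ioi (0 : ℝ))) :=
  (hφ.1.continuous.memLp_of_hasCompactSupport hφ.2.1).restrict _

theorem IsTest.deriv {φ : ℝ → ℂ} (hφ : IsTest φ) : IsTest (deriv φ) :=
  ⟨hφ.1.deriv' , hφ.2.1.deriv, (tsupport_deriv_subset (f := φ)).trans hφ.2.2⟩

/-- The factor need not be smooth at 0, since the support of φ is a compact subset of the open half
line; this admits t^p and t^(-p) as factors. -/
theorem IsTest.mul_left {φ : ℝ → ℂ} (hφ : IsTest φ) {g : ℝ → ℂ} (hg : ContDiffOn ℝ ∞ g (Ioi 0)) :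
    IsTest fun t => g t * φ t := by
  refine ⟨?_, hφ.2.1.mul_left, (closure_mono ?_).trans hφ.2.2⟩
  · rw [contDiff_iff_contDiffAt]
    intro t
    by_cases ht : t ∈ tsupport φ
    · exact (hg.contDiffAt (isOpen_Ioi.mem_nhds (hφ.2.2 ht))).mul hφ.1.contDiffAt
    · have h0 : (fun t => g t * φ t) =ᶠ[𝓝 t] fun _ => 0 := by
        filter_upwards [(isClosed_tsupport φ).isOpen_compl.mem_nhds ht] with s hs
        rw [image_eq_zero_of_notMem_tsupport hs, mul_zero]
      exact (contDiffAt_const (c := (0 : ℂ))).congr_of_eventuallyEq h0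
  · exact fun t ht => right_ne_zero_of_mul ht

theorem IsTest.add {φ ψ : ℝ → ℂ} (hφ : IsTest φ) (hψ : IsTest ψ) : IsTest fun t => φ t + ψ t :=
  ⟨hφ.1.add hψ.1, hφ.2.1.add hψ.2.1,
    (tsupport_add (f := φ) (g := ψ)).trans (union_subset hφ.2.2 hψ.2.2)⟩

theorem IsTest.eq_zero {φ : ℝ → ℂ} (hφ : IsTest φ) {t : ℝ} (ht : t ≤ 0) : φ t = 0 := by
  by_contra h
  exact absurd (hφ.2.2 (subset_tsupport φ h)) (not_lt.2 ht)

theorem contDiff_ofReal_complex : ContDiff ℝ ∞ (fun t : ℝ => (t : ℂ)) := Complex.ofRealCLM.contDiff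

theorem isTest_ofReal {g : ℝ → ℝ} (hg : ContDiff ℝ ∞ g) (hc : HasCompactSupport g)
    (hs : tsupport g ⊆ Ioi 0) : IsTest fun t => (g t : ℂ) := by
  refine ⟨contDiff_ofReal_complex.comp hg, hc.comp_left (g := fun t : ℝ => (t : ℂ)) (by simp),
    (closure_mono ?_).trans hs⟩
  intro t ht
  simpa using ht

theorem exists_represents {φ : ℝ → ℂ} (hφ : IsTest φ) :
    ∃ z ∈ energySpace, Represents φ z := by
  have h2 : IsTest fun t => (t : ℂ) * φ t := hφ.mul_left contDiff_ofReal_complex.contDiffOn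
  refine ⟨WithLp.toLp 2 (hφ.deriv.memLp.toLp _, h2.memLp.toLp _), ?_, ?_⟩
  · refine Submodule.le_topologicalClosure _ (Submodule.subset_span ⟨φ, hφ, ?_⟩)
    exact ⟨hφ.deriv.memLp.coeFn_toLp, h2.memLp.coeFn_toLp⟩
  · exact ⟨hφ.deriv.memLp.coeFn_toLp, h2.memLp.coeFn_toLp⟩

theorem ae_eq_zero_of_forall_isTest {f : ℝ → ℂ} (hf : LocallyIntegrableOn f (Ioi 0))
    (h : ∀ g : ℝ → ℝ, IsTest (fun t => (g t : ℂ)) → ∫ t in Ioi (0 : ℝ), (g t : ℂ) * f t = 0) :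
    f =ᵐ[volume.restrict (Ioi (0 : ℝ))] 0 := by
  have := isOpen_Ioi.ae_eq_zero_of_integral_contDiff_smul_eq_zero hf fun g hg hc hs => by
    rw [← h g (isTest_ofReal hg hc hs), setIntegral_eq_integral_of_forall_compl_eq_zero]
    · rfl
    · intro x hx
      rw [(isTest_ofReal hg hc hs).eq_zero (not_lt.1 hx), zero_mul]
  exact (ae_restrict_iff' measurableSet_Ioi).2 this

/-! ### The form space and its profiles -/

/-- The constants of the form `∫ {a |w'|² + b t² |w|²}` and of the weight `μ t^p`. -/
structure Model where
  a : ℝ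
  b : ℝ
  μ : ℝ
  p : ℝ
  a_pos : 0 < a
  b_pos : 0 < b
  μ_pos : 0 < μ
  p_nonneg : 0 ≤ p
  p_lt_two : p < 2

namespace Model

variable (D : Model)

def sqrtA : ℂˣ := Units.mk0 (Real.sqrt D.a : ℂ) (by
  simpa using (Real.sqrt_pos.2 D.a_pos).ne')

def sqrtB : ℂˣ := Units.mk0 (Real.sqrt D.b : ℂ) (by
  simpa using (Real.sqrt_pos.2 D.b_pos).ne')

/-- The image of the energy space under `(w', t w) ↦ (√a w', √b t w)`. -/
def space : Submodule ℂ L2Pair :=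
  energySpace.map (scaleEquiv D.sqrtA D.sqrtB : L2Pair →ₗ[ℂ] L2Pair)

instance : CompleteSpace D.space := by
  refine IsClosed.completeSpace_coe (hs := ?_)
  have h : IsClosed (energySpace : Set L2Pair) := Submodule.isClosed_topologicalClosure _
  rw [space, Submodule.map_coe]
  exact (scaleEquiv D.sqrtA D.sqrtB).toHomeomorph.isClosedMap _ h

/-- The Hilbert space of the form `∫ {a |w'|² + b t² |w|²}`. -/
def HSpace : Type := D.space

instance : NormedAddCommGroup D.HSpace := inferInstanceAs (NormedAddCommGroup D.space)

instance : InnerProductSpace ℂ D.HSpace := inferInstanceAs (InnerProductSpace ℂ D.space)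

instance : CompleteSpace D.HSpace := inferInstanceAs (CompleteSpace D.space)

/-- The elements of the form space as pairs `(√a w', √b t w)`. -/
def incl : D.HSpace →ₗᵢ[ℂ] L2Pair := D.space.subtypeₗᵢ

instance : CoeOut D.HSpace L2Pair := ⟨D.incl⟩

theorem incl_mem (z : D.HSpace) : (z : L2Pair) ∈ D.space := z.2

/-- The energy space and its rescaled copy are isomorphic. -/
def spaceEquiv : energySpace ≃L[ℂ] D.HSpace :=
  (scaleEquiv D.sqrtA D.sqrtB).submoduleMap energySpace

/-- The vector that represents the evaluation of `w` at `t`. -/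
def rep (t : ℝ) : L2Pair := WithLp.toLp 2 (((Real.sqrt D.a)⁻¹ : ℝ) • chi t, 0)

/-- The function `w` with `z = (√a w', √b t w)`. -/
def profile (z : L2Pair) (t : ℝ) : ℂ := inner ℂ (D.rep t) z

theorem profile_eq (z : L2Pair) (t : ℝ) :
    D.profile z t = ((Real.sqrt D.a)⁻¹ : ℝ) * inner ℂ (chi t) z.fst := by
  simp only [profile, rep, WithLp.prod_inner_apply, inner_zero_left, add_zero]
  rw [inner_smul_left_eq_smul, Complex.real_smul]
  rfl

theorem norm_rep_sub_sq_le (s t : ℝ) : ‖D.rep t - D.rep s‖ ^ 2 ≤ |t - s| / D.a := by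
  rw [WithLp.prod_norm_sq_eq_of_L2]
  simp only [rep, WithLp.sub_fst, WithLp.sub_snd, WithLp.toLp_fst, WithLp.toLp_snd, sub_zero,
    norm_zero, ← smul_sub, norm_smul, mul_pow]
  rw [Real.norm_of_nonneg (by positivity), inv_pow, Real.sq_sqrt D.a_pos.le]
  have := norm_chi_sub_sq_le s t
  have ha := D.a_pos
  rw [div_eq_inv_mul]
  norm_num
  gcongr

theorem rep_of_nonpos {t : ℝ} (ht : t ≤ 0) : D.rep t = 0 := by
  simp [rep, chi_of_nonpos ht]

theorem norm_rep_sq_le {t : ℝ} (ht : 0 ≤ t) : ‖D.rep t‖ ^ 2 ≤ t / D.a := by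
  simpa [D.rep_of_nonpos le_rfl, abs_of_nonneg ht] using D.norm_rep_sub_sq_le 0 t

theorem continuous_rep : Continuous D.rep :=
  (WithLp.prod_continuous_toLp 2 L2 L2).comp
    ((continuous_chi.const_smul (Real.sqrt D.a)⁻¹).prodMk (continuous_const (y := (0 : L2))))

theorem continuous_profile (z : L2Pair) : Continuous (D.profile z) :=
  D.continuous_rep.inner continuous_const

theorem profile_of_nonpos (z : L2Pair) {t : ℝ} (ht : t ≤ 0) : D.profile z t = 0 := by
  rw [profile, D.rep_of_nonpos ht, inner_zero_left]

theorem profile_add (z z' : L2Pair) (t : ℝ) :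
    D.profile (z + z') t = D.profile z t + D.profile z' t := inner_add_right _ _ _

theorem profile_smul (c : ℂ) (z : L2Pair) (t : ℝ) :
    D.profile (c • z) t = c * D.profile z t := inner_smul_right _ _ _

/-- Cauchy–Schwarz against the difference of the two evaluation vectors. This equicontinuity on
bounded sets drives the compactness argument. -/
theorem profile_sub_sq_le (z : L2Pair) (s t : ℝ) :
    ‖D.profile z t - D.profile z s‖ ^ 2 ≤ |t - s| / D.a * ‖z‖ ^ 2 := by
  rw [profile, profile, ← inner_sub_left]
  calc _ ≤ (‖D.rep t - D.rep s‖ * ‖z‖) ^ 2 := by gcongr; exact norm_inner_le_norm _ _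
    _ = ‖D.rep t - D.rep s‖ ^ 2 * ‖z‖ ^ 2 := mul_pow _ _ _
    _ ≤ _ := by gcongr; exact D.norm_rep_sub_sq_le s t

theorem profile_sq_le (z : L2Pair) {t : ℝ} (ht : 0 ≤ t) :
    ‖D.profile z t‖ ^ 2 ≤ t / D.a * ‖z‖ ^ 2 := by
  simpa [D.profile_of_nonpos z le_rfl, abs_of_nonneg ht] using D.profile_sub_sq_le z 0 t

theorem space_snd {z : L2Pair} (hz : z ∈ D.space) :
    z.snd =ᵐ[volume.restrict (Ioi (0 : ℝ))]
      fun t => (Real.sqrt D.b : ℂ) * (t * D.profile z t) := by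
  obtain ⟨x, hx, rfl⟩ := hz
  filter_upwards [energySpace_snd hx, Lp.coeFn_smul (D.sqrtB : ℂ) x.snd] with t h1 h2
  change (scaleEquiv D.sqrtA D.sqrtB x).snd t = _ * (_ * D.profile (scaleEquiv D.sqrtA D.sqrtB x) t)
  rw [profile_eq, scaleEquiv_snd, scaleEquiv_fst, h2, Pi.smul_apply, h1, inner_smul_right]
  have hne : (Real.sqrt D.a : ℂ) ≠ 0 := D.sqrtA.ne_zero
  simp only [sqrtA, sqrtB, Units.val_mk0, Complex.ofReal_inv, smul_eq_mul]
  field_simp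

theorem exists_embed {φ : ℝ → ℂ} (hφ : IsTest φ) : ∃ z : D.HSpace,
    ((z : L2Pair).fst =ᵐ[volume.restrict (Ioi (0 : ℝ))] fun t => (Real.sqrt D.a : ℂ) * deriv φ t) ∧
    ((z : L2Pair).snd =ᵐ[volume.restrict (Ioi (0 : ℝ))] fun t => (Real.sqrt D.b : ℂ) * (t * φ t)) ∧
    ∀ t, D.profile z t = φ t := by
  obtain ⟨x, hx, hr⟩ := exists_represents hφ
  obtain ⟨z, hz⟩ : ∃ z : D.HSpace, (z : L2Pair) = scaleEquiv D.sqrtA D.sqrtB x :=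
    ⟨⟨_, x, hx, rfl⟩, rfl⟩
  refine ⟨z, ?_, ?_, ?_⟩ <;> simp only [hz]
  · filter_upwards [hr.1, Lp.coeFn_smul (D.sqrtA : ℂ) x.fst] with t h1 h2
    rw [scaleEquiv_fst, h2, Pi.smul_apply, h1]; rfl
  · filter_upwards [hr.2, Lp.coeFn_smul (D.sqrtB : ℂ) x.snd] with t h1 h2
    rw [scaleEquiv_snd, h2, Pi.smul_apply, h1]; rfl
  · intro t
    rw [profile_eq, scaleEquiv_fst, inner_smul_right, hr.inner_chi hφ]
    have hne : (Real.sqrt D.a : ℂ) ≠ 0 := D.sqrtA.ne_zero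
    simp only [sqrtA, Units.val_mk0, Complex.ofReal_inv]
    field_simp

/-- A test function `φ` as the pair `(√a φ', √b t φ)`. -/
def embed {φ : ℝ → ℂ} (hφ : IsTest φ) : D.HSpace := (D.exists_embed hφ).choose

theorem embed_fst {φ : ℝ → ℂ} (hφ : IsTest φ) :
    (D.embed hφ : L2Pair).fst =ᵐ[volume.restrict (Ioi (0 : ℝ))]
      fun t => (Real.sqrt D.a : ℂ) * deriv φ t := (D.exists_embed hφ).choose_spec.1

theorem embed_snd {φ : ℝ → ℂ} (hφ : IsTest φ) :
    (D.embed hφ : L2Pair).snd =ᵐ[volume.restrict (Ioi (0 : ℝ))]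
      fun t => (Real.sqrt D.b : ℂ) * (t * φ t) := (D.exists_embed hφ).choose_spec.2.1

theorem profile_embed {φ : ℝ → ℂ} (hφ : IsTest φ) (t : ℝ) : D.profile (D.embed hφ) t = φ t :=
  (D.exists_embed hφ).choose_spec.2.2 t

theorem norm_sq_snd {z : L2Pair} (hz : z ∈ D.space) :
    IntegrableOn (fun t => t ^ 2 * ‖D.profile z t‖ ^ 2) (Ioi 0) ∧
    D.b * ∫ t in Ioi (0 : ℝ), t ^ 2 * ‖D.profile z t‖ ^ 2 = ‖z.snd‖ ^ 2 := by
  have h : (fun t => ‖z.snd t‖ ^ 2) =ᵐ[volume.restrict (Ioi (0 : ℝ))]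
      fun t => D.b * (t ^ 2 * ‖D.profile z t‖ ^ 2) := by
    filter_upwards [D.space_snd hz] with t ht
    rw [ht, norm_mul, norm_mul, mul_pow, mul_pow, Complex.norm_real, Complex.norm_real,
      Real.norm_eq_abs, Real.norm_eq_abs, sq_abs, sq_abs, Real.sq_sqrt D.b_pos.le]
  constructor
  · have h1 : IntegrableOn (fun t => D.b * (t ^ 2 * ‖D.profile z t‖ ^ 2)) (Ioi 0) :=
      (integrable_norm_sq_L2 z.snd).congr h
    have h2 := h1.const_mul (D.b)⁻¹
    refine h2.congr (Eventually.of_forall fun t => ?_)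
    have := D.b_pos.ne'
    field_simp
  · rw [norm_sq_L2, integral_congr_ae h, integral_const_mul]

theorem integral_sq_mul_profile_sq_le {z : L2Pair} (hz : z ∈ D.space) :
    ∫ t in Ioi (0 : ℝ), t ^ 2 * ‖D.profile z t‖ ^ 2 ≤ ‖z‖ ^ 2 / D.b := by
  rw [le_div_iff₀' D.b_pos, (D.norm_sq_snd hz).2, WithLp.prod_norm_sq_eq_of_L2]
  linarith [sq_nonneg ‖z.fst‖]

end Model

/-! ### Compactness of multiplication operators -/

theorem integrableOn_indicator_Ioc (x y c : ℝ) :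
    IntegrableOn ((Ioc x y).indicator fun _ => c) (Ioi 0) :=
  (((integrableOn_const (by simp)).integrable_indicator measurableSet_Ioc)).integrableOn

theorem isCompactOperator_of_forall_approx {E F : Type*} [NormedAddCommGroup E] [NormedSpace ℂ E]
    [NormedAddCommGroup F] [NormedSpace ℂ F] [CompleteSpace F] (T : E →L[ℂ] F)
    (h : ∀ δ > 0, ∃ S : E →L[ℂ] F, IsCompactOperator S ∧ ∀ z, ‖(T - S) z‖ ≤ δ * ‖z‖) :
    IsCompactOperator T := by
  have hcl : T ∈ closure {S : E →L[ℂ] F | IsCompactOperator S} := by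
    rw [Metric.mem_closure_iff]
    intro δ hδ
    obtain ⟨S, hS, hest⟩ := h (δ / 2) (half_pos hδ)
    refine ⟨S, hS, ?_⟩
    rw [dist_eq_norm]
    exact (ContinuousLinearMap.opNorm_le_bound _ (half_pos hδ).le hest).trans_lt (half_lt_self hδ)
  rwa [isClosed_setOfPred_isCompactOperator.closure_eq] at hcl

namespace Model

variable (D : Model)

/-- Weights of at most linear growth. -/
structure LinearGrowth (θ : ℝ → ℝ) (C : ℝ) : Prop where
  measurable : Measurable θ
  le : ∀ t, 0 < t → |θ t| ≤ C * (1 + t)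

theorem LinearGrowth.nonneg {θ : ℝ → ℝ} {C : ℝ} (h : LinearGrowth θ C) : 0 ≤ C := by
  have := (abs_nonneg _).trans (h.le 1 one_pos)
  linarith

theorem aestronglyMeasurable_mul_profile {θ : ℝ → ℝ} (hθ : Measurable θ) (z : L2Pair)
    (m : Measure ℝ) : AEStronglyMeasurable (fun t => (θ t : ℂ) * D.profile z t) m :=
  ((Complex.measurable_ofReal.comp hθ).mul (D.continuous_profile z).measurable).aestronglyMeasurable

/-- The form does not control |w|² directly near 0, so the half line is cut at 1. On (0, 1] the
pointwise bound |w|² ≤ t‖z‖²/a is used; beyond 1 one has 1 + t ≤ 2t, and t²|w|² takes over. -/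
theorem norm_sq_mul_profile_le {θ : ℝ → ℝ} {C : ℝ} (hθ : LinearGrowth θ C) (z : L2Pair) {t : ℝ}
    (ht : 0 < t) : ‖(θ t : ℂ) * D.profile z t‖ ^ 2 ≤
      (Ioc 0 1).indicator (fun _ => 4 * C ^ 2 * (1 / D.a * ‖z‖ ^ 2)) t
        + 4 * C ^ 2 * (t ^ 2 * ‖D.profile z t‖ ^ 2) := by
  have ha := D.a_pos
  have hθ2 : θ t ^ 2 ≤ C ^ 2 * (1 + t) ^ 2 := by
    rw [← mul_pow, ← sq_abs]
    exact pow_le_pow_left₀ (abs_nonneg _) (hθ.le t ht) 2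
  rw [norm_mul, mul_pow, Complex.norm_real, Real.norm_eq_abs, sq_abs]
  have h1 : θ t ^ 2 * ‖D.profile z t‖ ^ 2 ≤ C ^ 2 * (1 + t) ^ 2 * ‖D.profile z t‖ ^ 2 := by
    gcongr
  by_cases h : t ≤ 1
  · rw [indicator_of_mem (show t ∈ Ioc (0 : ℝ) 1 from ⟨ht, h⟩)]
    have h2 : ‖D.profile z t‖ ^ 2 ≤ 1 / D.a * ‖z‖ ^ 2 :=
      (D.profile_sq_le z ht.le).trans (by gcongr)
    have h3 : C ^ 2 * (1 + t) ^ 2 * ‖D.profile z t‖ ^ 2 ≤ C ^ 2 * (1 + 1) ^ 2 *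
        (1 / D.a * ‖z‖ ^ 2) := by gcongr
    have h4 : 0 ≤ 4 * C ^ 2 * (t ^ 2 * ‖D.profile z t‖ ^ 2) := by positivity
    linarith
  · rw [indicator_of_notMem (fun hh => h hh.2), zero_add]
    have h3 : C ^ 2 * (1 + t) ^ 2 * ‖D.profile z t‖ ^ 2 ≤ C ^ 2 * (2 * t) ^ 2 *
        ‖D.profile z t‖ ^ 2 := by gcongr; linarith
    linarith

theorem integrableOn_growth_bound (C : ℝ) {z : L2Pair} (hz : z ∈ D.space) :
    IntegrableOn (fun t => (Ioc 0 1).indicator (fun _ => 4 * C ^ 2 * (1 / D.a * ‖z‖ ^ 2)) t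
        + 4 * C ^ 2 * (t ^ 2 * ‖D.profile z t‖ ^ 2)) (Ioi 0) := by
  refine Integrable.add ?_ ((D.norm_sq_snd hz).1.const_mul _)
  exact integrableOn_indicator_Ioc _ _ _

theorem memLp_mul_profile {θ : ℝ → ℝ} {C : ℝ} (hθ : LinearGrowth θ C) {z : L2Pair}
    (hz : z ∈ D.space) : MemLp (fun t => (θ t : ℂ) * D.profile z t) 2
      (volume.restrict (Ioi (0 : ℝ))) :=
  memLp_two_of_norm_sq_le (D.aestronglyMeasurable_mul_profile hθ.measurable z _)
    (D.integrableOn_growth_bound C hz)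
    ((ae_restrict_iff' measurableSet_Ioi).2 (Eventually.of_forall fun _ ht =>
      D.norm_sq_mul_profile_le hθ z ht))

theorem norm_sq_toLp_mul_profile_le {θ : ℝ → ℝ} {C : ℝ} (hθ : LinearGrowth θ C) {z : L2Pair}
    (hz : z ∈ D.space) :
    ‖(D.memLp_mul_profile hθ hz).toLp _‖ ^ 2 ≤ 4 * C ^ 2 * (1 / D.a + 1 / D.b) * ‖z‖ ^ 2 := by
  refine (norm_sq_toLp_le _ (D.integrableOn_growth_bound C hz)
    ((ae_restrict_iff' measurableSet_Ioi).2 (Eventually.of_forall fun _ ht =>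
      D.norm_sq_mul_profile_le hθ z ht))).trans ?_
  have h : IntegrableOn ((Ioc (0 : ℝ) 1).indicator
      (fun _ => 4 * C ^ 2 * (1 / D.a * ‖z‖ ^ 2))) (Ioi 0) :=
    integrableOn_indicator_Ioc _ _ _
  rw [integral_add h ((D.norm_sq_snd hz).1.const_mul _), integral_const_mul,
    integral_indicator measurableSet_Ioc, Measure.restrict_restrict measurableSet_Ioc,
    inter_eq_left.2 fun s hs => hs.1]
  have := D.integral_sq_mul_profile_sq_le hz
  have h2 : 4 * C ^ 2 * ∫ t in Ioi (0 : ℝ), t ^ 2 * ‖D.profile z t‖ ^ 2 ≤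
    4 * C ^ 2 * (‖z‖ ^ 2 / D.b) := by gcongr
  simp only [integral_const, measureReal_restrict_apply_univ, Real.volume_real_Ioc, smul_eq_mul]
  norm_num
  calc _ ≤ 4 * C ^ 2 * (D.a⁻¹ * ‖z‖ ^ 2) + 4 * C ^ 2 * (‖z‖ ^ 2 / D.b) := by linarith
    _ = _ := by ring

/-- The operator `z = (√a w', √b t w) ↦ θ w`. -/
def mulOp {θ : ℝ → ℝ} {C : ℝ} (hθ : LinearGrowth θ C) : D.HSpace →L[ℂ] L2 :=
  LinearMap.mkContinuous
    { toFun := fun z => (D.memLp_mul_profile hθ (D.incl_mem z)).toLp _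
      map_add' := fun z z' => by
        rw [← MemLp.toLp_add]
        congr 1
        ext t
        simp only [map_add, profile_add, Pi.add_apply]; ring
      map_smul' := fun c z => by
        rw [RingHom.id_apply, ← MemLp.toLp_const_smul]
        congr 1
        ext t
        simp only [map_smul, profile_smul, Pi.smul_apply, smul_eq_mul]; ring }
    (Real.sqrt (4 * C ^ 2 * (1 / D.a + 1 / D.b))) fun z => by
      have h1 : 0 ≤ 4 * C ^ 2 * (1 / D.a + 1 / D.b) := by
        have := D.a_pos; have := D.b_pos; positivity
      refine abs_le_of_sq_le_sq' ?_ (by positivity) |>.2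
      rw [mul_pow, Real.sq_sqrt h1]
      have h2 := D.norm_sq_toLp_mul_profile_le hθ (D.incl_mem z)
      rwa [D.incl.norm_map] at h2

theorem coeFn_mulOp {θ : ℝ → ℝ} {C : ℝ} (hθ : LinearGrowth θ C) (z : D.HSpace) :
    D.mulOp hθ z =ᵐ[volume.restrict (Ioi (0 : ℝ))] fun t => (θ t : ℂ) * D.profile z t :=
  (D.memLp_mul_profile hθ (D.incl_mem z)).coeFn_toLp

/-- Evaluation of the profile at `t`. -/
def evalAt (t : ℝ) : D.HSpace →L[ℂ] ℂ := (innerSL ℂ (D.rep t)).comp D.incl.toContinuousLinearMap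

theorem evalAt_apply (t : ℝ) (z : D.HSpace) : D.evalAt t z = D.profile z t := rfl

theorem isCompactOperator_sum_smulRight {ι : Type*} (s : Finset ι) (f : ι → (D.HSpace →L[ℂ] ℂ))
    (e : ι → L2) : IsCompactOperator (∑ i ∈ s, (f i).smulRight (e i) : D.HSpace →L[ℂ] L2) := by
  classical
  induction s using Finset.induction_on with
  | empty => simpa using! isCompactOperator_zero
  | insert i s hi ih =>
    rw [Finset.sum_insert hi]
    refine IsCompactOperator.add ?_ ih
    exact (isCompactOperator_of_locallyCompactSpace_dom (f i)).clm_comp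
      (ContinuousLinearMap.toSpanSingleton ℂ (e i))

/-- Approximation of `z ↦ θ w` by step functions. -/
theorem exists_finite_rank_approx {θ : ℝ → ℝ} {C : ℝ} (hθ : LinearGrowth θ C) {ε R : ℝ}
    (hR : 0 < R) (hε : ∀ t, R < t → |θ t| ≤ ε * t) {N : ℕ} (hN : 0 < N) :
    ∃ F : D.HSpace →L[ℂ] L2, IsCompactOperator F ∧ ∀ z, ‖(D.mulOp hθ - F) z‖ ^ 2 ≤
      (C ^ 2 * (1 + R) ^ 2 * (R / N / D.a) * R + ε ^ 2 / D.b) * ‖z‖ ^ 2 := by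
  have ha := D.a_pos
  have hb := D.b_pos
  have hC := hθ.nonneg
  set h : ℝ := R / N with hh
  have hNR : (0 : ℝ) < N := by exact_mod_cast hN
  have hpos : 0 < h := by positivity
  -- On each cell of length h = R/N the profile is replaced by its value at the left endpoint, while
  -- θ is kept. The result depends on only N evaluations, so it has finite rank.
  let I : ℕ → Set ℝ := fun k => Ioc (k * h) ((k + 1) * h)
  have hI : ∀ k, MeasurableSet (I k) := fun k => measurableSet_Ioc
  have hmem : ∀ k, MemLp ((I k).indicator fun t => (θ t : ℂ)) 2 (volume.restrict (Ioi (0 : ℝ))) := by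
    intro k
    refine memLp_two_of_norm_sq_le (g := (I k).indicator fun _ => (C * (1 + (k + 1) * h)) ^ 2)
      ((Complex.measurable_ofReal.comp hθ.measurable).indicator (hI k)).aestronglyMeasurable
      (integrableOn_indicator_Ioc _ _ _)
      ((ae_restrict_iff' measurableSet_Ioi).2 (Eventually.of_forall fun t ht => ?_))
    by_cases hk : t ∈ I k
    · rw [indicator_of_mem hk, indicator_of_mem hk, Complex.norm_real, Real.norm_eq_abs]
      have := hθ.le t ht
      have h2 : C * (1 + t) ≤ C * (1 + (k + 1) * h) := by gcongr; exact hk.2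
      gcongr
      linarith
    · simp [indicator_of_notMem hk]
  let e : ℕ → L2 := fun k => (hmem k).toLp _
  refine ⟨∑ k ∈ Finset.range N, (D.evalAt (k * h)).smulRight (e k),
    D.isCompactOperator_sum_smulRight _ _ _, fun z => ?_⟩
  set G : ℝ → ℂ := fun t => (θ t : ℂ) * D.profile z t
    - ∑ k ∈ Finset.range N, D.profile z (k * h) * (I k).indicator (fun t => (θ t : ℂ)) t with hG
  have hcoe : ((D.mulOp hθ - ∑ k ∈ Finset.range N, (D.evalAt (k * h)).smulRight (e k)) z : L2)
      =ᵐ[volume.restrict (Ioi (0 : ℝ))] G := by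
    have h1 : ∀ s : Finset ℕ, ((∑ k ∈ s, (D.profile z (k * h)) • e k : L2) : ℝ → ℂ)
        =ᵐ[volume.restrict (Ioi (0 : ℝ))]
        fun t => ∑ k ∈ s, D.profile z (k * h) * (I k).indicator (fun t => (θ t : ℂ)) t := by
      intro s
      classical
      induction s using Finset.induction_on with
      | empty =>
        simp only [Finset.sum_empty]
        exact Lp.coeFn_zero ℂ 2 (volume.restrict (Ioi (0 : ℝ)))
      | insert k s hk ih =>
        simp only [Finset.sum_insert hk]
        filter_upwards [ih, Lp.coeFn_add (D.profile z (k * h) • e k)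
          (∑ k ∈ s, (D.profile z (k * h)) • e k), Lp.coeFn_smul (D.profile z (k * h)) (e k),
          (hmem k).coeFn_toLp] with t h1 h2 h3 h4
        rw [h2, Pi.add_apply, h1, h3, Pi.smul_apply, h4, smul_eq_mul]
    simp only [_root_.sub_apply, _root_.sum_apply, ContinuousLinearMap.smulRight_apply,
      evalAt_apply]
    filter_upwards [Lp.coeFn_sub (D.mulOp hθ z)
      (∑ k ∈ Finset.range N, (D.profile z (k * h)) • e k), D.coeFn_mulOp hθ z,
      h1 (Finset.range N)] with t h1 h2 h3
    rw [h1, Pi.sub_apply, h2, h3]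
  have hin : ∀ t ∈ Ioc 0 R, ‖G t‖ ^ 2 ≤ C ^ 2 * (1 + R) ^ 2 * (h / D.a * ‖z‖ ^ 2) := by
    intro t ht
    have hth : 0 < t / h := div_pos ht.1 hpos
    -- The cells are open on the left, so the index is the ceiling minus one.
    obtain ⟨k, hk⟩ : ∃ k, ⌈t / h⌉₊ = k + 1 := Nat.exists_eq_succ_of_ne_zero (Nat.ceil_pos.2 hth).ne'
    have hk1 : (k : ℝ) * h < t := by
      rw [← lt_div_iff₀ hpos]; exact Nat.lt_ceil.1 (by omega)
    have hk2 : t ≤ ((k : ℝ) + 1) * h := by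
      rw [← div_le_iff₀ hpos]; have := Nat.le_ceil (t / h); rw [hk] at this; exact_mod_cast this
    have hkN : k < N := by
      have : (k : ℝ) * h < N * h := by
        calc _ < t := hk1
          _ ≤ R := ht.2
          _ = N * h := by rw [hh]; field_simp
      exact_mod_cast lt_of_mul_lt_mul_right this hpos.le
    have hGt : G t = (θ t : ℂ) * (D.profile z t - D.profile z (k * h)) := by
      rw [hG]
      simp only
      rw [Finset.sum_eq_single_of_mem k (Finset.mem_range.2 hkN)]
      · rw [indicator_of_mem (show t ∈ I k from ⟨hk1, hk2⟩)]; ring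
      · intro j _ hj
        rw [indicator_of_notMem, mul_zero]
        rintro ⟨hj1, hj2⟩
        have h1 : (j : ℝ) < k + 1 := lt_of_mul_lt_mul_right (hj1.trans_le hk2) hpos.le
        have h2 : (k : ℝ) < j + 1 := lt_of_mul_lt_mul_right (hk1.trans_le hj2) hpos.le
        have h1' : j < k + 1 := by exact_mod_cast h1
        have h2' : k < j + 1 := by exact_mod_cast h2
        omega
    rw [hGt, norm_mul, mul_pow, Complex.norm_real, Real.norm_eq_abs]
    have h1 : |θ t| ^ 2 ≤ C ^ 2 * (1 + R) ^ 2 := by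
      rw [← mul_pow]
      refine pow_le_pow_left₀ (abs_nonneg _) ((hθ.le t ht.1).trans ?_) 2
      gcongr
      exact ht.2
    have h2 : ‖D.profile z t - D.profile z (k * h)‖ ^ 2 ≤ h / D.a * ‖z‖ ^ 2 := by
      refine (D.profile_sub_sq_le z (k * h) t).trans ?_
      have : |t - k * h| ≤ h := by rw [abs_of_pos (by linarith)]; linarith
      gcongr
      rfl
    gcongr
  have hout : ∀ t, R < t → ‖G t‖ ^ 2 ≤ ε ^ 2 * (t ^ 2 * ‖D.profile z t‖ ^ 2) := by
    intro t ht
    have hGt : G t = (θ t : ℂ) * D.profile z t := by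
      rw [hG]
      simp only
      rw [Finset.sum_eq_zero, sub_zero]
      intro j hj
      rw [indicator_of_notMem, mul_zero]
      rintro ⟨-, hj2⟩
      have : ((j : ℝ) + 1) * h ≤ N * h := by
        gcongr
        exact_mod_cast Finset.mem_range.1 hj
      have h3 : N * h = R := by rw [hh]; field_simp
      linarith
    rw [hGt, norm_mul, mul_pow, Complex.norm_real, Real.norm_eq_abs, ← mul_assoc, ← mul_pow ε t]
    exact mul_le_mul_of_nonneg_right (pow_le_pow_left₀ (abs_nonneg _) (hε t ht) 2) (sq_nonneg _)
  rw [norm_sq_L2]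
  have hint : IntegrableOn ((Ioc 0 R).indicator
      (fun _ => C ^ 2 * (1 + R) ^ 2 * (h / D.a * ‖z‖ ^ 2))) (Ioi 0) :=
    integrableOn_indicator_Ioc _ _ _
  have hint2 := (D.norm_sq_snd (D.incl_mem z)).1.const_mul (ε ^ 2)
  calc _ ≤ ∫ t in Ioi (0 : ℝ), ((Ioc 0 R).indicator
          (fun _ => C ^ 2 * (1 + R) ^ 2 * (h / D.a * ‖z‖ ^ 2)) t
          + ε ^ 2 * (t ^ 2 * ‖D.profile z t‖ ^ 2)) := by
        refine integral_mono_ae (integrable_norm_sq_L2 _) (hint.add hint2) ?_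
        filter_upwards [hcoe, ae_restrict_mem measurableSet_Ioi] with t ht ht0
        rw [ht]
        by_cases htR : t ≤ R
        · rw [indicator_of_mem (show t ∈ Ioc 0 R from ⟨ht0, htR⟩)]
          have := hin t ⟨ht0, htR⟩
          have h4 : 0 ≤ ε ^ 2 * (t ^ 2 * ‖D.profile z t‖ ^ 2) := by positivity
          linarith
        · rw [indicator_of_notMem (fun hh => htR hh.2), zero_add]
          exact hout t (not_le.1 htR)
    _ = C ^ 2 * (1 + R) ^ 2 * (h / D.a * ‖z‖ ^ 2) * R +
          ε ^ 2 * ∫ t in Ioi (0 : ℝ), t ^ 2 * ‖D.profile z t‖ ^ 2 := by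
        rw [integral_add hint hint2, integral_const_mul, integral_indicator measurableSet_Ioc,
          Measure.restrict_restrict measurableSet_Ioc, inter_eq_left.2 fun s hs => hs.1]
        simp [hR.le, mul_comm]
    _ ≤ C ^ 2 * (1 + R) ^ 2 * (h / D.a * ‖z‖ ^ 2) * R + ε ^ 2 * (‖(z : L2Pair)‖ ^ 2 / D.b) := by
        gcongr
        exact D.integral_sq_mul_profile_sq_le (D.incl_mem z)
    _ = _ := by
      rw [D.incl.norm_map]; ring

theorem isCompactOperator_mulOp {θ : ℝ → ℝ} {C : ℝ} (hθ : LinearGrowth θ C)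
    (h : ∀ ε > 0, ∃ R > 0, ∀ t, R < t → |θ t| ≤ ε * t) : IsCompactOperator (D.mulOp hθ) := by
  have ha := D.a_pos
  have hb := D.b_pos
  refine isCompactOperator_of_forall_approx _ fun δ hδ => ?_
  -- The squared error budget δ² is split in halves: ε makes the tail beyond R cost exactly δ²/2,
  -- and N is then taken large enough for the cells in (0, R].
  have hε : 0 < Real.sqrt (D.b * (δ ^ 2 / 2)) := Real.sqrt_pos.2 (by positivity)
  obtain ⟨R, hR, hRε⟩ := h _ hε
  obtain ⟨N, hN⟩ := exists_nat_gt (C ^ 2 * (1 + R) ^ 2 * (R / D.a) * R / (δ ^ 2 / 2))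
  have hN0 : 0 < N := by
    have : 0 ≤ C ^ 2 * (1 + R) ^ 2 * (R / D.a) * R / (δ ^ 2 / 2) := by positivity
    exact_mod_cast this.trans_lt hN
  obtain ⟨F, hF, hest⟩ := D.exists_finite_rank_approx hθ hR hRε hN0
  refine ⟨F, hF, fun z => abs_le_of_sq_le_sq' ((hest z).trans ?_) (by positivity) |>.2⟩
  rw [mul_pow]
  gcongr
  rw [Real.sq_sqrt (by positivity)]
  have hNR : (0 : ℝ) < N := by exact_mod_cast hN0
  have h1 : C ^ 2 * (1 + R) ^ 2 * (R / N / D.a) * R ≤ δ ^ 2 / 2 := by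
    rw [div_lt_iff₀ (by positivity)] at hN
    calc _ = (C ^ 2 * (1 + R) ^ 2 * (R / D.a) * R) / N := by field_simp
      _ ≤ _ := by rw [div_le_iff₀ hNR]; linarith
  have h2 : D.b * (δ ^ 2 / 2) / D.b = δ ^ 2 / 2 := by field_simp
  rw [h2]
  linarith

end Model

/-! ### Integration by parts and the lemma of du Bois-Reymond -/

theorem IsTest.exists_Icc {φ : ℝ → ℂ} (hφ : IsTest φ) :
    ∃ α β : ℝ, 0 < α ∧ α ≤ β ∧ tsupport φ ⊆ Icc α β := by
  -- Adding the point 1 makes the compact set nonempty when φ vanishes and keeps it inside the open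
  -- half line.
  have hK : IsCompact (insert 1 (tsupport φ)) := IsCompact.insert hφ.2.1 1
  obtain ⟨α, hα, hα'⟩ := hK.exists_isLeast (insert_nonempty _ _)
  obtain ⟨β, hβ, hβ'⟩ := hK.exists_isGreatest (insert_nonempty _ _)
  refine ⟨α, β, ?_, hα' hβ, fun t ht => ⟨hα' (mem_insert_of_mem _ ht), hβ' (mem_insert_of_mem _ ht)⟩⟩
  rcases hα with rfl | hα
  · exact one_pos
  · exact hφ.2.2 hα

theorem IsTest.integrableOn_mul {φ : ℝ → ℂ} (hφ : IsTest φ) {f : ℝ → ℂ}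
    (hf : LocallyIntegrableOn f (Ioi 0)) : IntegrableOn (fun t => φ t * f t) (Ioi 0) := by
  have h1 : IntegrableOn f (tsupport φ) := hf.integrableOn_compact_subset hφ.2.2 hφ.2.1
  have h2 : IntegrableOn (fun t => φ t * f t) (tsupport φ) :=
    h1.continuousOn_mul hφ.1.continuous.continuousOn hφ.2.1
  have h3 : Integrable (fun t => φ t * f t) := by
    rwa [integrableOn_iff_integrable_of_support_subset] at h2
    intro t ht
    exact subset_tsupport φ (left_ne_zero_of_mul ht)
  exact h3.integrableOn

theorem IsTest.setIntegral_eq {φ : ℝ → ℂ} (hφ : IsTest φ) (f : ℝ → ℂ) :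
    ∫ t in Ioi (0 : ℝ), φ t * f t = ∫ t, φ t * f t := by
  refine setIntegral_eq_integral_of_forall_compl_eq_zero fun x hx => ?_
  rw [hφ.eq_zero (not_lt.1 hx), zero_mul]

theorem IsTest.integral_by_parts {φ : ℝ → ℂ} (hφ : IsTest φ) {f f' : ℝ → ℂ}
    (hf : ∀ t, HasDerivAt f (f' t) t) (hf' : Continuous f') :
    ∫ t in Ioi (0 : ℝ), _root_.deriv φ t * f t = - ∫ t in Ioi (0 : ℝ), φ t * f' t := by
  have hfc : Continuous f := continuous_iff_continuousAt.2 fun t => (hf t).continuousAt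
  have hi : ∀ {ψ : ℝ → ℂ}, IsTest ψ → ∀ {g : ℝ → ℂ}, Continuous g → Integrable fun t => ψ t * g t :=
    fun hψ _ hg => (hψ.1.continuous.mul hg).integrable_of_hasCompactSupport hψ.2.1.mul_right
  rw [hφ.deriv.setIntegral_eq, hφ.setIntegral_eq]
  have := integral_mul_deriv_eq_deriv_mul_of_integrable (u := φ) (v := f) (u' := _root_.deriv φ) (v' := f')
    (fun x _ => ((hφ.1.differentiable (by simp)) x).hasDerivAt) (fun x _ => hf x)
    (hi hφ hf') (hi hφ.deriv hfc) (hi hφ hfc)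
  rw [this, neg_neg]

/-- A test function with vanishing integral is the derivative of a test function. -/
theorem IsTest.exists_primitive {h : ℝ → ℝ} (hh : IsTest fun t => (h t : ℂ))
    (h0 : ∫ t, h t = 0) : ∃ H : ℝ → ℝ, IsTest (fun t => (H t : ℂ)) ∧ ∀ t, HasDerivAt H (h t) t := by
  have hreal : h = fun t => ((h t : ℂ)).re := by ext; simp
  have hsm : ContDiff ℝ ∞ h := by
    rw [hreal]; exact Complex.reCLM.contDiff.comp hh.1
  have hc := hsm.continuous
  obtain ⟨α, β, hα, hαβ, hsub⟩ := hh.exists_Icc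
  have hz : ∀ t, t ∉ Icc α β → h t = 0 := fun t ht => by
    have := image_eq_zero_of_notMem_tsupport (f := fun t => (h t : ℂ)) fun hh => ht (hsub hh)
    exact_mod_cast this
  set H : ℝ → ℝ := fun t => ∫ s in (0 : ℝ)..t, h s with hH
  have hd : ∀ t, HasDerivAt H (h t) t := fun t => hc.integral_hasStrictDerivAt 0 t |>.hasDerivAt
  -- Left of α nothing has been integrated yet; right of β the whole integral has been, and it is
  -- zero.
  have hHz : ∀ t, t ∉ Icc α β → H t = 0 := by
    intro t ht
    rcases lt_or_ge t α with h1 | h1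
    · rw [hH]
      refine intervalIntegral.integral_zero_ae (Eventually.of_forall fun s hs => hz s fun hs' => ?_)
      have : s ≤ max 0 t := hs.2
      have h2 : max 0 t < α := max_lt hα h1
      linarith [hs'.1]
    · have h2 : β < t := by by_contra h; exact ht ⟨h1, not_lt.1 h⟩
      rw [hH]
      have h3 : ∫ s in Ioc 0 t, h s = ∫ s, h s :=
        setIntegral_eq_integral_of_forall_compl_eq_zero fun x hx =>
          hz x fun hx' => hx (mem_Ioc.2 ⟨hα.trans_le hx'.1, hx'.2.trans h2.le⟩)
      simp only
      rw [intervalIntegral.integral_of_le (by linarith), h3, h0]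
  have hsupp : tsupport H ⊆ Icc α β := by
    refine closure_minimal ?_ isClosed_Icc
    intro t ht
    by_contra h
    exact ht (hHz t h)
  refine ⟨H, isTest_ofReal ?_ (HasCompactSupport.of_support_subset_isCompact isCompact_Icc
    ((subset_tsupport H).trans hsupp)) (hsupp.trans fun t ht => hα.trans_le ht.1), hd⟩
  rw [contDiff_infty_iff_deriv]
  refine ⟨fun t => (hd t).differentiableAt, ?_⟩
  rwa [show _root_.deriv H = h from funext fun t => (hd t).deriv]

theorem exists_isTest_integral_one :
    ∃ ψ : ℝ → ℝ, IsTest (fun t => (ψ t : ℂ)) ∧ ∫ t, ψ t = 1 := by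
  let f : ContDiffBump (1 : ℝ) := ⟨1 / 4, 1 / 2, by norm_num, by norm_num⟩
  refine ⟨f.normed volume, isTest_ofReal f.contDiff_normed f.hasCompactSupport_normed ?_,
    f.integral_normed⟩
  rw [f.tsupport_normed_eq]
  intro t ht
  rw [Metric.mem_closedBall, Real.dist_eq, abs_le] at ht
  have h : -(1 / 2 : ℝ) ≤ t - 1 := ht.1
  rw [mem_Ioi]; linarith

/-- The lemma of du Bois-Reymond. -/
theorem ae_eq_const_of_forall_isTest {f : ℝ → ℂ} (hf : LocallyIntegrableOn f (Ioi 0))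
    (h : ∀ g : ℝ → ℝ, IsTest (fun t => (g t : ℂ)) →
      ∫ t in Ioi (0 : ℝ), deriv (fun s => (g s : ℂ)) t * f t = 0) :
    ∃ c : ℂ, f =ᵐ[volume.restrict (Ioi (0 : ℝ))] fun _ => c := by
  obtain ⟨ψ, hψ, hψ1⟩ := exists_isTest_integral_one
  set c := ∫ t in Ioi (0 : ℝ), (ψ t : ℂ) * f t with hc
  refine ⟨c, ?_⟩
  have hconst : LocallyIntegrableOn (fun _ : ℝ => c) (Ioi 0) :=
    (locallyIntegrable_const c).locallyIntegrableOn _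
  have key := ae_eq_zero_of_forall_isTest (f := fun t => f t - c) (hf.sub hconst) fun g hg => by
    have hgr : ∀ {k : ℝ → ℝ}, IsTest (fun t => (k t : ℂ)) → Integrable k := fun {k} hk => by
      have := hk.1.continuous.integrable_of_hasCompactSupport hk.2.1 (μ := volume)
      simpa using this.re
    -- Subtracting (∫ g) ψ removes the mean of g and leaves the derivative of a test function, to
    -- which the hypothesis applies; the subtracted term produces the constant c.
    have hh : IsTest fun t => ((g t - (∫ s, g s) * ψ t : ℝ) : ℂ) := by
      have := hg.add (hψ.mul_left (g := fun _ => -((∫ s, g s : ℝ) : ℂ)) contDiffOn_const)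
      convert this using 2
      push_cast; ring
    obtain ⟨H, hH, hd⟩ := hh.exists_primitive (by
      rw [integral_sub (hgr hg) ((hgr hψ).const_mul _), integral_const_mul, hψ1]; ring)
    have h0 := h H hH
    have hderiv : deriv (fun s => (H s : ℂ)) = fun t => ((g t - (∫ s, g s) * ψ t : ℝ) : ℂ) :=
      funext fun t => (hd t).ofReal_comp.deriv
    rw [hderiv] at h0
    have e1 : ∀ t, ((g t - (∫ s, g s) * ψ t : ℝ) : ℂ) * f t
        = (g t : ℂ) * f t - ((∫ s, g s : ℝ) : ℂ) * ((ψ t : ℂ) * f t) := by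
      intro t; push_cast; ring
    simp only [e1] at h0
    rw [integral_sub (hg.integrableOn_mul hf) ((hψ.integrableOn_mul hf).const_mul _),
      integral_const_mul, ← hc] at h0
    simp only [mul_sub]
    rw [integral_sub (hg.integrableOn_mul hf) (hg.integrableOn_mul hconst),
      integral_mul_const, integral_complex_ofReal,
      setIntegral_eq_integral_of_forall_compl_eq_zero (f := g)]
    · exact h0
    · intro x hx
      exact_mod_cast hg.eq_zero (not_lt.1 hx)
  filter_upwards [key] with t ht
  exact sub_eq_zero.1 ht

theorem locallyIntegrableOn_L2 (f : L2) : LocallyIntegrableOn f (Ioi 0) :=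
  locallyIntegrableOn_of_locallyIntegrable_restrict
    ((Lp.memLp f).locallyIntegrable (by norm_num))

/-! ### The solution operator -/

section Gram

variable {E F : Type*} [NormedAddCommGroup E] [InnerProductSpace ℂ E] [CompleteSpace E]
  [NormedAddCommGroup F] [InnerProductSpace ℂ F] [CompleteSpace F]

/-- The operator `A† A`. -/
def gramOp (A : E →L[ℂ] F) : E →L[ℂ] E := (ContinuousLinearMap.adjoint A).comp A

theorem inner_gramOp (A : E →L[ℂ] F) (x y : E) : inner ℂ x (gramOp A y) = inner ℂ (A x) (A y) := by
  rw [gramOp, ContinuousLinearMap.comp_apply, ContinuousLinearMap.adjoint_inner_right]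

theorem isSymmetric_gramOp (A : E →L[ℂ] F) : (gramOp A : E →ₗ[ℂ] E).IsSymmetric := fun x y => by
  change inner ℂ (gramOp A x) y = inner ℂ x (gramOp A y)
  rw [inner_gramOp, gramOp, ContinuousLinearMap.comp_apply,
    ContinuousLinearMap.adjoint_inner_left]

theorem isCompactOperator_gramOp {A : E →L[ℂ] F} (hA : IsCompactOperator A) :
    IsCompactOperator (gramOp A) :=
  hA.clm_comp (ContinuousLinearMap.adjoint A)

end Gram

namespace Model

variable (D : Model)

/-- The weight `μ t^p`, extended evenly. -/
def weight (t : ℝ) : ℝ := D.μ * |t| ^ D.p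

theorem weight_of_pos {t : ℝ} (ht : 0 < t) : D.weight t = D.μ * t ^ D.p := by
  rw [weight, abs_of_pos ht]

theorem weight_nonneg (t : ℝ) : 0 ≤ D.weight t := by
  have := D.μ_pos
  exact mul_nonneg this.le (Real.rpow_nonneg (abs_nonneg t) _)

theorem weight_pos {t : ℝ} (ht : 0 < t) : 0 < D.weight t := by
  rw [D.weight_of_pos ht]
  exact mul_pos D.μ_pos (Real.rpow_pos_of_pos ht _)

theorem continuous_weight : Continuous D.weight :=
  continuous_const.mul (continuous_abs.rpow_const fun _ => Or.inr D.p_nonneg)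

/-- An exponent large enough for the polynomial bounds in the eigenvalue. -/
def order : ℕ := ⌈(2 - D.p)⁻¹⌉₊

theorem one_le_order_mul : 1 ≤ (D.order : ℝ) * (2 - D.p) := by
  have h : 0 < 2 - D.p := sub_pos.2 D.p_lt_two
  rw [← inv_le_iff_one_le_mul₀ h]
  exact Nat.le_ceil _

/-- Since `order` times 2 - p is at least 1, t ≥ L^`order` forces t^(2-p) ≥ L. Taking `order` to be
a natural number keeps every threshold a polynomial in L. -/
theorem rpow_le_mul_sq {L t : ℝ} (hL : 1 ≤ L) (ht : L ^ D.order ≤ t) :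
    t ^ D.p ≤ L⁻¹ * t ^ 2 := by
  have h1 : 1 ≤ L ^ D.order := one_le_pow₀ hL
  have ht0 : 0 < t := by linarith
  have hp : 0 < 2 - D.p := sub_pos.2 D.p_lt_two
  have h2 : L ≤ t ^ (2 - D.p) := by
    calc L = L ^ (1 : ℝ) := (Real.rpow_one L).symm
      _ ≤ L ^ ((D.order : ℝ) * (2 - D.p)) :=
        Real.rpow_le_rpow_of_exponent_le hL D.one_le_order_mul
      _ = (L ^ D.order) ^ (2 - D.p) := by
        rw [Real.rpow_mul (by linarith), Real.rpow_natCast]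
      _ ≤ _ := Real.rpow_le_rpow (by positivity) ht hp.le
  have h3 : t ^ D.p * t ^ (2 - D.p) = t ^ 2 := by
    rw [← Real.rpow_add ht0, ← Real.rpow_natCast]; congr 1; push_cast; ring
  rw [← h3, ← mul_assoc, mul_comm L⁻¹, mul_assoc]
  refine le_mul_of_one_le_right (Real.rpow_nonneg ht0.le _) ?_
  rw [inv_mul_eq_div, le_div_iff₀ (by linarith)]
  linarith

theorem weight_le_mul_sq {L t : ℝ} (hL : 1 ≤ L) (ht : L ^ D.order ≤ t) :
    D.weight t ≤ D.μ / L * t ^ 2 := by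
  have ht0 : 0 < t := lt_of_lt_of_le (by positivity) ht
  rw [D.weight_of_pos ht0, div_eq_mul_inv, mul_assoc]
  exact mul_le_mul_of_nonneg_left (D.rpow_le_mul_sq hL ht) D.μ_pos.le

theorem weight_le_of_le {R t : ℝ} (ht : 0 < t) (hR : 1 ≤ R) (htR : t ≤ R) :
    D.weight t ≤ D.μ * R ^ 2 := by
  rw [D.weight_of_pos ht]
  refine mul_le_mul_of_nonneg_left ?_ D.μ_pos.le
  calc t ^ D.p ≤ R ^ D.p := Real.rpow_le_rpow ht.le htR D.p_nonneg
    _ ≤ R ^ (2 : ℝ) := Real.rpow_le_rpow_of_exponent_le hR D.p_lt_two.le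
    _ = R ^ 2 := by norm_cast

theorem weight_le_one_add_sq {t : ℝ} (ht : 0 < t) : D.weight t ≤ D.μ * (1 + t) ^ 2 :=
  D.weight_le_of_le ht (by linarith) (by linarith)

theorem growth_sqrt_weight : LinearGrowth (fun t => Real.sqrt (D.weight t)) (Real.sqrt D.μ) where
  measurable := (D.continuous_weight.sqrt).measurable
  le t ht := by
    rw [abs_of_nonneg (Real.sqrt_nonneg _)]
    refine Real.sqrt_le_iff.2 ⟨by positivity, ?_⟩
    rw [mul_pow, Real.sq_sqrt D.μ_pos.le]
    exact D.weight_le_one_add_sq ht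

/-- The multiplication operator `z ↦ √(μ t^p) w`. -/
def weightOp : D.HSpace →L[ℂ] L2 := D.mulOp D.growth_sqrt_weight

/-- This is where p < 2 matters: √(μ t^p) is o(t), so the term b t² of the form makes the tails
uniformly small. -/
theorem isCompactOperator_weightOp : IsCompactOperator D.weightOp := by
  refine D.isCompactOperator_mulOp _ fun ε hε => ?_
  have hμ := D.μ_pos
  set L := max 1 (D.μ / ε ^ 2) with hL
  have hL1 : 1 ≤ L := le_max_left _ _
  refine ⟨L ^ D.order, by positivity, fun t ht => ?_⟩
  have ht0 : 0 < t := lt_trans (by positivity) ht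
  rw [abs_of_nonneg (Real.sqrt_nonneg _)]
  refine Real.sqrt_le_iff.2 ⟨by positivity, ?_⟩
  refine (D.weight_le_mul_sq hL1 ht.le).trans ?_
  rw [mul_pow]
  gcongr
  rw [div_le_iff₀ (by positivity), ← div_le_iff₀' (by positivity)]
  exact le_max_right _ _

/-- The compact operator whose quadratic form is `∫ μ t^p |w|²`. -/
def solOp : D.HSpace →L[ℂ] D.HSpace := gramOp D.weightOp

theorem isCompactOperator_solOp : IsCompactOperator D.solOp :=
  isCompactOperator_gramOp D.isCompactOperator_weightOp

theorem inner_solOp_eq (z z' : D.HSpace) :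
    inner ℂ z (D.solOp z') = inner ℂ (D.weightOp z) (D.weightOp z') :=
  inner_gramOp _ _ _

theorem isSymmetric_solOp : (D.solOp : D.HSpace →ₗ[ℂ] D.HSpace).IsSymmetric :=
  isSymmetric_gramOp _

theorem inner_solOp (z z' : D.HSpace) : inner ℂ z (D.solOp z') =
    ∫ t in Ioi (0 : ℝ), (D.weight t : ℂ) *
      ((starRingEnd ℂ) (D.profile z t) * D.profile z' t) := by
  rw [inner_solOp_eq, L2.inner_def]
  refine integral_congr_ae ?_
  filter_upwards [D.coeFn_mulOp D.growth_sqrt_weight z, D.coeFn_mulOp D.growth_sqrt_weight z']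
    with t h1 h2
  have h3 : (Real.sqrt (D.weight t) : ℂ) * (Real.sqrt (D.weight t) : ℂ) = D.weight t := by
    rw [← Complex.ofReal_mul, Real.mul_self_sqrt (D.weight_nonneg t)]
  rw [weightOp, h1, h2, RCLike.inner_apply, map_mul, Complex.conj_ofReal, ← h3]
  ring

theorem inner_embed {φ : ℝ → ℂ} (hφ : IsTest φ) (z : D.HSpace) :
    inner ℂ (D.embed hφ) z =
      Real.sqrt D.a * (∫ t in Ioi (0 : ℝ), (starRingEnd ℂ) (deriv φ t) * (z : L2Pair).fst t) +
      D.b * ∫ t in Ioi (0 : ℝ), (starRingEnd ℂ) (φ t) * ((t : ℂ) ^ 2 * D.profile z t) := by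
  rw [← D.incl.inner_map_map, WithLp.prod_inner_apply]
  congr 1
  · change inner ℂ (D.embed hφ : L2Pair).fst (z : L2Pair).fst = _
    rw [L2.inner_def, ← integral_const_mul]
    refine integral_congr_ae ?_
    filter_upwards [D.embed_fst hφ] with t h1
    rw [h1, RCLike.inner_apply, map_mul, Complex.conj_ofReal]; ring
  · change inner ℂ (D.embed hφ : L2Pair).snd (z : L2Pair).snd = _
    rw [L2.inner_def, ← integral_const_mul]
    refine integral_congr_ae ?_
    filter_upwards [D.embed_snd hφ, D.space_snd (D.incl_mem z)] with t h1 h2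
    have h3 : (Real.sqrt D.b : ℂ) * (Real.sqrt D.b : ℂ) = D.b := by
      rw [← Complex.ofReal_mul, Real.mul_self_sqrt D.b_pos.le]
    rw [h1, h2, RCLike.inner_apply, map_mul, map_mul, Complex.conj_ofReal, Complex.conj_ofReal, ← h3]
    ring

/-! ### From the weak equation to the differential equation -/

/-- The coefficient in `w'' = coeff w`. -/
def coeff (lam t : ℝ) : ℝ := (D.b * t ^ 2 - lam * D.weight t) / D.a

theorem continuous_coeff (lam : ℝ) : Continuous (D.coeff lam) := by
  have := D.continuous_weight
  unfold coeff
  fun_prop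

/-- Solutions of the weak eigenvalue equation solve the differential equation. -/
theorem exists_deriv_of_eigen {lam : ℝ} {z : D.HSpace} (hz : z = (lam : ℂ) • D.solOp z) :
    ∃ y : ℝ → ℂ, (∀ t, HasDerivAt y (D.coeff lam t * D.profile z t) t) ∧
      ((z : L2Pair).fst =ᵐ[volume.restrict (Ioi (0 : ℝ))] fun t => (Real.sqrt D.a : ℂ) * y t) ∧
      ∀ t, 0 ≤ t → D.profile z t = ∫ s in (0 : ℝ)..t, y s := by
  have hne : (Real.sqrt D.a : ℂ) ≠ 0 := D.sqrtA.ne_zero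
  have haa : (Real.sqrt D.a : ℂ) * (Real.sqrt D.a : ℂ) = D.a := by
    rw [← Complex.ofReal_mul, Real.mul_self_sqrt D.a_pos.le]
  have ha0 : (D.a : ℂ) ≠ 0 := by exact_mod_cast D.a_pos.ne'
  set k : ℝ → ℂ := fun t => D.coeff lam t * D.profile z t with hk
  have hkc : Continuous k :=
    (Complex.continuous_ofReal.comp (D.continuous_coeff lam)).mul (D.continuous_profile z)
  set G : ℝ → ℂ := fun t => ∫ s in (0 : ℝ)..t, k s with hG
  have hGd : ∀ t, HasDerivAt G (k t) t := fun t => (hkc.integral_hasStrictDerivAt 0 t).hasDerivAt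
  have hGc : Continuous G := continuous_iff_continuousAt.2 fun t => (hGd t).continuousAt
  have hloc1 := (locallyIntegrableOn_L2 (z : L2Pair).fst)
  have hloc2 : LocallyIntegrableOn G (Ioi 0) := hGc.locallyIntegrable.locallyIntegrableOn _
  have hloc3 : LocallyIntegrableOn (fun t => (Real.sqrt D.a : ℂ)⁻¹ * (z : L2Pair).fst t) (Ioi 0) :=
    hloc1.smul ((Real.sqrt D.a : ℂ)⁻¹)
  -- The weak equation says that w' and the primitive G of `coeff` · w have the same distributional
  -- derivative. Hence w' = c + G almost everywhere, and the right-hand side is the continuously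
  -- differentiable representative.
  obtain ⟨c, hc⟩ := ae_eq_const_of_forall_isTest
    (f := fun t => (Real.sqrt D.a : ℂ)⁻¹ * (z : L2Pair).fst t - G t) (hloc3.sub hloc2) fun g hg => by
    have hconj : ∀ t, (starRingEnd ℂ) ((g t : ℂ)) = g t := fun t => Complex.conj_ofReal _
    have hdr : ∀ t, deriv (fun s => (g s : ℂ)) t = ((deriv g t : ℝ) : ℂ) := fun t => by
      have hgd : DifferentiableAt ℝ g t := by
        have := Complex.reCLM.differentiableAt.comp t ((hg.1.differentiable (by simp)) t)
        exact this
      exact hgd.hasDerivAt.ofReal_comp.deriv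
    have hconj' : ∀ t, (starRingEnd ℂ) (deriv (fun s => (g s : ℂ)) t)
        = deriv (fun s => (g s : ℂ)) t := fun t => by rw [hdr, Complex.conj_ofReal]
    have hweak : inner ℂ (D.embed hg) z = lam * inner ℂ (D.embed hg) (D.solOp z) := by
      conv_lhs => rw [hz]
      rw [inner_smul_right]
    rw [D.inner_embed hg, D.inner_solOp] at hweak
    simp only [hconj, hconj', D.profile_embed] at hweak
    have hp2 : LocallyIntegrableOn (fun t : ℝ => (t : ℂ) ^ 2 * D.profile z t) (Ioi 0) :=
      (((Complex.continuous_ofReal.pow 2).mul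
        (D.continuous_profile z)).locallyIntegrable).locallyIntegrableOn _
    have hpw : LocallyIntegrableOn (fun t => (D.weight t : ℂ) * D.profile z t) (Ioi 0) :=
      (((Complex.continuous_ofReal.comp D.continuous_weight).mul
        (D.continuous_profile z)).locallyIntegrable).locallyIntegrableOn _
    have hparts := hg.integral_by_parts hGd hkc
    have hgk : (D.a : ℂ) * ∫ t in Ioi (0 : ℝ), (g t : ℂ) * k t =
        D.b * (∫ t in Ioi (0 : ℝ), (g t : ℂ) * ((t : ℂ) ^ 2 * D.profile z t)) -
        lam * ∫ t in Ioi (0 : ℝ), (D.weight t : ℂ) * ((g t : ℂ) * D.profile z t) := by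
      have e2 : ∀ t : ℝ, (D.weight t : ℂ) * ((g t : ℂ) * D.profile z t)
        = (g t : ℂ) * ((D.weight t : ℂ) * D.profile z t) := fun t => by ring
      simp only [e2]
      rw [← integral_const_mul, ← integral_const_mul, ← integral_const_mul,
        ← integral_sub ((hg.integrableOn_mul hp2).const_mul _)
          ((hg.integrableOn_mul hpw).const_mul _)]
      refine integral_congr_ae (Eventually.of_forall fun t => ?_)
      simp only [hk, coeff]
      push_cast
      field_simp
    simp only [mul_sub]
    rw [integral_sub (hg.deriv.integrableOn_mul hloc3) (hg.deriv.integrableOn_mul hloc2), hparts]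
    have e3 : ∀ t : ℝ, deriv (fun s => (g s : ℂ)) t * ((Real.sqrt D.a : ℂ)⁻¹ * (z : L2Pair).fst t) =
      (Real.sqrt D.a : ℂ)⁻¹ * (deriv (fun s => (g s : ℂ)) t * (z : L2Pair).fst t) := fun t => by ring
    simp only [e3]
    rw [integral_const_mul, sub_neg_eq_add]
    have h4 : (Real.sqrt D.a : ℂ) * (∫ t in Ioi (0 : ℝ), deriv (fun s => (g s : ℂ)) t *
        (z : L2Pair).fst t) = - (D.a * ∫ t in Ioi (0 : ℝ), (g t : ℂ) * k t) := by
      rw [hgk]; linear_combination hweak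
    have h5 : (∫ t in Ioi (0 : ℝ), deriv (fun s => (g s : ℂ)) t * (z : L2Pair).fst t)
      = - (Real.sqrt D.a : ℂ) * ∫ t in Ioi (0 : ℝ), (g t : ℂ) * k t := by
      apply mul_left_cancel₀ hne
      rw [h4, ← haa]; ring
    rw [h5]
    field_simp
    ring
  have hfst : (z : L2Pair).fst =ᵐ[volume.restrict (Ioi (0 : ℝ))]
      fun t => (Real.sqrt D.a : ℂ) * (c + G t) := by
    filter_upwards [hc] with t ht
    rw [← ht]; field_simp; ring
  refine ⟨fun t => c + G t, fun t => (hGd t).const_add c, hfst, fun t ht => ?_⟩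
  rw [D.profile_eq, inner_chi, intervalIntegral.integral_of_le ht, ← integral_const_mul]
  have hfst' : (z : L2Pair).fst =ᵐ[volume.restrict (Ioc 0 t)]
      fun t => (Real.sqrt D.a : ℂ) * (c + G t) :=
    ae_restrict_of_ae_restrict_of_subset (fun s hs => hs.1) hfst
  refine integral_congr_ae ?_
  filter_upwards [hfst'] with s hs
  rw [hs]; push_cast; field_simp


/-! ### Density of test functions and injectivity -/

theorem incl_spaceEquiv (x : energySpace) :
    (D.spaceEquiv x : L2Pair) = scaleEquiv D.sqrtA D.sqrtB x := rfl

theorem eq_embed {φ : ℝ → ℂ} (hφ : IsTest φ) {x : L2Pair} (hr : Represents φ x) {z : D.HSpace}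
    (hz : (z : L2Pair) = scaleEquiv D.sqrtA D.sqrtB x) : z = D.embed hφ := by
  apply D.incl.injective
  have h1 : (z : L2Pair).fst = (D.embed hφ : L2Pair).fst := by
    apply Lp.ext
    rw [hz]
    filter_upwards [hr.1, Lp.coeFn_smul (D.sqrtA : ℂ) x.fst, D.embed_fst hφ] with t h1 h2 h3
    rw [h3, scaleEquiv_fst, h2, Pi.smul_apply, h1]; rfl
  have h2 : (z : L2Pair).snd = (D.embed hφ : L2Pair).snd := by
    apply Lp.ext
    rw [hz]
    filter_upwards [hr.2, Lp.coeFn_smul (D.sqrtB : ℂ) x.snd, D.embed_snd hφ] with t h1 h2 h3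
    rw [h3, scaleEquiv_snd, h2, Pi.smul_apply, h1]; rfl
  exact WithLp.ofLp_injective 2 (Prod.ext h1 h2)

/-- Test functions are dense by construction. The kernel of the functional, carried to `L2Pair`, is
closed because `energySpace` is; it contains the generators, hence everything. -/
theorem eq_zero_of_forall_embed (T : D.HSpace →L[ℂ] ℂ)
    (h : ∀ φ, ∀ hφ : IsTest φ, T (D.embed hφ) = 0) (z : D.HSpace) : T z = 0 := by
  let S : energySpace →L[ℂ] ℂ := T.comp (D.spaceEquiv : energySpace →L[ℂ] D.HSpace)
  let P : Submodule ℂ L2Pair := S.ker.map energySpace.subtype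
  have hcl : IsClosed (energySpace : Set L2Pair) := Submodule.isClosed_topologicalClosure _
  have hP : IsClosed (P : Set L2Pair) := by
    rw [Submodule.map_coe]
    exact hcl.isClosedEmbedding_subtypeVal.isClosedMap _ S.isClosed_ker
  have hle : energySpace ≤ P := by
    refine Submodule.topologicalClosure_minimal _ ?_ hP
    rw [Submodule.span_le]
    rintro x ⟨φ, hφ, hr⟩
    have hx : x ∈ energySpace :=
      Submodule.le_topologicalClosure _ (Submodule.subset_span ⟨φ, hφ, hr⟩)
    refine ⟨⟨x, hx⟩, ?_, rfl⟩
    change T (D.spaceEquiv ⟨x, hx⟩) = 0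
    rw [D.eq_embed hφ hr (D.incl_spaceEquiv ⟨x, hx⟩), h]
  obtain ⟨x, rfl⟩ := D.spaceEquiv.surjective z
  obtain ⟨x', hx', hxx⟩ := hle x.2
  have : x' = x := Subtype.ext hxx
  rw [this] at hx'
  exact hx'

theorem eq_zero_of_inner_embed {z : D.HSpace}
    (h : ∀ φ, ∀ hφ : IsTest φ, inner ℂ (D.embed hφ) z = 0) : z = 0 := by
  have := D.eq_zero_of_forall_embed (innerSL ℂ z) (fun φ hφ => by
    rw [innerSL_apply_apply, ← inner_conj_symm, h φ hφ, map_zero]) z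
  rwa [innerSL_apply_apply, inner_self_eq_zero] at this

/-- The differential operator `-a ∂² + b t²`. -/
def diffOp (φ : ℝ → ℂ) (t : ℝ) : ℂ := -D.a * deriv (deriv φ) t + D.b * ((t : ℂ) ^ 2 * φ t)

theorem isTest_diffOp {φ : ℝ → ℂ} (hφ : IsTest φ) : IsTest (D.diffOp φ) := by
  have h1 := (hφ.deriv.deriv).mul_left (g := fun _ => -(D.a : ℂ)) contDiffOn_const
  have h2 := hφ.mul_left (g := fun t : ℝ => (D.b : ℂ) * (t : ℂ) ^ 2)
    (contDiff_const.mul (contDiff_ofReal_complex.pow 2)).contDiffOn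
  convert h1.add h2 using 2
  rw [diffOp]; ring

theorem growth_one : LinearGrowth (fun _ => 1) 1 where
  measurable := measurable_const
  le t ht := by simp; linarith

/-- The embedding of the form space into `L²`. -/
def toL2 : D.HSpace →L[ℂ] L2 := D.mulOp growth_one

theorem coeFn_toL2 (z : D.HSpace) :
    D.toL2 z =ᵐ[volume.restrict (Ioi (0 : ℝ))] D.profile z := by
  filter_upwards [D.coeFn_mulOp growth_one z] with t ht
  rw [toL2, ht]; simp

theorem inner_toLp_isTest {φ : ℝ → ℂ} (hφ : IsTest φ) (f : L2) :
    inner ℂ (hφ.memLp.toLp φ) f = ∫ t in Ioi (0 : ℝ), (starRingEnd ℂ) (φ t) * f t := by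
  rw [L2.inner_def]
  refine integral_congr_ae ?_
  filter_upwards [hφ.memLp.coeFn_toLp] with t ht
  rw [ht, RCLike.inner_apply, mul_comm]

theorem _root_.GravityYM.IsTest.conj {φ : ℝ → ℂ} (hφ : IsTest φ) :
    IsTest fun t => (starRingEnd ℂ) (φ t) := by
  refine ⟨Complex.conjCLE.contDiff.comp hφ.1, hφ.2.1.comp_left (map_zero _),
    (closure_mono ?_).trans hφ.2.2⟩
  intro t ht
  simpa using ht

theorem _root_.GravityYM.IsTest.hasDerivAt {φ : ℝ → ℂ} (hφ : IsTest φ) (t : ℝ) :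
    HasDerivAt φ (_root_.deriv φ t) t := ((hφ.1.differentiable (by simp)) t).hasDerivAt

theorem _root_.GravityYM.IsTest.deriv_conj {φ : ℝ → ℂ} (hφ : IsTest φ) (t : ℝ) :
    _root_.deriv (fun t => (starRingEnd ℂ) (φ t)) t = (starRingEnd ℂ) (_root_.deriv φ t) :=
  (Complex.conjCLE.toContinuousLinearMap.hasFDerivAt.comp_hasDerivAt t (hφ.hasDerivAt t)).deriv

/-- The form is represented by the differential operator. -/
theorem inner_embed_eq {ψ : ℝ → ℂ} (hψ : IsTest ψ) (z : D.HSpace) :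
    inner ℂ (D.embed hψ) z = inner ℂ ((D.isTest_diffOp hψ).memLp.toLp (D.diffOp ψ)) (D.toL2 z) := by
  have haa : (Real.sqrt D.a : ℂ) * (Real.sqrt D.a : ℂ) = D.a := by
    rw [← Complex.ofReal_mul, Real.mul_self_sqrt D.a_pos.le]
  rw [← sub_eq_zero]
  -- Both sides are continuous in z, so it suffices to integrate by parts once against test
  -- functions.
  refine D.eq_zero_of_forall_embed (innerSL ℂ (D.embed hψ) -
    (innerSL ℂ ((D.isTest_diffOp hψ).memLp.toLp (D.diffOp ψ))).comp D.toL2) (fun φ hφ => ?_) z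
  rw [_root_.sub_apply, ContinuousLinearMap.comp_apply, innerSL_apply_apply, innerSL_apply_apply,
    sub_eq_zero, inner_embed, inner_toLp_isTest (D.isTest_diffOp hψ)]
  have hψ' := hψ.conj
  have hψd := hψ.deriv.conj
  have e1 : ∫ t in Ioi (0 : ℝ), (starRingEnd ℂ) (deriv ψ t) * (D.embed hφ : L2Pair).fst t =
      Real.sqrt D.a * ∫ t in Ioi (0 : ℝ), deriv φ t * (starRingEnd ℂ) (deriv ψ t) := by
    rw [← integral_const_mul]
    refine integral_congr_ae ?_
    filter_upwards [D.embed_fst hφ] with t ht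
    rw [ht]; ring
  have e2 := hφ.integral_by_parts (f := fun t => (starRingEnd ℂ) (deriv ψ t))
    (f' := fun t => (starRingEnd ℂ) (deriv (deriv ψ) t))
    (fun t => by
      have := hψd.hasDerivAt t
      rwa [hψ.deriv.deriv_conj] at this) hψ.deriv.deriv.conj.1.continuous
  have e3 : ∫ t in Ioi (0 : ℝ), (starRingEnd ℂ) (D.diffOp ψ t) * D.toL2 (D.embed hφ) t =
      ∫ t in Ioi (0 : ℝ), (φ t * (-D.a * (starRingEnd ℂ) (deriv (deriv ψ) t)) +
        φ t * (D.b * ((t : ℂ) ^ 2 * (starRingEnd ℂ) (ψ t)))) := by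
    refine integral_congr_ae ?_
    filter_upwards [D.coeFn_toL2 (D.embed hφ)] with t ht
    rw [ht, profile_embed, diffOp]
    simp only [map_add, map_mul, map_neg, map_pow, Complex.conj_ofReal]
    ring
  have hcont : ∀ {f : ℝ → ℂ}, Continuous f → IntegrableOn (fun t => φ t * f t) (Ioi 0) :=
    fun hf => hφ.integrableOn_mul (hf.locallyIntegrable.locallyIntegrableOn _)
  have hi1 : IntegrableOn (fun t => φ t * (-D.a * (starRingEnd ℂ) (deriv (deriv ψ) t))) (Ioi 0) :=
    hcont (continuous_const.mul hψ.deriv.deriv.conj.1.continuous)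
  have hi2 : IntegrableOn (fun t => φ t * (D.b * ((t : ℂ) ^ 2 * (starRingEnd ℂ) (ψ t)))) (Ioi 0) :=
    hcont (continuous_const.mul ((Complex.continuous_ofReal.pow 2).mul hψ'.1.continuous))
  rw [e1, e2, e3, integral_add hi1 hi2]
  simp only [profile_embed]
  have e4 : ∫ t in Ioi (0 : ℝ), φ t * (-D.a * (starRingEnd ℂ) (deriv (deriv ψ) t)) =
      -D.a * ∫ t in Ioi (0 : ℝ), φ t * (starRingEnd ℂ) (deriv (deriv ψ) t) := by
    rw [← integral_const_mul]
    exact integral_congr_ae (Eventually.of_forall fun t => by ring)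
  have e5 : ∫ t in Ioi (0 : ℝ), φ t * (D.b * ((t : ℂ) ^ 2 * (starRingEnd ℂ) (ψ t))) =
      D.b * ∫ t in Ioi (0 : ℝ), (starRingEnd ℂ) (ψ t) * ((t : ℂ) ^ 2 * φ t) := by
    rw [← integral_const_mul]
    exact integral_congr_ae (Eventually.of_forall fun t => by ring)
  rw [e4, e5, ← haa]
  ring

/-- After integration by parts, the scalar product with a test function sees only the L² function w
and not w'; an element with w = 0 is therefore orthogonal to a dense set. -/
theorem eq_zero_of_toL2_eq_zero {z : D.HSpace} (h : D.toL2 z = 0) : z = 0 :=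
  D.eq_zero_of_inner_embed fun φ hφ => by rw [inner_embed_eq, h, inner_zero_right]

/-- The weight is positive on (0, ∞). Consequently 0 is not an eigenvalue of `solOp`, and the
spectral theorem will lose no part of the space to a kernel. -/
theorem weightOp_injective {z : D.HSpace} (h : D.weightOp z = 0) : z = 0 := by
  refine D.eq_zero_of_toL2_eq_zero (Lp.ext ?_)
  have h0 := D.coeFn_mulOp D.growth_sqrt_weight z
  rw [weightOp] at h
  rw [h] at h0
  filter_upwards [h0, D.coeFn_toL2 z, Lp.coeFn_zero ℂ 2 (volume.restrict (Ioi (0 : ℝ))),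
    ae_restrict_mem measurableSet_Ioi] with t h1 h2 h3 ht
  rw [h2, h3]
  rw [h3] at h1
  have h4 : (Real.sqrt (D.weight t) : ℂ) ≠ 0 := by
    exact_mod_cast (Real.sqrt_pos.2 (D.weight_pos ht)).ne'
  exact ((mul_eq_zero.1 h1.symm).resolve_left h4)

theorem integrableOn_weight_mul (z : D.HSpace) :
    IntegrableOn (fun t => D.weight t * ‖D.profile z t‖ ^ 2) (Ioi 0) := by
  have h := (memLp_two_iff_integrable_sq_norm
    (D.memLp_mul_profile D.growth_sqrt_weight (D.incl_mem z)).1).1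
    (D.memLp_mul_profile D.growth_sqrt_weight (D.incl_mem z))
  refine h.congr (Eventually.of_forall fun t => ?_)
  simp only
  rw [norm_mul, mul_pow, Complex.norm_real, Real.norm_eq_abs, sq_abs,
    Real.sq_sqrt (D.weight_nonneg t)]

theorem norm_sq_weightOp (z : D.HSpace) :
    ‖D.weightOp z‖ ^ 2 = ∫ t in Ioi (0 : ℝ), D.weight t * ‖D.profile z t‖ ^ 2 := by
  rw [norm_sq_L2]
  refine integral_congr_ae ?_
  filter_upwards [D.coeFn_mulOp D.growth_sqrt_weight z] with t ht
  rw [weightOp, ht, norm_mul, mul_pow, Complex.norm_real, Real.norm_eq_abs, sq_abs,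
    Real.sq_sqrt (D.weight_nonneg t)]

theorem norm_sq_eq_of_eigen {lam : ℝ} {z : D.HSpace} (hz : z = (lam : ℂ) • D.solOp z) :
    ‖z‖ ^ 2 = lam * ∫ t in Ioi (0 : ℝ), D.weight t * ‖D.profile z t‖ ^ 2 := by
  have h1 : inner ℂ z z = (lam : ℂ) * inner ℂ z (D.solOp z) := by
    rw [← inner_smul_right, ← hz]
  rw [inner_solOp_eq, inner_self_eq_norm_sq_to_K, inner_self_eq_norm_sq_to_K] at h1
  rw [← norm_sq_weightOp]
  have h2 : ((‖z‖ ^ 2 : ℝ) : ℂ) = ((lam * ‖D.weightOp z‖ ^ 2 : ℝ) : ℂ) := by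
    push_cast
    exact h1
  exact Complex.ofReal_injective h2

/-! ### Simplicity of the eigenvalues -/

/-- Solutions of the differential equation with vanishing Cauchy data at `0` vanish. -/
theorem eq_zero_of_cauchy {lam : ℝ} {u y : ℝ → ℂ}
    (hy : ∀ t, HasDerivAt y (D.coeff lam t * u t) t)
    (hu : ∀ t, 0 ≤ t → u t = ∫ s in (0 : ℝ)..t, y s) (h0 : y 0 = 0) {t : ℝ} (ht : 0 ≤ t) :
    y t = 0 := by
  have hyc : Continuous y := continuous_iff_continuousAt.2 fun t => (hy t).continuousAt
  obtain ⟨C, hC⟩ := (isCompact_Icc (a := (0 : ℝ)) (b := t + 1)).exists_bound_of_continuousOn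
    (D.continuous_coeff lam).continuousOn
  -- For the first-order system (u, y)' = (y, `coeff` · u) in the sup norm, the first component has
  -- Lipschitz constant 1 and the second C.
  set K : NNReal := Real.toNNReal (max 1 C) with hK
  have hK1 : (K : ℝ) = max 1 C := Real.coe_toNNReal _ (zero_le_one.trans (le_max_left _ _))
  -- The primitive U is differentiable on all of ℝ and agrees with u for t ≥ 0, so no one-sided
  -- derivative of u is needed at 0.
  set U : ℝ → ℂ := fun t => ∫ s in (0 : ℝ)..t, y s with hU
  have hUd : ∀ t, HasDerivAt U (y t) t := fun t => (hyc.integral_hasStrictDerivAt 0 t).hasDerivAt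
  have hUc : Continuous U := continuous_iff_continuousAt.2 fun t => (hUd t).continuousAt
  have key := ODE_solution_unique_of_mem_Icc_right (a := 0) (b := t + 1) (K := K)
    (v := fun t x => ((x.2, (D.coeff lam t : ℂ) * x.1) : ℂ × ℂ)) (s := fun _ => univ)
    (f := fun t => (U t, y t)) (g := fun _ => (0, 0))
    (by
      intro s hs
      refine (LipschitzWith.of_dist_le_mul fun x x' => ?_).lipschitzOnWith
      rw [hK1, Prod.dist_eq, max_le_iff]
      constructor
      · calc dist x.2 x'.2 ≤ dist x x' := le_max_right _ _
          _ ≤ _ := le_mul_of_one_le_left dist_nonneg (le_max_left _ _)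
      · rw [dist_eq_norm, ← mul_sub, norm_mul, Complex.norm_real, ← dist_eq_norm]
        have h1 := (hC s ⟨hs.1, hs.2.le⟩).trans (le_max_right 1 C)
        have h2 : dist x.1 x'.1 ≤ dist x x' := le_max_left _ _
        gcongr)
    (hUc.prodMk hyc).continuousOn
    (by
      intro s hs
      have := (hUd s).prodMk (hy s)
      rw [hu s hs.1] at this
      exact this.hasDerivWithinAt)
    (fun _ _ => mem_univ _) continuousOn_const
    (by
      intro s hs
      simp only [mul_zero]
      exact hasDerivWithinAt_const _ _ _)
    (fun _ _ => mem_univ _)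
    (by simp [hU, h0])
  exact congrArg Prod.snd (key ⟨ht, by linarith⟩)

/-- Eigenvalues are simple. -/
theorem exists_smul_of_eigen {lam : ℝ} {z z' : D.HSpace} (hz : z = (lam : ℂ) • D.solOp z)
    (hz' : z' = (lam : ℂ) • D.solOp z') (hne : z ≠ 0) : ∃ c : ℂ, z' = c • z := by
  obtain ⟨y, hy, hfst, hint⟩ := D.exists_deriv_of_eigen hz
  obtain ⟨y', hy', hfst', hint'⟩ := D.exists_deriv_of_eigen hz'
  have hyc : Continuous y := continuous_iff_continuousAt.2 fun t => (hy t).continuousAt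
  have hyc' : Continuous y' := continuous_iff_continuousAt.2 fun t => (hy' t).continuousAt
  have hzero : ∀ {x : D.HSpace}, (∀ t, 0 < t → D.profile x t = 0) → x = 0 := fun {x} hx => by
    refine D.eq_zero_of_toL2_eq_zero (Lp.ext ?_)
    filter_upwards [D.coeFn_toL2 x, Lp.coeFn_zero ℂ 2 (volume.restrict (Ioi (0 : ℝ))),
      ae_restrict_mem measurableSet_Ioi] with t h2 h3 ht
    rw [h2, h3, hx t ht]; rfl
  -- Every profile vanishes at 0, so the slope y 0 is the only free Cauchy datum. This determines
  -- the multiple c.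
  have hy0 : y 0 ≠ 0 := fun h0 => hne <| hzero fun t ht => by
    rw [hint t ht.le, intervalIntegral.integral_congr (g := fun _ => 0)]
    · simp
    · intro s hs
      rw [uIcc_of_le ht.le] at hs
      exact D.eq_zero_of_cauchy hy hint h0 hs.1
  refine ⟨y' 0 / y 0, ?_⟩
  rw [← sub_eq_zero]
  set c := y' 0 / y 0 with hc
  have hprof : ∀ t, D.profile (D.incl (z' - c • z)) t = D.profile z' t - c * D.profile z t := by
    intro t
    rw [sub_eq_add_neg, ← neg_smul, map_add, map_smul, profile_add, profile_smul]; ring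
  have hI : ∀ t, 0 ≤ t → D.profile z' t - c * D.profile z t = ∫ s in (0 : ℝ)..t, (y' s - c * y s) := by
    intro t ht
    rw [hint t ht, hint' t ht, intervalIntegral.integral_sub (hyc'.intervalIntegrable _ _)
      (hyc.intervalIntegrable _ _ |>.const_mul c), intervalIntegral.integral_const_mul]
  refine hzero fun t ht => ?_
  rw [hprof, hI t ht.le, intervalIntegral.integral_congr (g := fun _ => 0)]
  · simp
  · intro s hs
    rw [uIcc_of_le ht.le] at hs
    refine D.eq_zero_of_cauchy (lam := lam) (u := fun t => D.profile z' t - c * D.profile z t)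
      (y := fun s => y' s - c * y s) (fun t => ?_) hI ?_ hs.1
    · have := (hy' t).sub ((hy t).const_mul c)
      rwa [← mul_assoc, mul_comm c, mul_assoc, ← mul_sub] at this
    · rw [hc, div_mul_cancel₀ _ hy0, sub_self]

/-! ### Polynomial bounds: eigenvalue counting and moments -/

/-- Bessel's inequality for the vector that represents evaluation at t. The bound does not depend on
the number of functions, which is what makes counting possible. -/
theorem sum_profile_sq_le {ι : Type*} {e : ι → D.HSpace} (he : Orthonormal ℂ e) (s : Finset ι)
    {t : ℝ} (ht : 0 ≤ t) : ∑ i ∈ s, ‖D.profile (e i) t‖ ^ 2 ≤ t / D.a := by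
  have h1 : Orthonormal ℂ fun i => D.incl (e i) := he.comp_linearIsometry D.incl
  refine le_trans ?_ ((h1.sum_inner_products_le (x := D.rep t) (s := s)).trans
    (D.norm_rep_sq_le ht))
  refine Finset.sum_le_sum fun i _ => ?_
  rw [profile, norm_inner_symm]

/-- A scale beyond which `lam * weight` is dominated, for `lam ≤ L`. -/
def scale : ℝ := max 1 (2 * D.μ / D.b)

theorem one_le_scale : 1 ≤ D.scale := le_max_left _ _

theorem weight_le_of_scale {L t : ℝ} (hL : 1 ≤ L) (ht : (D.scale * L) ^ D.order ≤ t) :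
    D.weight t ≤ D.b / (2 * L) * t ^ 2 := by
  have hb := D.b_pos
  have hμ := D.μ_pos
  have h1 := D.one_le_scale
  have hs : 1 ≤ D.scale * L := one_le_mul_of_one_le_of_one_le h1 hL
  refine (D.weight_le_mul_sq hs ht).trans (mul_le_mul_of_nonneg_right ?_ (sq_nonneg t))
  rw [div_le_div_iff₀ (by positivity) (by positivity)]
  have h2 : 2 * D.μ / D.b ≤ D.scale := le_max_right _ _
  rw [div_le_iff₀ hb] at h2
  nlinarith

/-- The number of eigenvalues below `L` is at most polynomial in `L`. -/
theorem card_le_of_eigen {ι : Type*} {e : ι → D.HSpace} (he : Orthonormal ℂ e) {lam : ι → ℝ}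
    (heig : ∀ i, e i = (lam i : ℂ) • D.solOp (e i)) (hpos : ∀ i, 0 < lam i) {L : ℝ} (hL : 1 ≤ L)
    (s : Finset ι) (hs : ∀ i ∈ s, lam i ≤ L) :
    (s.card : ℝ) ≤ 2 * L * (D.μ * ((D.scale * L) ^ D.order) ^ 4 / D.a) := by
  have ha := D.a_pos
  have hb := D.b_pos
  have hμ := D.μ_pos
  have h1 := D.one_le_scale
  have hs1 : 1 ≤ D.scale * L := one_le_mul_of_one_le_of_one_le h1 hL
  set R := (D.scale * L) ^ D.order with hR
  have hR1 : 1 ≤ R := one_le_pow₀ hs1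
  have hint : ∀ i, IntegrableOn (fun t => ‖D.profile (e i) t‖ ^ 2) (Ioc 0 R) := fun i =>
    (((D.continuous_profile (e i)).norm.pow 2).integrableOn_Icc).mono_set Ioc_subset_Icc_self
  -- Pairing the equation with e i gives ∫ weight |u|² = 1/λ ≥ 1/L. Beyond R the weight is at most b
  -- t²/(2L), and ∫ b t²|u|² ≤ 1, so at least 1/(2L) of this integral comes from (0, R].
  have hlow : ∀ i ∈ s, 1 / (2 * L) ≤ D.μ * R ^ 2 * ∫ t in Ioc 0 R, ‖D.profile (e i) t‖ ^ 2 := by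
    intro i hi
    have hn := D.norm_sq_eq_of_eigen (heig i)
    rw [he.1 i, one_pow] at hn
    have hI : ∫ t in Ioi (0 : ℝ), D.weight t * ‖D.profile (e i) t‖ ^ 2 ≤
        D.μ * R ^ 2 * (∫ t in Ioc 0 R, ‖D.profile (e i) t‖ ^ 2) + D.b / (2 * L) *
          ∫ t in Ioi (0 : ℝ), t ^ 2 * ‖D.profile (e i) t‖ ^ 2 := by
      rw [← integral_const_mul, ← integral_const_mul]
      have hi1 : IntegrableOn ((Ioc 0 R).indicator
          fun t => D.μ * R ^ 2 * ‖D.profile (e i) t‖ ^ 2) (Ioi 0) :=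
        (IntegrableOn.integrable_indicator ((hint i).const_mul _) measurableSet_Ioc).integrableOn
      have hi2 := (D.norm_sq_snd (D.incl_mem (e i))).1.const_mul (D.b / (2 * L))
      have e1 : ∫ t in Ioc 0 R, D.μ * R ^ 2 * ‖D.profile (e i) t‖ ^ 2 =
          ∫ t in Ioi 0, (Ioc 0 R).indicator
            (fun t => D.μ * R ^ 2 * ‖D.profile (e i) t‖ ^ 2) t := by
        rw [integral_indicator measurableSet_Ioc, Measure.restrict_restrict measurableSet_Ioc,
          inter_eq_left.2 fun s hs => hs.1]
      rw [e1, ← integral_add hi1 hi2]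
      refine setIntegral_mono_on (D.integrableOn_weight_mul (e i)) (hi1.add hi2) measurableSet_Ioi
        fun t ht => ?_
      by_cases htR : t ≤ R
      · rw [indicator_of_mem (show t ∈ Ioc 0 R from ⟨ht, htR⟩)]
        have h2 := D.weight_le_of_le ht hR1 htR
        have h3 : 0 ≤ D.b / (2 * L) * (t ^ 2 * ‖D.profile (e i) t‖ ^ 2) := by positivity
        have h4 := mul_le_mul_of_nonneg_right h2 (sq_nonneg ‖D.profile (e i) t‖)
        linarith
      · rw [indicator_of_notMem (fun h => htR h.2), zero_add, ← mul_assoc]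
        exact mul_le_mul_of_nonneg_right (D.weight_le_of_scale hL (not_le.1 htR).le) (sq_nonneg _)
    have h5 := D.integral_sq_mul_profile_sq_le (D.incl_mem (e i))
    rw [D.incl.norm_map, he.1 i, one_pow] at h5
    have h6 : D.b / (2 * L) * ∫ t in Ioi (0 : ℝ), t ^ 2 * ‖D.profile (e i) t‖ ^ 2 ≤ 1 / (2 * L) := by
      calc _ ≤ D.b / (2 * L) * (1 / D.b) := by gcongr
        _ = _ := by field_simp
    have h7 : 1 / L ≤ ∫ t in Ioi (0 : ℝ), D.weight t * ‖D.profile (e i) t‖ ^ 2 := by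
      have h8 : 1 / L ≤ 1 / lam i := one_div_le_one_div_of_le (hpos i) (hs i hi)
      have h9 : 1 / lam i = ∫ t in Ioi (0 : ℝ), D.weight t * ‖D.profile (e i) t‖ ^ 2 := by
        rw [div_eq_iff (hpos i).ne', mul_comm]; exact hn
      linarith
    have h10 : 1 / L = 1 / (2 * L) + 1 / (2 * L) := by field_simp; norm_num
    linarith
  -- Summing the lower bounds under one integral lets Bessel's inequality bound all the functions at
  -- once on (0, R].
  have hsum : (s.card : ℝ) * (1 / (2 * L)) ≤ D.μ * R ^ 2 * (R / D.a * R) := by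
    calc (s.card : ℝ) * (1 / (2 * L)) = ∑ i ∈ s, 1 / (2 * L) := by simp
      _ ≤ ∑ i ∈ s, D.μ * R ^ 2 * ∫ t in Ioc 0 R, ‖D.profile (e i) t‖ ^ 2 := Finset.sum_le_sum hlow
      _ = D.μ * R ^ 2 * ∫ t in Ioc 0 R, ∑ i ∈ s, ‖D.profile (e i) t‖ ^ 2 := by
        rw [← Finset.mul_sum, integral_finsetSum _ fun i _ => hint i]
      _ ≤ D.μ * R ^ 2 * ∫ t in Ioc 0 R, R / D.a := by
        refine mul_le_mul_of_nonneg_left ?_ (by positivity)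
        refine setIntegral_mono_on (integrable_finsetSum _ fun i _ => hint i)
          (integrable_const _) measurableSet_Ioc fun t ht => ?_
        refine (D.sum_profile_sq_le he s ht.1.le).trans ?_
        gcongr
        exact ht.2
      _ = _ := by
        rw [integral_const, measureReal_restrict_apply_univ, Real.volume_real_Ioc,
          smul_eq_mul, sub_zero, max_eq_left (by linarith)]; ring
  rw [mul_one_div, div_le_iff₀ (by positivity)] at hsum
  calc _ ≤ _ := hsum
    _ = _ := by ring


theorem norm_sq_toL2_le (z : D.HSpace) :
    ‖D.toL2 z‖ ^ 2 ≤ 4 * (1 / D.a + 1 / D.b) * ‖z‖ ^ 2 := by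
  have := D.norm_sq_toLp_mul_profile_le growth_one (D.incl_mem z)
  rw [D.incl.norm_map, one_pow, mul_one] at this
  exact this

theorem integrableOn_profile_sq (z : D.HSpace) :
    IntegrableOn (fun t => ‖D.profile z t‖ ^ 2) (Ioi 0) := by
  refine (integrable_norm_sq_L2 (D.toL2 z)).congr ?_
  filter_upwards [D.coeFn_toL2 z] with t ht
  rw [ht]

theorem integral_profile_sq_le (z : D.HSpace) :
    ∫ t in Ioi (0 : ℝ), ‖D.profile z t‖ ^ 2 ≤ 4 * (1 / D.a + 1 / D.b) * ‖z‖ ^ 2 := by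
  refine le_of_eq_of_le ?_ (D.norm_sq_toL2_le z)
  rw [norm_sq_L2]
  refine integral_congr_ae ?_
  filter_upwards [D.coeFn_toL2 z] with t ht
  rw [ht]

/-- Beyond the threshold R the weight term uses up at most half of b t²; below it the term is
bounded by a constant polynomial in L. -/
theorem coeff_lower_bound {lam L t : ℝ} (hL : 1 ≤ L) (hlam : lam ≤ L) (ht : 0 < t) :
    D.b / (2 * D.a) * t ^ 2 - L * D.μ * ((D.scale * L) ^ D.order) ^ 2 / D.a ≤ D.coeff lam t := by
  have ha := D.a_pos
  have hb := D.b_pos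
  have hμ := D.μ_pos
  have hR1 : 1 ≤ (D.scale * L) ^ D.order :=
    one_le_pow₀ (one_le_mul_of_one_le_of_one_le D.one_le_scale hL)
  set R := (D.scale * L) ^ D.order
  have hw := D.weight_nonneg t
  have key : lam * D.weight t ≤ D.b / 2 * t ^ 2 + L * D.μ * R ^ 2 := by
    have h1 : lam * D.weight t ≤ L * D.weight t := by gcongr
    rcases le_total R t with h | h
    · have h2 := D.weight_le_of_scale hL h
      have h3 : L * D.weight t ≤ L * (D.b / (2 * L) * t ^ 2) := by gcongr
      have h4 : L * (D.b / (2 * L) * t ^ 2) = D.b / 2 * t ^ 2 := by field_simp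
      have h5 : 0 ≤ L * D.μ * R ^ 2 := by positivity
      linarith
    · have h2 := D.weight_le_of_le ht hR1 h
      have h3 : L * D.weight t ≤ L * (D.μ * R ^ 2) := by gcongr
      have h5 : 0 ≤ D.b / 2 * t ^ 2 := by positivity
      linarith
  rw [coeff, le_div_iff₀ ha, sub_mul, div_mul_cancel₀ _ ha.ne']
  have : D.b / (2 * D.a) * t ^ 2 * D.a = D.b / 2 * t ^ 2 := by field_simp
  linarith

theorem coeff_nonneg {lam L t : ℝ} (hL : 1 ≤ L) (hlam : lam ≤ L)
    (ht : (D.scale * L) ^ D.order ≤ t) : 0 ≤ D.coeff lam t := by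
  have hb := D.b_pos
  have h2 := D.weight_le_of_scale hL ht
  have h3 : lam * D.weight t ≤ L * (D.b / (2 * L) * t ^ 2) := by
    have := D.weight_nonneg t
    gcongr
  have h4 : L * (D.b / (2 * L) * t ^ 2) = D.b / 2 * t ^ 2 := by field_simp
  refine div_nonneg ?_ D.a_pos.le
  nlinarith [mul_nonneg hb.le (sq_nonneg t)]

/-- The eigenfunctions decay: their fourth moments are polynomially bounded. -/
theorem fourth_moment {lam L : ℝ} (hL : 1 ≤ L) (hlam : lam ≤ L) {z : D.HSpace}
    (hz : z = (lam : ℂ) • D.solOp z) :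
    IntegrableOn (fun t => t ^ 4 * ‖D.profile z t‖ ^ 2) (Ioi 0) ∧
    ∫ t in Ioi (0 : ℝ), t ^ 4 * ‖D.profile z t‖ ^ 2 ≤
      2 * D.a / D.b * (D.μ / (D.a * D.b) + 4 * (1 / D.a + 1 / D.b)) *
        (L * ((D.scale * L) ^ D.order) ^ 2) * ‖z‖ ^ 2 := by
  have ha := D.a_pos
  have hb := D.b_pos
  have hμ := D.μ_pos
  have hR1 : 1 ≤ (D.scale * L) ^ D.order :=
    one_le_pow₀ (one_le_mul_of_one_le_of_one_le D.one_le_scale hL)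
  have hlow := fun t (ht : 0 < t) => D.coeff_lower_bound hL hlam ht
  have hnn := fun t => D.coeff_nonneg (t := t) hL hlam
  set R := (D.scale * L) ^ D.order
  obtain ⟨y, hy, hfst, hint⟩ := D.exists_deriv_of_eigen hz
  have hyc : Continuous y := continuous_iff_continuousAt.2 fun t => (hy t).continuousAt
  set U : ℝ → ℂ := fun t => ∫ s in (0 : ℝ)..t, y s with hU
  have hUd : ∀ t, HasDerivAt U (y t) t := fun t => (hyc.integral_hasStrictDerivAt 0 t).hasDerivAt
  have hUc : Continuous U := continuous_iff_continuousAt.2 fun t => (hUd t).continuousAt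
  have hUu : ∀ t, 0 ≤ t → D.profile z t = U t := hint
  -- P is half the derivative of |U|², and the equation makes its derivative explicit for t ≥ 0.
  set P : ℝ → ℝ := fun t => inner ℝ (U t) (y t) with hP
  have hPd : ∀ t, 0 ≤ t → HasDerivAt P (D.coeff lam t * ‖U t‖ ^ 2 + ‖y t‖ ^ 2) t := by
    intro t ht
    have h1 := hy t
    rw [hUu t ht, ← Complex.real_smul] at h1
    have h2 := (hUd t).inner ℝ h1
    rwa [inner_smul_right, real_inner_self_eq_norm_sq, real_inner_self_eq_norm_sq] at h2
  have hPc : Continuous P := hUc.inner hyc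
  -- the boundary term has a sign far out
  have hPint : IntegrableOn P (Ioi 0) := by
    have h1 : IntegrableOn (fun t => ‖U t‖ ^ 2) (Ioi 0) :=
      (D.integrableOn_profile_sq z).congr_fun (fun t ht => by simp only [hUu t (le_of_lt ht)])
        measurableSet_Ioi
    have h2 : IntegrableOn (fun t => ‖y t‖ ^ 2) (Ioi 0) := by
      have h3 := (integrable_norm_sq_L2 (z : L2Pair).fst).const_mul (D.a)⁻¹
      refine h3.congr ?_
      filter_upwards [hfst] with t ht
      rw [ht, norm_mul, mul_pow, Complex.norm_real, Real.norm_eq_abs, sq_abs,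
        Real.sq_sqrt ha.le]
      field_simp
    refine Integrable.mono' (h1.add h2) hPc.aestronglyMeasurable
      (Eventually.of_forall fun t => ?_)
    have h4 := norm_inner_le_norm (𝕜 := ℝ) (U t) (y t)
    simp only [Pi.add_apply]
    nlinarith [sq_nonneg (‖U t‖ - ‖y t‖), norm_nonneg (U t), norm_nonneg (y t)]
  -- Past R the coefficient is nonnegative, so P is nondecreasing there; a positive value would
  -- persist and contradict integrability.
  have hPneg : ∀ r, R ≤ r → P r ≤ 0 := by
    intro r hr
    by_contra! hpos
    have hmono : MonotoneOn P (Ici r) := by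
      refine monotoneOn_of_deriv_nonneg (convex_Ici r) hPc.continuousOn ?_ ?_
      · intro t ht
        rw [interior_Ici] at ht
        have : (0 : ℝ) ≤ t := by linarith [mem_Ioi.1 ht]
        exact (hPd t this).differentiableAt.differentiableWithinAt
      · intro t ht
        rw [interior_Ici] at ht
        have h1 : (0 : ℝ) ≤ t := by linarith [mem_Ioi.1 ht]
        rw [(hPd t h1).deriv]
        have := hnn t (by linarith [mem_Ioi.1 ht])
        positivity
    have hc : IntegrableOn (fun _ => P r) (Ioi r) := by
      refine Integrable.mono' (hPint.mono_set (Ioi_subset_Ioi (by linarith)))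
        aestronglyMeasurable_const ((ae_restrict_iff' measurableSet_Ioi).2
          (Eventually.of_forall fun t ht => ?_))
      rw [Real.norm_of_nonneg hpos.le]
      exact hmono self_mem_Ici (le_of_lt (mem_Ioi.1 ht)) (le_of_lt (mem_Ioi.1 ht))
    rw [integrableOn_const_iff] at hc
    rcases hc with hc | hc
    · exact hpos.ne' (by simpa using hc)
    · simp at hc
  set B := 2 * D.a / D.b * (D.μ / (D.a * D.b) + 4 * (1 / D.a + 1 / D.b)) * (L * R ^ 2) * ‖z‖ ^ 2
    with hB
  -- Integrate (t² P)' over (0, r). The boundary term r² P(r) is nonpositive, so ∫ t² `coeff` |U|²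
  -- is controlled, and the lower bound for `coeff` turns this into a bound for the fourth moment.
  have hbound : ∀ r, R ≤ r → ∫ t in (0 : ℝ)..r, t ^ 4 * ‖D.profile z t‖ ^ 2 ≤ B := by
    intro r hr
    have hr0 : 0 ≤ r := by linarith
    have hderiv : ∀ t ∈ uIcc 0 r, HasDerivAt (fun t => t ^ 2 * P t)
        (2 * t * P t + t ^ 2 * (D.coeff lam t * ‖U t‖ ^ 2 + ‖y t‖ ^ 2)) t := by
      intro t ht
      rw [uIcc_of_le hr0] at ht
      have h1 : HasDerivAt (fun t : ℝ => t ^ 2) (2 * t) t := by simpa using hasDerivAt_pow 2 t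
      exact h1.mul (hPd t ht.1)
    have hcc := D.continuous_coeff lam
    have hFTC := intervalIntegral.integral_eq_sub_of_hasDerivAt hderiv
      (Continuous.intervalIntegrable (by fun_prop) _ _)
    have hle : ∫ t in (0 : ℝ)..r, (D.b / (2 * D.a) * (t ^ 4 * ‖U t‖ ^ 2) -
        (L * D.μ * R ^ 2 / D.a * (t ^ 2 * ‖U t‖ ^ 2) + ‖U t‖ ^ 2)) ≤
        ∫ t in (0 : ℝ)..r, (2 * t * P t + t ^ 2 * (D.coeff lam t * ‖U t‖ ^ 2 + ‖y t‖ ^ 2)) := by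
      refine intervalIntegral.integral_mono_on_of_le_Ioo hr0
        (Continuous.intervalIntegrable (by fun_prop) _ _)
        (Continuous.intervalIntegrable (by fun_prop) _ _) fun t ht => ?_
      have h1 := hlow t ht.1
      -- This is the square of |U + t y|; it absorbs the indefinite term 2tP at the cost of |U|².
      have h2 : 0 ≤ ‖U t‖ ^ 2 + 2 * (t * P t) + t ^ 2 * ‖y t‖ ^ 2 := by
        have h3 := norm_add_sq_real (U t) (t • y t)
        rw [inner_smul_right, norm_smul, mul_pow, Real.norm_eq_abs, sq_abs] at h3
        rw [hP]
        simp only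
        rw [← h3]
        positivity
      have h4 : (D.b / (2 * D.a) * t ^ 2 - L * D.μ * R ^ 2 / D.a) * (t ^ 2 * ‖U t‖ ^ 2) ≤
        D.coeff lam t * (t ^ 2 * ‖U t‖ ^ 2) := by gcongr
      nlinarith
    rw [hFTC, intervalIntegral.integral_sub (Continuous.intervalIntegrable (by fun_prop) _ _)
      (Continuous.intervalIntegrable (by fun_prop) _ _),
      intervalIntegral.integral_add (Continuous.intervalIntegrable (by fun_prop) _ _)
      (Continuous.intervalIntegrable (by fun_prop) _ _), intervalIntegral.integral_const_mul,
      intervalIntegral.integral_const_mul] at hle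
    have h5 : r ^ 2 * P r - 0 ^ 2 * P 0 ≤ 0 := by
      have := mul_nonneg (sq_nonneg r) (neg_nonneg.2 (hPneg r hr))
      linarith
    have hUeq : ∀ k : ℕ, ∫ t in (0 : ℝ)..r, t ^ k * ‖U t‖ ^ 2 =
        ∫ t in (0 : ℝ)..r, t ^ k * ‖D.profile z t‖ ^ 2 := fun k => by
      refine intervalIntegral.integral_congr fun t ht => ?_
      rw [uIcc_of_le hr0] at ht
      simp only [hUu t ht.1]
    have h6 : ∫ t in (0 : ℝ)..r, t ^ 2 * ‖U t‖ ^ 2 ≤ ‖z‖ ^ 2 / D.b := by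
      rw [hUeq, intervalIntegral.integral_of_le hr0]
      have := D.integral_sq_mul_profile_sq_le (D.incl_mem z)
      rw [D.incl.norm_map] at this
      refine le_trans (setIntegral_mono_set (D.norm_sq_snd (D.incl_mem z)).1
        (Eventually.of_forall fun t => by positivity) ?_) this
      exact Eventually.of_forall fun t ht => ht.1
    have h7 : ∫ t in (0 : ℝ)..r, ‖U t‖ ^ 2 ≤ 4 * (1 / D.a + 1 / D.b) * ‖z‖ ^ 2 := by
      have h8 := hUeq 0
      simp only [pow_zero, one_mul] at h8
      rw [h8, intervalIntegral.integral_of_le hr0]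
      refine le_trans (setIntegral_mono_set (D.integrableOn_profile_sq z)
        (Eventually.of_forall fun t => by positivity) ?_) (D.integral_profile_sq_le z)
      exact Eventually.of_forall fun t ht => ht.1
    rw [hUeq] at hle
    have hLR : 1 ≤ L * R ^ 2 := one_le_mul_of_one_le_of_one_le hL (one_le_pow₀ hR1)
    have h9 : D.b / (2 * D.a) * ∫ t in (0 : ℝ)..r, t ^ 4 * ‖D.profile z t‖ ^ 2 ≤
        L * D.μ * R ^ 2 / D.a * (‖z‖ ^ 2 / D.b) +
          (4 * (1 / D.a + 1 / D.b) * ‖z‖ ^ 2) * (L * R ^ 2) := by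
      have h10 : L * D.μ * R ^ 2 / D.a * ∫ t in (0 : ℝ)..r, t ^ 2 * ‖U t‖ ^ 2 ≤
        L * D.μ * R ^ 2 / D.a * (‖z‖ ^ 2 / D.b) := by gcongr
      have h11 : 4 * (1 / D.a + 1 / D.b) * ‖z‖ ^ 2 ≤
        (4 * (1 / D.a + 1 / D.b) * ‖z‖ ^ 2) * (L * R ^ 2) :=
        le_mul_of_one_le_right (by positivity) hLR
      linarith
    have h12 : B = 2 * D.a / D.b * (L * D.μ * R ^ 2 / D.a * (‖z‖ ^ 2 / D.b) +
          (4 * (1 / D.a + 1 / D.b) * ‖z‖ ^ 2) * (L * R ^ 2)) := by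
      rw [hB]; field_simp
    rw [h12]
    calc ∫ t in (0 : ℝ)..r, t ^ 4 * ‖D.profile z t‖ ^ 2
        = 2 * D.a / D.b * (D.b / (2 * D.a) * ∫ t in (0 : ℝ)..r, t ^ 4 * ‖D.profile z t‖ ^ 2) := by
          field_simp
      _ ≤ _ := by gcongr
  have hcont : Continuous fun t => t ^ 4 * ‖D.profile z t‖ ^ 2 :=
    (continuous_pow 4).mul ((D.continuous_profile z).norm.pow 2)
  have hI : IntegrableOn (fun t => t ^ 4 * ‖D.profile z t‖ ^ 2) (Ioi 0) := by
    refine integrableOn_Ioi_of_intervalIntegral_norm_bounded B 0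
      (fun i : ℝ => (hcont.integrableOn_Icc).mono_set Ioc_subset_Icc_self) tendsto_id ?_
    filter_upwards [eventually_ge_atTop R] with r hr
    refine le_of_eq_of_le (intervalIntegral.integral_congr fun t _ => ?_) (hbound r hr)
    exact Real.norm_of_nonneg (by positivity)
  refine ⟨hI, le_of_tendsto (intervalIntegral_tendsto_integral_Ioi 0 hI tendsto_id) ?_⟩
  filter_upwards [eventually_ge_atTop R] with r hr
  exact hbound r hr

end Model

/-! ### Enumeration of the characteristic values and the eigenbasis -/

/-- An infinite set of reals with finitely many elements below every bound is enumerated in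
increasing order by the natural numbers. -/
theorem exists_strictMono_range_eq {S : Set ℝ} (hS : S.Infinite)
    (hfin : ∀ L, (S ∩ Iic L).Finite) :
    ∃ f : ℕ → ℝ, StrictMono f ∧ range f = S ∧ Tendsto f atTop atTop := by
  have hIcc : ∀ x y : S, (Icc x y).Finite := fun x y => by
    refine Finite.of_finite_image ((hfin y).subset ?_) Subtype.val_injective.injOn
    rintro _ ⟨z, hz, rfl⟩
    exact ⟨z.2, hz.2⟩
  obtain ⟨x₀, hx₀⟩ := hS.nonempty
  obtain ⟨m, hm, hmin⟩ := exists_min_image _ id (hfin x₀) ⟨x₀, hx₀, le_refl x₀⟩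
  -- A locally finite linear order with a least and no greatest element is isomorphic to ℕ.
  let _ : LocallyFiniteOrder S := LocallyFiniteOrder.ofFiniteIcc hIcc
  let _ : SuccOrder S := LinearLocallyFiniteOrder.succOrder S
  let _ : PredOrder S := LinearLocallyFiniteOrder.predOrder S
  let _ : OrderBot S :=
    { bot := ⟨m, hm.1⟩
      bot_le := fun x => by
        rcases le_total (x : ℝ) x₀ with h | h
        · exact hmin x ⟨x.2, h⟩
        · exact (show m ≤ x from le_trans hm.2 h) }
  have : NoMaxOrder S := ⟨fun x => by
    by_contra! h
    exact hS ((hfin x).subset fun y hy => ⟨hy, h ⟨y, hy⟩⟩)⟩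
  let φ : S ≃o ℕ := orderIsoNatOfLinearSuccPredArch
  have hmono : StrictMono fun i => (φ.symm i : ℝ) := fun i j h => φ.symm.strictMono h
  have hrange : range (fun i => (φ.symm i : ℝ)) = S := by
    rw [show (fun i => (φ.symm i : ℝ)) = Subtype.val ∘ φ.symm from rfl, range_comp,
      φ.symm.surjective.range_eq, image_univ, Subtype.range_coe]
  refine ⟨_, hmono, hrange, tendsto_atTop_atTop_of_monotone hmono.monotone fun L => ?_⟩
  by_contra! h
  refine hS ((hfin L).subset fun y hy => ⟨hy, ?_⟩)
  rw [← hrange] at hy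
  obtain ⟨i, rfl⟩ := hy
  exact (h i).le

namespace Model

variable (D : Model)

/-- The characteristic values: the inverses of the eigenvalues of the solution operator. -/
def characteristicValues : Set ℝ := {lam | ∃ z : D.HSpace, z ≠ 0 ∧ z = (lam : ℂ) • D.solOp z}

theorem pos_of_eigen {lam : ℝ} {z : D.HSpace} (hz : z = (lam : ℂ) • D.solOp z) (hne : z ≠ 0) :
    0 < lam := by
  have h1 := D.norm_sq_eq_of_eigen hz
  rw [← norm_sq_weightOp] at h1
  have h2 : 0 < ‖z‖ ^ 2 := by positivity
  rw [h1] at h2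
  exact pos_of_mul_pos_left h2 (sq_nonneg _)

theorem exists_unit_eigen (l : D.characteristicValues) :
    ∃ z : D.HSpace, ‖z‖ = 1 ∧ z = ((l : ℝ) : ℂ) • D.solOp z := by
  obtain ⟨z, hne, hz⟩ := l.2
  have hn : ‖z‖ ≠ 0 := norm_ne_zero_iff.2 hne
  refine ⟨((‖z‖⁻¹ : ℝ) : ℂ) • z, ?_, ?_⟩
  · rw [norm_smul, Complex.norm_real, norm_inv, norm_norm, inv_mul_cancel₀ hn]
  · rw [map_smul, smul_comm, ← hz]

/-- A normalized eigenvector. -/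
def eigenvector (l : D.characteristicValues) : D.HSpace := (D.exists_unit_eigen l).choose

theorem norm_eigenvector (l : D.characteristicValues) : ‖D.eigenvector l‖ = 1 :=
  (D.exists_unit_eigen l).choose_spec.1

theorem eigenvector_eq (l : D.characteristicValues) :
    D.eigenvector l = ((l : ℝ) : ℂ) • D.solOp (D.eigenvector l) :=
  (D.exists_unit_eigen l).choose_spec.2

theorem characteristicValue_pos (l : D.characteristicValues) : 0 < (l : ℝ) := by
  refine D.pos_of_eigen (D.eigenvector_eq l) fun h => ?_
  have := D.norm_eigenvector l
  simp [h] at this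

theorem orthonormal_eigenvector : Orthonormal ℂ D.eigenvector := by
  refine ⟨D.norm_eigenvector, fun l l' hne => ?_⟩
  set z := D.eigenvector l with hz
  set z' := D.eigenvector l' with hz'
  have h1 : inner ℂ z z' = ((l' : ℝ) : ℂ) * inner ℂ z (D.solOp z') := by
    rw [← inner_smul_right, ← D.eigenvector_eq l']
  have h2 : inner ℂ z z' = ((l : ℝ) : ℂ) * inner ℂ z (D.solOp z') := by
    have h3 : inner ℂ (D.solOp z) z' = inner ℂ z (D.solOp z') := D.isSymmetric_solOp z z'
    rw [← h3]
    have h4 := inner_smul_left (𝕜 := ℂ) (D.solOp z) z' ((l : ℝ) : ℂ)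
    rwa [← D.eigenvector_eq l, Complex.conj_ofReal] at h4
  have h3 : (((l : ℝ) : ℂ) - ((l' : ℝ) : ℂ)) * inner ℂ z (D.solOp z') = 0 := by
    rw [sub_mul, ← h1, ← h2, sub_self]
  have h4 : ((l : ℝ) : ℂ) - ((l' : ℝ) : ℂ) ≠ 0 := by
    rw [sub_ne_zero]
    exact fun h => hne (Subtype.ext (Complex.ofReal_injective h))
  rw [h1, (mul_eq_zero.1 h3).resolve_left h4, mul_zero]

/-- The spectral theorem provides all complex eigenvalues κ of `solOp`. From κ‖z‖² = ‖`weightOp` z‖²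
and injectivity, each κ with a nonzero eigenvector is the inverse of a positive characteristic
value; by simplicity one vector per value exhausts the eigenspaces. -/
theorem orthogonal_span_eigenvector :
    (Submodule.span ℂ (range D.eigenvector))ᗮ = ⊥ := by
  rw [eq_bot_iff, ← ContinuousLinearMap.orthogonalComplement_iSup_eigenspaces_eq_bot
    D.isCompactOperator_solOp D.isSymmetric_solOp]
  refine Submodule.orthogonal_le (iSup_le fun κ z hz => ?_)
  rw [Module.End.mem_eigenspace_iff] at hz
  replace hz : D.solOp z = κ • z := hz
  by_cases hne : z = 0
  · rw [hne]; exact zero_mem _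
  have h1 : κ * ((‖z‖ ^ 2 : ℝ) : ℂ) = ((‖D.weightOp z‖ ^ 2 : ℝ) : ℂ) := by
    have h2 := D.inner_solOp_eq z z
    rw [hz, inner_smul_right, inner_self_eq_norm_sq_to_K, inner_self_eq_norm_sq_to_K] at h2
    push_cast
    exact h2
  have hn : ‖z‖ ^ 2 ≠ 0 := pow_ne_zero 2 (norm_ne_zero_iff.2 hne)
  have hw : ‖D.weightOp z‖ ^ 2 ≠ 0 :=
    pow_ne_zero 2 (norm_ne_zero_iff.2 fun h => hne (D.weightOp_injective h))
  have hκ : ((‖z‖ ^ 2 / ‖D.weightOp z‖ ^ 2 : ℝ) : ℂ) * κ = 1 := by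
    rw [Complex.ofReal_div, div_mul_eq_mul_div, mul_comm, h1, div_self]
    exact Complex.ofReal_ne_zero.2 hw
  have heig : z = ((‖z‖ ^ 2 / ‖D.weightOp z‖ ^ 2 : ℝ) : ℂ) • D.solOp z := by
    rw [hz, smul_smul, hκ, one_smul]
  let l : D.characteristicValues := ⟨_, z, hne, heig⟩
  have he0 : D.eigenvector l ≠ 0 := fun h => by
    have := D.norm_eigenvector l
    simp [h] at this
  obtain ⟨c, hc⟩ := D.exists_smul_of_eigen (D.eigenvector_eq l) heig he0
  rw [hc]
  exact Submodule.smul_mem _ _ (Submodule.subset_span (mem_range_self l))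

theorem finite_characteristicValues_inter (L : ℝ) : (D.characteristicValues ∩ Iic L).Finite := by
  classical
  by_contra hinf
  set B := 2 * max 1 L * (D.μ * ((D.scale * max 1 L) ^ D.order) ^ 4 / D.a) with hB
  obtain ⟨s, hs, hcard⟩ := Set.Infinite.exists_subset_card_eq hinf (⌈B⌉₊ + 1)
  let s' : Finset D.characteristicValues := s.subtype (· ∈ D.characteristicValues)
  have h1 := D.card_le_of_eigen D.orthonormal_eigenvector D.eigenvector_eq
    D.characteristicValue_pos (le_max_left 1 L) s' fun i hi =>
      le_trans (hs (Finset.mem_subtype.1 hi)).2 (le_max_right 1 L)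
  have h2 : s'.card = s.card := by
    rw [← Finset.card_map (Function.Embedding.subtype _), Finset.subtype_map_of_mem]
    exact fun x hx => (hs hx).1
  rw [h2, hcard, ← hB] at h1
  push_cast at h1
  linarith [Nat.le_ceil B]

/-- Bumps of outer radius 1/2 centred at 1, 2, 3, …: evaluations at the centres form a dual family.
-/
theorem exists_linearIndependent : ∃ v : ℕ → D.HSpace, LinearIndependent ℂ v := by
  let f (k : ℕ) : ContDiffBump ((k : ℝ) + 1) := ⟨1 / 4, 1 / 2, by norm_num, by norm_num⟩
  have hf (k : ℕ) : IsTest fun t => (f k t : ℂ) := by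
    refine isTest_ofReal (f k).contDiff (f k).hasCompactSupport ?_
    rw [(f k).tsupport_eq]
    intro t ht
    rw [mem_closedBall_iff_norm, Real.norm_eq_abs, abs_le] at ht
    have h1 : (f k).rOut = 1 / 2 := rfl
    rw [h1] at ht
    have h2 : (0 : ℝ) ≤ k := k.cast_nonneg
    rw [mem_Ioi]
    linarith [ht.1]
  have heval (i j : ℕ) : D.evalAt ((i : ℝ) + 1) (D.embed (hf j)) = (f j ((i : ℝ) + 1) : ℂ) := by
    rw [evalAt_apply, profile_embed]
  refine ⟨fun k => D.embed (hf k), LinearIndependent.of_pairwise_dual_eq_zero_one _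
    (fun k => (D.evalAt ((k : ℝ) + 1)).toLinearMap) (fun i j hij => ?_) fun i => ?_⟩
  · change D.evalAt ((i : ℝ) + 1) (D.embed (hf j)) = 0
    rw [heval, (f j).zero_of_le_dist, Complex.ofReal_zero]
    have h1 : (f j).rOut = 1 / 2 := rfl
    rw [h1, dist_add_right, Nat.dist_cast_real]
    have h2 : 1 ≤ dist i j := Nat.pairwise_one_le_dist hij
    linarith
  · change D.evalAt ((i : ℝ) + 1) (D.embed (hf i)) = 1
    rw [heval, (f i).one_of_mem_closedBall (Metric.mem_closedBall_self (f i).rIn_pos.le),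
      Complex.ofReal_one]

/-- With finitely many values, the span of the eigenvectors would be finite-dimensional with trivial
orthogonal complement, hence the whole space. -/
theorem infinite_characteristicValues : D.characteristicValues.Infinite := by
  intro hfin
  have : Finite D.characteristicValues := hfin
  have : FiniteDimensional ℂ (Submodule.span ℂ (range D.eigenvector)) :=
    FiniteDimensional.span_of_finite ℂ (finite_range _)
  have htop := Submodule.orthogonal_eq_bot_iff.1 D.orthogonal_span_eigenvector
  have : FiniteDimensional ℂ D.HSpace := by
    rw [htop] at this
    exact Module.Finite.equiv (Submodule.topEquiv (R := ℂ) (M := D.HSpace))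
  obtain ⟨v, hv⟩ := D.exists_linearIndependent
  exact not_finite_iff_infinite.2 inferInstance hv.finite

/-- A Hilbert basis of eigenvectors with increasing characteristic values. -/
structure Eigenbasis where
  basis : HilbertBasis ℕ ℂ D.HSpace
  lam : ℕ → ℝ
  pos : ∀ i, 0 < lam i
  strictMono : StrictMono lam
  tendsto : Tendsto lam atTop atTop
  eigen : ∀ i, basis i = (lam i : ℂ) • D.solOp (basis i)

theorem nonempty_eigenbasis : Nonempty D.Eigenbasis := by
  obtain ⟨f, hmono, hrange, htend⟩ :=
    exists_strictMono_range_eq D.infinite_characteristicValues D.finite_characteristicValues_inter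
  have hmem : ∀ i, f i ∈ D.characteristicValues := fun i => hrange ▸ mem_range_self i
  let g : ℕ → D.characteristicValues := fun i => ⟨f i, hmem i⟩
  have hginj : Function.Injective g := fun i j h => hmono.injective (congrArg Subtype.val h)
  have hgsurj : Function.Surjective g := fun l => by
    obtain ⟨i, hi⟩ := hrange.ge l.2
    exact ⟨i, Subtype.ext hi⟩
  have horth : Orthonormal ℂ (D.eigenvector ∘ g) := D.orthonormal_eigenvector.comp g hginj
  have hspan : (Submodule.span ℂ (range (D.eigenvector ∘ g)))ᗮ = ⊥ := by
    rw [hgsurj.range_comp]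
    exact D.orthogonal_span_eigenvector
  refine ⟨⟨HilbertBasis.mkOfOrthogonalEqBot horth hspan, f, fun i => D.characteristicValue_pos (g i),
    hmono, htend, fun i => ?_⟩⟩
  rw [HilbertBasis.coe_mkOfOrthogonalEqBot]
  exact D.eigenvector_eq (g i)

/-- The characteristic values grow at least like a power of the index. -/
theorem Eigenbasis.index_le {D : Model} (e : D.Eigenbasis) :
    ∃ C : ℝ, ∃ N : ℕ, 0 ≤ C ∧ ∀ i : ℕ, (i : ℝ) + 1 ≤ C * (1 + e.lam i) ^ N := by
  have ha := D.a_pos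
  have hμ := D.μ_pos
  have hs := D.one_le_scale
  refine ⟨2 * (D.μ * (D.scale ^ D.order) ^ 4 / D.a), 1 + D.order * 4, by positivity, fun i => ?_⟩
  -- The first i + 1 values are at most L = 1 + λ_i, where the added 1 secures L ≥ 1.
  have h := D.card_le_of_eigen e.basis.orthonormal e.eigen e.pos
    (L := 1 + e.lam i) (by linarith [e.pos i]) (Finset.range (i + 1)) fun j hj => by
      have := e.strictMono.monotone (Nat.lt_succ_iff.1 (Finset.mem_range.1 hj))
      linarith
  rw [Finset.card_range] at h
  push_cast at h
  refine h.trans (le_of_eq ?_)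
  rw [mul_pow, mul_pow, ← pow_mul (1 + e.lam i), pow_add]
  ring

end Model

/-! ### The Markushevich basis of L² -/

theorem ae_eq_zero_of_inner_isTest {f : L2}
    (h : ∀ φ, ∀ hφ : IsTest φ, inner ℂ (hφ.memLp.toLp φ) f = 0) : f = 0 := by
  refine (Lp.eq_zero_iff_ae_eq_zero).2 (ae_eq_zero_of_forall_isTest (locallyIntegrableOn_L2 f)
    fun g hg => ?_)
  rw [← h _ hg, Model.inner_toLp_isTest hg]
  simp only [Complex.conj_ofReal]

namespace Model

variable (D : Model)

theorem contDiffOn_weight : ContDiffOn ℝ ∞ (fun t => (D.weight t : ℂ)) (Ioi 0) := by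
  refine contDiff_ofReal_complex.comp_contDiffOn (ContDiffOn.congr (f := fun t => D.μ * t ^ D.p)
    (contDiffOn_const.mul fun t ht => ?_) fun t ht => D.weight_of_pos ht)
  exact (Real.contDiffAt_rpow_const_of_ne (ne_of_gt ht)).contDiffWithinAt

theorem weight_ne_zero {t : ℝ} (ht : 0 < t) : (D.weight t : ℂ) ≠ 0 :=
  Complex.ofReal_ne_zero.2 (D.weight_pos ht).ne'

theorem isTest_weight_mul {φ : ℝ → ℂ} (hφ : IsTest φ) : IsTest fun t => (D.weight t : ℂ) * φ t :=
  hφ.mul_left D.contDiffOn_weight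

theorem isTest_weight_inv_mul {φ : ℝ → ℂ} (hφ : IsTest φ) :
    IsTest fun t => (D.weight t : ℂ)⁻¹ * φ t :=
  hφ.mul_left (D.contDiffOn_weight.inv fun _ ht => D.weight_ne_zero ht)

theorem weight_mul_weight_inv_mul {φ : ℝ → ℂ} (hφ : IsTest φ) (t : ℝ) :
    (D.weight t : ℂ) * ((D.weight t : ℂ)⁻¹ * φ t) = φ t := by
  rcases le_or_gt t 0 with ht | ht
  · rw [hφ.eq_zero ht, mul_zero, mul_zero]
  · rw [mul_inv_cancel_left₀ (D.weight_ne_zero ht)]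

theorem toL2_embed {φ : ℝ → ℂ} (hφ : IsTest φ) : D.toL2 (D.embed hφ) = hφ.memLp.toLp φ := by
  refine Lp.ext ?_
  filter_upwards [D.coeFn_toL2 (D.embed hφ), hφ.memLp.coeFn_toLp] with t h1 h2
  rw [h1, h2, profile_embed]

theorem inner_embed_solOp {φ : ℝ → ℂ} (hφ : IsTest φ) (z : D.HSpace) :
    inner ℂ (D.embed hφ) (D.solOp z) =
      inner ℂ ((D.isTest_weight_mul hφ).memLp.toLp fun t => (D.weight t : ℂ) * φ t) (D.toL2 z) := by
  rw [inner_solOp, inner_toLp_isTest (D.isTest_weight_mul hφ)]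
  refine integral_congr_ae ?_
  filter_upwards [D.coeFn_toL2 z] with t ht
  rw [ht, profile_embed, map_mul, Complex.conj_ofReal, mul_assoc]

/-- The solution operator inverts `diffOp / weight`. -/
theorem inner_embed_eq_solOp {φ : ℝ → ℂ} (hφ : IsTest φ) (z : D.HSpace) :
    inner ℂ (D.embed hφ) z =
      inner ℂ (D.embed (D.isTest_weight_inv_mul (D.isTest_diffOp hφ))) (D.solOp z) := by
  rw [inner_embed_solOp, inner_embed_eq]
  congr 2
  funext t
  exact (D.weight_mul_weight_inv_mul (D.isTest_diffOp hφ) t).symm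

theorem norm_sq_weight_mul_le (z : D.HSpace) {t : ℝ} (ht : 0 < t) :
    ‖(D.weight t : ℂ) * D.profile z t‖ ^ 2 ≤
      8 * D.μ ^ 2 * (‖D.profile z t‖ ^ 2 + t ^ 4 * ‖D.profile z t‖ ^ 2) := by
  have h1 : D.weight t ^ 2 ≤ (D.μ * (1 + t) ^ 2) ^ 2 :=
    pow_le_pow_left₀ (D.weight_nonneg t) (D.weight_le_one_add_sq ht) 2
  have h2 : (1 + t) ^ 4 ≤ 2 ^ 3 * (1 ^ 4 + t ^ 4) := add_pow_le zero_le_one ht.le 4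
  rw [norm_mul, mul_pow, Complex.norm_real, Real.norm_eq_abs, sq_abs]
  calc D.weight t ^ 2 * ‖D.profile z t‖ ^ 2 ≤ (D.μ * (1 + t) ^ 2) ^ 2 * ‖D.profile z t‖ ^ 2 := by
        gcongr
    _ = D.μ ^ 2 * (1 + t) ^ 4 * ‖D.profile z t‖ ^ 2 := by ring
    _ ≤ D.μ ^ 2 * (2 ^ 3 * (1 ^ 4 + t ^ 4)) * ‖D.profile z t‖ ^ 2 := by gcongr
    _ = _ := by ring

/-- Elements of the form space control only t w in L², whereas the weight may grow almost like t².
For eigenfunctions the fourth moment closes the gap. -/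
theorem memLp_weight_mul {lam : ℝ} {z : D.HSpace} (hz : z = (lam : ℂ) • D.solOp z) :
    MemLp (fun t => (D.weight t : ℂ) * D.profile z t) 2 (volume.restrict (Ioi (0 : ℝ))) := by
  have h := (D.fourth_moment (le_max_left 1 lam) (le_max_right 1 lam) hz).1
  refine memLp_two_of_norm_sq_le ?_ (((D.integrableOn_profile_sq z).add h).const_mul (8 * D.μ ^ 2))
    ((ae_restrict_iff' measurableSet_Ioi).2 (Eventually.of_forall fun t ht =>
      D.norm_sq_weight_mul_le z ht))
  exact ((Complex.continuous_ofReal.comp D.continuous_weight).mul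
    (D.continuous_profile z)).aestronglyMeasurable

/-- `weight` times an eigenfunction, as an element of `L²`. -/
def weighted {lam : ℝ} {z : D.HSpace} (hz : z = (lam : ℂ) • D.solOp z) : L2 :=
  (D.memLp_weight_mul hz).toLp _

theorem norm_weighted_le :
    ∃ C : ℝ, ∃ N : ℕ, 0 ≤ C ∧ ∀ (lam : ℝ) (z : D.HSpace) (hz : z = (lam : ℂ) • D.solOp z),
      0 ≤ lam → ‖z‖ = 1 → ‖D.weighted hz‖ ≤ C * (1 + lam) ^ N := by
  have ha := D.a_pos
  have hb := D.b_pos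
  have hμ := D.μ_pos
  have hs := D.one_le_scale
  set c := 4 * (1 / D.a + 1 / D.b) with hc
  set c' := 2 * D.a / D.b * (D.μ / (D.a * D.b) + c) * (D.scale ^ D.order) ^ 2 with hc'
  have hc0 : 0 ≤ c := by positivity
  have hc0' : 0 ≤ c' := by positivity
  refine ⟨1 + 8 * D.μ ^ 2 * (c + c'), 1 + D.order * 2, by positivity, fun lam z hz h0 hn => ?_⟩
  have hL : 1 ≤ 1 + lam := by linarith
  obtain ⟨h1, h2⟩ := D.fourth_moment hL (by linarith) hz
  have h3 := D.integral_profile_sq_le z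
  have h4 := norm_sq_toLp_le (D.memLp_weight_mul hz)
    (((D.integrableOn_profile_sq z).add h1).const_mul (8 * D.μ ^ 2))
    ((ae_restrict_iff' measurableSet_Ioi).2 (Eventually.of_forall fun t ht =>
      D.norm_sq_weight_mul_le z ht))
  rw [integral_const_mul] at h4
  have h5 := integral_add (D.integrableOn_profile_sq z) h1
  simp only [Pi.add_apply] at h4
  rw [h5] at h4
  rw [hn, ← hc] at h2 h3
  set X := (1 + lam) ^ (1 + D.order * 2) with hX
  have hX1 : 1 ≤ X := one_le_pow₀ hL
  have h6 : 2 * D.a / D.b * (D.μ / (D.a * D.b) + c) *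
      ((1 + lam) * ((D.scale * (1 + lam)) ^ D.order) ^ 2) * 1 ^ 2 = c' * X := by
    rw [hc', hX, pow_add, pow_mul, mul_pow]; ring
  rw [h6] at h2
  have h7 : ‖D.weighted hz‖ ^ 2 ≤ 8 * D.μ ^ 2 * (c * X + c' * X) := by
    refine h4.trans ?_
    have : c * 1 ^ 2 ≤ c * X := by rw [one_pow]; gcongr
    gcongr
    exact h3.trans this
  -- The bound is on the square; x ≤ 1 + x² passes to x itself and explains the summand 1 in the
  -- constant.
  nlinarith [sq_nonneg (‖D.weighted hz‖ - 1)]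

theorem inner_weighted {lam : ℝ} {z : D.HSpace} (hz : z = (lam : ℂ) • D.solOp z) (z' : D.HSpace) :
    inner ℂ (D.weighted hz) (D.toL2 z') = inner ℂ z (D.solOp z') := by
  rw [L2.inner_def, inner_solOp]
  refine integral_congr_ae ?_
  filter_upwards [(D.memLp_weight_mul hz).coeFn_toLp, D.coeFn_toL2 z'] with t h1 h2
  rw [weighted, h1, h2, RCLike.inner_apply, map_mul, Complex.conj_ofReal]
  ring

theorem inner_toLp_weighted {lam : ℝ} {z : D.HSpace} (hz : z = (lam : ℂ) • D.solOp z)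
    {ψ : ℝ → ℂ} (hψ : IsTest ψ) :
    inner ℂ (hψ.memLp.toLp ψ) (D.weighted hz) = inner ℂ (D.embed hψ) (D.solOp z) := by
  rw [inner_toLp_isTest hψ, inner_solOp]
  refine integral_congr_ae ?_
  filter_upwards [(D.memLp_weight_mul hz).coeFn_toLp] with t h1
  rw [weighted, h1, profile_embed]
  ring

namespace Eigenbasis

variable {D} (e : D.Eigenbasis)

theorem eq_zero_of_inner {z : D.HSpace} (h : ∀ i, inner ℂ (e.basis i) z = 0) : z = 0 := by
  refine e.basis.repr.map_eq_zero_iff.1 (lp.ext (funext fun i => ?_))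
  rw [e.basis.repr_apply_apply, h i]; rfl

/-- The span of the eigenfunctions is dense in `L²`. -/
theorem topologicalClosure_span_toL2 :
    (Submodule.span ℂ (range fun i => D.toL2 (e.basis i))).topologicalClosure = ⊤ := by
  rw [Submodule.topologicalClosure_eq_top_iff, eq_bot_iff]
  intro f hf
  rw [Submodule.mem_orthogonal] at hf
  -- A vector f orthogonal to all eigenfunctions in L² has an image under the adjoint of `toL2` that
  -- is orthogonal to a Hilbert basis. So f is orthogonal to the range of `toL2`, which contains the
  -- test functions.
  have hadj : ContinuousLinearMap.adjoint D.toL2 f = 0 := e.eq_zero_of_inner fun i => by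
    rw [ContinuousLinearMap.adjoint_inner_right]
    exact hf _ (Submodule.subset_span (mem_range_self i))
  rw [Submodule.mem_bot]
  refine ae_eq_zero_of_inner_isTest fun φ hφ => ?_
  rw [← D.toL2_embed hφ, ← ContinuousLinearMap.adjoint_inner_right, hadj, inner_zero_right]

/-- The coefficients of a test function decay faster than any power of the characteristic value. -/
theorem exists_coefficient_bound (k : ℕ) : ∀ {φ : ℝ → ℂ} (hφ : IsTest φ), ∃ C : ℝ, 0 ≤ C ∧
    ∀ i, (1 + e.lam i) ^ k * ‖inner ℂ (D.embed hφ) (e.basis i)‖ ≤ C := by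
  induction k with
  | zero =>
    intro φ hφ
    refine ⟨‖D.embed hφ‖, norm_nonneg _, fun i => ?_⟩
    have := norm_inner_le_norm (𝕜 := ℂ) (D.embed hφ) (e.basis i)
    rwa [e.basis.orthonormal.1 i, mul_one, ← one_mul ‖inner ℂ _ _‖, ← pow_zero (1 + e.lam i)]
      at this
  | succ k ih =>
    intro φ hφ
    -- Replacing φ by weight⁻¹(-a∂² + bt²)φ multiplies its i-th coefficient by λ_i and yields a test
    -- function again, so each application gains one power. This is why φ is quantified inside the
    -- induction.
    have hφ' := D.isTest_weight_inv_mul (D.isTest_diffOp hφ)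
    obtain ⟨C, hC0, hC⟩ := ih hφ
    obtain ⟨C', hC0', hC'⟩ := ih hφ'
    refine ⟨C + C', add_nonneg hC0 hC0', fun i => ?_⟩
    have hpos := e.pos i
    have h1 : inner ℂ (D.embed hφ') (e.basis i) =
        (e.lam i : ℂ) * inner ℂ (D.embed hφ) (e.basis i) := by
      rw [D.inner_embed_eq_solOp hφ, ← inner_smul_right, ← e.eigen i]
    have h2 := hC' i
    rw [h1, norm_mul, Complex.norm_real, Real.norm_of_nonneg hpos.le] at h2
    calc _ = (1 + e.lam i) ^ k * ‖inner ℂ (D.embed hφ) (e.basis i)‖ +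
          (1 + e.lam i) ^ k * (e.lam i * ‖inner ℂ (D.embed hφ) (e.basis i)‖) := by ring
      _ ≤ _ := add_le_add (hC i) h2

theorem summable_coefficient_smul_weighted {φ : ℝ → ℂ} (hφ : IsTest φ) :
    Summable fun i => inner ℂ (e.basis i) (D.embed hφ) • D.weighted (e.eigen i) := by
  obtain ⟨C₁, N, hC₁, h₁⟩ := D.norm_weighted_le
  obtain ⟨C₂, M, hC₂, h₂⟩ := e.index_le
  -- Of the decay, N powers pay for the norm of the weighted eigenfunction and 2M powers for (i +
  -- 1)², leaving a convergent series.
  obtain ⟨C, hC, h⟩ := e.exists_coefficient_bound (N + 2 * M) hφ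
  have hs : Summable fun i : ℕ => C * C₁ * C₂ ^ 2 * (1 / ((i : ℝ) + 1) ^ 2) := by
    refine Summable.mul_left _ ?_
    have := (summable_nat_add_iff 1).2 (Real.summable_one_div_nat_pow.2 (one_lt_two))
    simpa using this
  refine Summable.of_norm_bounded hs fun i => ?_
  have hpos := e.pos i
  have h3 := h₁ _ _ (e.eigen i) hpos.le (e.basis.orthonormal.1 i)
  have h4 := h₂ i
  have h5 := h i
  rw [norm_smul, norm_inner_symm, mul_one_div, le_div_iff₀ (by positivity)]
  set d := ‖inner ℂ (D.embed hφ) (e.basis i)‖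
  set X := 1 + e.lam i with hX
  have hX0 : 0 < X := by positivity
  calc d * ‖D.weighted (e.eigen i)‖ * ((i : ℝ) + 1) ^ 2
      ≤ d * (C₁ * X ^ N) * (C₂ * X ^ M) ^ 2 := by gcongr
    _ = X ^ (N + 2 * M) * d * (C₁ * C₂ ^ 2) := by ring
    _ ≤ C * (C₁ * C₂ ^ 2) := by gcongr
    _ = _ := by ring

/-- `weight` times a test function is the sum of its biorthogonal expansion. -/
theorem tsum_coefficient_smul_weighted {φ : ℝ → ℂ} (hφ : IsTest φ) :
    ∑' i, inner ℂ (e.basis i) (D.embed hφ) • D.weighted (e.eigen i) =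
      (D.isTest_weight_mul hφ).memLp.toLp fun t => (D.weight t : ℂ) * φ t := by
  rw [← sub_eq_zero]
  refine ae_eq_zero_of_inner_isTest fun ψ hψ => ?_
  rw [inner_sub_right, sub_eq_zero]
  have h1 := (e.summable_coefficient_smul_weighted hφ).hasSum.mapL
    (innerSL ℂ (hψ.memLp.toLp ψ))
  -- Tested against ψ, the series in L² becomes Parseval's identity in the form space for the pair
  -- `solOp` ψ, φ.
  have h2 := e.basis.hasSum_inner_mul_inner (D.solOp (D.embed hψ)) (D.embed hφ)
  have hsym : ∀ z, inner ℂ (D.solOp (D.embed hψ)) z = inner ℂ (D.embed hψ) (D.solOp z) :=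
    fun z => D.isSymmetric_solOp (D.embed hψ) z
  have h3 : (fun i => innerSL ℂ (hψ.memLp.toLp ψ)
      (inner ℂ (e.basis i) (D.embed hφ) • D.weighted (e.eigen i))) =
      fun i => inner ℂ (D.solOp (D.embed hψ)) (e.basis i) *
        inner ℂ (e.basis i) (D.embed hφ) := by
    funext i
    rw [innerSL_apply_apply, inner_smul_right, D.inner_toLp_weighted (e.eigen i) hψ, hsym, mul_comm]
  rw [h3] at h1
  have h4 := h1.unique h2
  rw [innerSL_apply_apply] at h4
  rw [h4, hsym, inner_solOp, inner_toLp_isTest hψ]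
  refine integral_congr_ae ?_
  filter_upwards [(D.isTest_weight_mul hφ).memLp.coeFn_toLp] with t ht
  rw [ht, profile_embed, profile_embed]
  ring

/-- Any test function ψ is the weight times the test function ψ/weight, hence a convergent sum of
weighted eigenfunctions; f is therefore orthogonal to every ψ. -/
theorem eq_zero_of_inner_weighted {f : L2}
    (h : ∀ i, inner ℂ (D.weighted (e.eigen i)) f = 0) : f = 0 := by
  refine ae_eq_zero_of_inner_isTest fun ψ hψ => ?_
  have hφ := D.isTest_weight_inv_mul hψ
  have h1 := e.tsum_coefficient_smul_weighted hφ
  have h2 : (D.isTest_weight_mul hφ).memLp.toLp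
      (fun t => (D.weight t : ℂ) * ((D.weight t : ℂ)⁻¹ * ψ t)) = hψ.memLp.toLp ψ := by
    congr 1
    funext t
    exact D.weight_mul_weight_inv_mul hψ t
  rw [← h2, ← h1, ← inner_conj_symm]
  have h3 := (e.summable_coefficient_smul_weighted hφ).hasSum.mapL (innerSL ℂ f)
  have h4 : (fun i => innerSL ℂ f
      (inner ℂ (e.basis i) (D.embed hφ) • D.weighted (e.eigen i))) = fun _ => 0 := by
    funext i
    rw [innerSL_apply_apply, inner_smul_right, ← inner_conj_symm f, h i, map_zero, mul_zero]
  rw [h4] at h3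
  rw [← innerSL_apply_apply ℂ f, h3.unique hasSum_zero, map_zero]

/-- The eigenfunctions are a Markushevich basis of `L²`. -/
theorem isMarkushevichBasis_toL2 : IsMarkushevichBasis fun i => D.toL2 (e.basis i) := by
  refine ⟨e.topologicalClosure_span_toL2,
    fun i => (e.lam i : ℂ) • innerSL ℂ (D.weighted (e.eigen i)), fun i j => ?_, fun f hf => ?_⟩
  -- Biorthogonality in L² is orthonormality in the form space: λ_i ∫ weight ū_i u_j = λ_i ⟨u_i,
  -- `solOp` u_j⟩ = ⟨u_i, u_j⟩.
  · rw [_root_.smul_apply, innerSL_apply_apply, D.inner_weighted, smul_eq_mul]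
    have h1 : inner ℂ (e.basis i) (D.solOp (e.basis j)) =
        inner ℂ (D.solOp (e.basis i)) (e.basis j) := (D.isSymmetric_solOp _ _).symm
    have h2 := inner_smul_left (𝕜 := ℂ) (D.solOp (e.basis i)) (e.basis j) (e.lam i : ℂ)
    rw [← e.eigen i, Complex.conj_ofReal] at h2
    rw [h1, ← h2, orthonormal_iff_ite.1 e.basis.orthonormal]
  · refine e.eq_zero_of_inner_weighted fun i => ?_
    have := hf i
    rw [_root_.smul_apply, innerSL_apply_apply, smul_eq_mul] at this
    exact (mul_eq_zero.1 this).resolve_left (Complex.ofReal_ne_zero.2 (e.pos i).ne')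

end Eigenbasis

end Model

/-! ### Separation of variables, smoothness, transport of bases -/

section Laplacian

variable {n : ℕ} {M : Type*} [TopologicalSpace M] [ChartedSpace (EuclideanSpace ℝ (Fin n)) M]

theorem pd_const_smul (i : Fin n) (c : ℂ) (f : EuclideanSpace ℝ (Fin n) → ℂ) :
    pd i (c • f) = c • pd i f := by
  funext y
  rw [pd, fderiv_const_smul_field]
  rfl

theorem laplacian_const_mul [IsManifold (𝓡 n) ∞ M] (σ : Metric (n := n) M) (c : ℂ) (v : M → ℂ)
    (x : M) : laplacian σ (fun x => c * v x) x = c * laplacian σ v x := by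
  have h : (fun x => c * v x) ∘ (chartAt (EuclideanSpace ℝ (Fin n)) x).symm =
      c • (v ∘ (chartAt (EuclideanSpace ℝ (Fin n)) x).symm) := rfl
  simp only [laplacian, h, pd_const_smul, Pi.smul_apply, smul_eq_mul, Finset.mul_sum]
  refine Finset.sum_congr rfl fun i _ => Finset.sum_congr rfl fun j _ => ?_
  rw [mul_sub, mul_sub, mul_sub, mul_left_comm, Finset.mul_sum, Finset.mul_sum, Finset.mul_sum]
  congr 1
  refine Finset.sum_congr rfl fun k _ => ?_
  ring

end Laplacian

/-- A separated product of solutions solves the wave equation. -/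
theorem isWaveSolution_mul {n : ℕ}
    {M : Type*} [TopologicalSpace M] [ChartedSpace (EuclideanSpace ℝ (Fin n)) M]
    [IsManifold (𝓡 n) ∞ M]
    {𝔤 : Type*} [NormedAddCommGroup 𝔤] [NormedSpace ℝ 𝔤] [FiniteDimensional ℝ 𝔤]
    {𝒢 : Type*} [TopologicalSpace 𝒢] [ChartedSpace 𝔤 𝒢] [Group 𝒢] [LieGroup 𝓘(ℝ, 𝔤) ∞ 𝒢]
    {E : M → Type*} [TopologicalSpace (Bundle.TotalSpace 𝔤 E)]
    [∀ x, TopologicalSpace (E x)] [∀ x, AddCommGroup (E x)] [∀ x, Module ℝ (E x)]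
    [FiberBundle 𝔤 E] [VectorBundle ℝ 𝔤 E]
    {B : Background n 𝔤 𝒢 E} {v : M → ℂ} {μ : ℝ} (hv : B.IsEigenpair v μ)
    {w : ℝ → ℂ} {Λ : ℝ} (hw : IsImplicitEigenpair n μ w Λ) :
    B.IsWaveSolution Λ fun t x => w t * v x where
  smooth := by
    have h1 : ContMDiffOn (𝓘(ℝ, ℝ).prod (𝓡 n)) 𝓘(ℝ, ℂ) ∞ (fun q : ℝ × M => w q.1)
        (Ioi 0 ×ˢ univ) :=
      hw.smooth.contMDiffOn.comp contMDiffOn_fst fun q hq => hq.1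
    have h2 : ContMDiffOn (𝓘(ℝ, ℝ).prod (𝓡 n)) 𝓘(ℝ, ℂ) ∞ (fun q : ℝ × M => v q.2)
        (Ioi 0 ×ˢ univ) :=
      hv.smooth.comp_contMDiffOn contMDiffOn_snd
    exact (contDiff_mul (𝕜 := ℝ) (𝔸 := ℂ)).contMDiff.comp_contMDiffOn (h1.prodMk_space h2)
  eqn t ht x := by
    have h1 := hw.eqn t ht
    have h2 := hv.eqn x
    intro τ
    have h3 : deriv (deriv fun s => w s * v x) t = deriv (deriv w) t * v x := by
      rw [deriv_mul_const_field', deriv_mul_const_field]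
    simp only [h3, laplacian_const_mul]
    change _ - (μ : ℂ) * τ * w t - _ = 0 at h1
    -- The spatial operator acts on v as μ, so the wave operator applied to w v is minus the
    -- ordinary differential expression in w, times v.
    linear_combination (-v x) * h1 + (τ * w t) * h2

/-- Bootstrapping: if u and y are of class C^k, so are their derivatives y and q u. The open set
matters because t^p need not be smooth at 0. -/
theorem contDiffOn_of_hasDerivAt_system {u y q : ℝ → ℂ} {s : Set ℝ} (hs : IsOpen s)
    (hq : ContDiffOn ℝ ∞ q s) (hu : ∀ t ∈ s, HasDerivAt u (y t) t)
    (hy : ∀ t ∈ s, HasDerivAt y (q t * u t) t) : ContDiffOn ℝ ∞ u s := by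
  have hdu : EqOn (deriv u) y s := fun t ht => (hu t ht).deriv
  have hdy : EqOn (deriv y) (fun t => q t * u t) s := fun t ht => (hy t ht).deriv
  have hu' : DifferentiableOn ℝ u s := fun t ht => (hu t ht).differentiableAt.differentiableWithinAt
  have hy' : DifferentiableOn ℝ y s := fun t ht => (hy t ht).differentiableAt.differentiableWithinAt
  have key : ∀ k : ℕ, ContDiffOn ℝ k u s ∧ ContDiffOn ℝ k y s := by
    intro k
    induction k with
    | zero =>
      simp only [Nat.cast_zero, contDiffOn_zero]
      exact ⟨hu'.continuousOn, hy'.continuousOn⟩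
    | succ k ih =>
      push_cast
      rw [contDiffOn_succ_iff_deriv_of_isOpen hs, contDiffOn_succ_iff_deriv_of_isOpen hs]
      refine ⟨⟨hu', by simp, ih.2.congr hdu⟩, hy', by simp, ContDiffOn.congr ?_ hdy⟩
      exact (hq.of_le (mod_cast le_top)).mul ih.1
  rw [contDiffOn_infty]
  exact fun k => (key k).1

/-- The transport of a Schauder basis under a continuous linear equivalence. -/
def schauderBasisMap {ι X Y : Type*} [NormedAddCommGroup X] [NormedSpace ℂ X]
    [NormedAddCommGroup Y] [NormedSpace ℂ Y] (b : UnconditionalSchauderBasis ι ℂ X)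
    (T : X ≃L[ℂ] Y) : UnconditionalSchauderBasis ι ℂ Y where
  basis i := T (b i)
  coord i := (b.coord i).comp (T.symm : Y →L[ℂ] X)
  ortho i j := by
    rw [ContinuousLinearMap.comp_apply, ContinuousLinearEquiv.coe_coe, T.symm_apply_apply, b.ortho]
  expansion y := by
    have h := (b.expansion (T.symm y)).mapL (T : X →L[ℂ] Y)
    simp only [map_smul, ContinuousLinearEquiv.coe_coe, T.apply_symm_apply] at h
    exact h

namespace Model

variable (D : Model)

/-- Eigenvectors solve the differential equation classically on `(0, ∞)`. -/
theorem exists_hasDerivAt_profile {lam : ℝ} {z : D.HSpace} (hz : z = (lam : ℂ) • D.solOp z) :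
    ∃ y : ℝ → ℂ, (∀ t, HasDerivAt y (D.coeff lam t * D.profile z t) t) ∧
      ((z : L2Pair).fst =ᵐ[volume.restrict (Ioi (0 : ℝ))] fun t => (Real.sqrt D.a : ℂ) * y t) ∧
      ∀ t, 0 < t → HasDerivAt (D.profile z) (y t) t := by
  obtain ⟨y, hy, hfst, hint⟩ := D.exists_deriv_of_eigen hz
  have hyc : Continuous y := continuous_iff_continuousAt.2 fun t => (hy t).continuousAt
  refine ⟨y, hy, hfst, fun t ht => ?_⟩
  refine (hyc.integral_hasStrictDerivAt 0 t).hasDerivAt.congr_of_eventuallyEq ?_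
  filter_upwards [Ioi_mem_nhds ht] with s hs
  exact hint s (le_of_lt hs)

theorem contDiffOn_profile {lam : ℝ} {z : D.HSpace} (hz : z = (lam : ℂ) • D.solOp z) :
    ContDiffOn ℝ ∞ (D.profile z) (Ioi 0) := by
  obtain ⟨y, hy, -, hp⟩ := D.exists_hasDerivAt_profile hz
  refine contDiffOn_of_hasDerivAt_system (q := fun t => (D.coeff lam t : ℂ)) isOpen_Ioi ?_ hp
    fun t _ => hy t
  have h : ContDiffOn ℝ ∞ (fun t : ℝ => ((D.a : ℂ))⁻¹ *
      ((D.b : ℂ) * (t : ℂ) ^ 2 - (lam : ℂ) * (D.weight t : ℂ))) (Ioi 0) :=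
    contDiffOn_const.mul ((contDiffOn_const.mul (contDiff_ofReal_complex.pow 2).contDiffOn).sub
      (contDiffOn_const.mul D.contDiffOn_weight))
  refine h.congr fun t _ => ?_
  rw [coeff]
  push_cast
  rw [div_eq_inv_mul]

theorem represents_profile {lam : ℝ} {z : D.HSpace} (hz : z = (lam : ℂ) • D.solOp z) :
    Represents (D.profile z) (D.spaceEquiv.symm z : L2Pair) := by
  obtain ⟨y, -, hfst, hp⟩ := D.exists_hasDerivAt_profile hz
  set x := D.spaceEquiv.symm z with hx
  have hzx : (z : L2Pair) = scaleEquiv D.sqrtA D.sqrtB x := by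
    rw [← incl_spaceEquiv, hx, ContinuousLinearEquiv.apply_symm_apply]
  constructor
  · have h := Lp.coeFn_smul (D.sqrtA : ℂ) (x : L2Pair).fst
    have hfst' := hfst
    rw [hzx, scaleEquiv_fst] at hfst'
    filter_upwards [h, hfst', ae_restrict_mem measurableSet_Ioi] with t h1 h2 ht
    rw [(hp t ht).deriv]
    rw [h1, Pi.smul_apply, smul_eq_mul] at h2
    exact mul_left_cancel₀ D.sqrtA.ne_zero h2
  · have h := Lp.coeFn_smul (D.sqrtB : ℂ) (x : L2Pair).snd
    have hsnd := D.space_snd (D.incl_mem z)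
    have hsnd' : (scaleEquiv D.sqrtA D.sqrtB x).snd =ᵐ[volume.restrict (Ioi (0 : ℝ))]
        fun t => (Real.sqrt D.b : ℂ) * (t * D.profile z t) := by
      rw [← hzx]; exact hsnd
    rw [scaleEquiv_snd] at hsnd'
    filter_upwards [h, hsnd'] with t h1 h2
    rw [h1, Pi.smul_apply, smul_eq_mul] at h2
    exact mul_left_cancel₀ D.sqrtB.ne_zero h2

/-! ### Rescaling to the implicit eigenvalue problem -/

/-- The model operator of the implicit eigenvalue problem. -/
def ofDimension {n : ℕ} (hn : 2 ≤ n) {μ : ℝ} (hμ : 0 < μ) : Model where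
  a := 1 / 32 * ((n : ℝ) ^ 2 / ((n : ℝ) - 1))
  b := n
  μ := μ
  p := 2 - 4 / n
  a_pos := by
    have : (2 : ℝ) ≤ n := by exact_mod_cast hn
    have h1 : (0 : ℝ) < n - 1 := by linarith
    positivity
  b_pos := by
    have : (2 : ℝ) ≤ n := by exact_mod_cast hn
    linarith
  μ_pos := hμ
  p_nonneg := by
    have : (2 : ℝ) ≤ n := by exact_mod_cast hn
    rw [sub_nonneg, div_le_iff₀ (by linarith)]
    linarith
  p_lt_two := by
    have : (2 : ℝ) ≤ n := by exact_mod_cast hn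
    have h1 : (0 : ℝ) < 4 / n := by positivity
    linarith

variable {n : ℕ} {hn : 2 ≤ n} {μ : ℝ} {hμ : 0 < μ}

theorem deriv_profile_comp {lam : ℝ} {z : D.HSpace} {y : ℝ → ℂ}
    (hp : ∀ t, 0 < t → HasDerivAt (D.profile z) (y t) t)
    (hy : ∀ t, HasDerivAt y (D.coeff lam t * D.profile z t) t) {c t : ℝ} (hc : 0 < c) (ht : 0 < t) :
    deriv (fun t => D.profile z (c * t)) t = c * y (c * t) ∧
    deriv (deriv fun t => D.profile z (c * t)) t =
      c ^ 2 * (D.coeff lam (c * t) * D.profile z (c * t)) := by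
  have hd : ∀ t, 0 < t → deriv (fun t => D.profile z (c * t)) t = c * y (c * t) := fun t ht => by
    rw [deriv_comp_mul_left, (hp _ (mul_pos hc ht)).deriv, Complex.real_smul]
  refine ⟨hd t ht, ?_⟩
  have h1 : deriv (fun t => D.profile z (c * t)) =ᶠ[𝓝 t] fun t => (c : ℂ) * y (c * t) := by
    filter_upwards [Ioi_mem_nhds ht] with s hs
    exact hd s hs
  rw [h1.deriv_eq, deriv_const_mul_field, deriv_comp_mul_left, (hy _).deriv, Complex.real_smul]
  ring

/-- Under t ↦ t/κ the second derivative contributes κ⁻², so the term b t² acquires κ⁻⁴, which is -Λ,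
and the term λ μ t^p acquires λ κ^(-2-p). The latter factor is 1 exactly when λ = κ^(4-4/n). -/
theorem isImplicitEigenpair_profile (hD : D = ofDimension hn hμ) {lam κ : ℝ} (hκ : 0 < κ) (hlam : lam = κ ^ (4 - 4 / (n : ℝ)))
    {z : D.HSpace} (hz : z = (lam : ℂ) • D.solOp z) :
    IsImplicitEigenpair n μ (fun t => D.profile z (κ⁻¹ * t)) (-κ⁻¹ ^ 4) := by
  have hDp : D.p = 2 - 4 / (n : ℝ) := by rw [hD]; rfl
  have hDμ : D.μ = μ := by rw [hD]; rfl
  obtain ⟨y, hy, -, hp⟩ := D.exists_hasDerivAt_profile hz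
  have hc : 0 < κ⁻¹ := inv_pos.2 hκ
  refine ⟨(D.contDiffOn_profile hz).comp (contDiff_const.mul contDiff_id).contDiffOn
    fun t ht => mul_pos hc ht, fun t ht => ?_⟩
  rw [(D.deriv_profile_comp hp hy hc ht).2]
  have h1 : κ⁻¹ ^ 2 * (lam * D.weight (κ⁻¹ * t)) = μ * t ^ (2 - 4 / (n : ℝ)) := by
    rw [D.weight_of_pos (mul_pos hc ht), Real.mul_rpow hc.le ht.le, hlam, hDp, hDμ]
    have h2 : κ⁻¹ ^ 2 * (κ ^ (4 - 4 / (n : ℝ)) * κ⁻¹ ^ (2 - 4 / (n : ℝ))) = 1 := by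
      rw [Real.inv_rpow hκ.le, ← Real.rpow_neg hκ.le, ← Real.rpow_add hκ, inv_pow,
        show 4 - 4 / (n : ℝ) + -(2 - 4 / (n : ℝ)) = (2 : ℕ) by push_cast; ring, Real.rpow_natCast,
        inv_mul_cancel₀ (by positivity)]
    linear_combination (μ * t ^ (2 - 4 / (n : ℝ))) * h2
  have h2 : D.a * (κ⁻¹ ^ 2 * D.coeff lam (κ⁻¹ * t)) =
      n * t ^ 2 * κ⁻¹ ^ 4 - μ * t ^ (2 - 4 / (n : ℝ)) := by
    rw [← h1, coeff, mul_div_assoc', mul_div_cancel₀ _ D.a_pos.ne']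
    rw [hD, ofDimension]
    ring
  have h3 := congrArg (fun r : ℝ => (r : ℂ)) h2
  have ha : (D.a : ℂ) = 1 / 32 * ((n : ℂ) ^ 2 / ((n : ℂ) - 1)) := by
    simp [hD, ofDimension]
  simp only [Complex.ofReal_mul, Complex.ofReal_sub, Complex.ofReal_pow, ha,
    Complex.ofReal_natCast] at h3
  simp only [Complex.ofReal_neg, Complex.ofReal_pow]
  linear_combination (-D.profile z (κ⁻¹ * t)) * h3

theorem hasFiniteEnergy_profile (hD : D = ofDimension hn hμ) {lam κ : ℝ} (hκ : 0 < κ)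
    {z : D.HSpace} (hz : z = (lam : ℂ) • D.solOp z) :
    HasFiniteEnergy n μ (fun t => D.profile z (κ⁻¹ * t)) := by
  have hDp : D.p = 2 - 4 / (n : ℝ) := by rw [hD]; rfl
  have hDμ : D.μ = μ := by rw [hD]; rfl
  obtain ⟨y, hy, hfst, hp⟩ := D.exists_hasDerivAt_profile hz
  have hc : 0 < κ⁻¹ := inv_pos.2 hκ
  have hyint : IntegrableOn (fun t => ‖y t‖ ^ 2) (Ioi 0) := by
    have h3 := (integrable_norm_sq_L2 (z : L2Pair).fst).const_mul (D.a)⁻¹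
    refine h3.congr ?_
    filter_upwards [hfst] with t ht
    have ha := D.a_pos
    rw [ht, norm_mul, mul_pow, Complex.norm_real, Real.norm_eq_abs, sq_abs, Real.sq_sqrt ha.le]
    field_simp
  have h1 := D.integrableOn_profile_sq z
  have h2 := (D.norm_sq_snd (D.incl_mem z)).1
  have h3 := D.integrableOn_weight_mul z
  have hG : IntegrableOn (fun s => κ⁻¹ ^ 2 * ‖y s‖ ^ 2 + (‖D.profile z s‖ ^ 2 +
      (κ ^ 2 * (s ^ 2 * ‖D.profile z s‖ ^ 2) + κ ^ (2 - 4 / (n : ℝ)) *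
        (D.weight s * ‖D.profile z s‖ ^ 2)))) (Ioi 0) :=
    (hyint.const_mul _).add (h1.add ((h2.const_mul _).add (h3.const_mul _)))
  have hG' := (integrableOn_Ioi_comp_mul_left_iff _ 0 hc).2 (by rwa [mul_zero])
  refine IntegrableOn.congr_fun hG' (fun t ht => ?_) measurableSet_Ioi
  have ht' : 0 < t := ht
  simp only
  rw [(D.deriv_profile_comp hp hy hc ht').1, D.weight_of_pos (mul_pos hc ht'),
    Real.mul_rpow hc.le ht'.le, norm_mul, Complex.norm_real, Real.norm_of_nonneg hc.le, hDp,
    hDμ]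
  have h4 : κ ^ (2 - 4 / (n : ℝ)) * κ⁻¹ ^ (2 - 4 / (n : ℝ)) = 1 := by
    rw [← Real.mul_rpow hκ.le hc.le, mul_inv_cancel₀ hκ.ne', Real.one_rpow]
  have h5 : κ ^ 2 * κ⁻¹ ^ 2 = 1 := by rw [← mul_pow, mul_inv_cancel₀ hκ.ne', one_pow]
  linear_combination (μ * t ^ (2 - 4 / (n : ℝ)) * ‖D.profile z (κ⁻¹ * t)‖ ^ 2) * h4 +
    (t ^ 2 * ‖D.profile z (κ⁻¹ * t)‖ ^ 2) * h5

end Model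

/-- The two exponents in `rescaled` multiply to -1/4, independently of n, and (κ⁻⁴)^(-1/4) = κ
undoes the dilation. -/
theorem rescaled_comp_inv_mul {n : ℕ} (hn : 2 ≤ n) {κ : ℝ} (hκ : 0 < κ) (u : ℝ → ℂ) :
    rescaled n (-κ⁻¹ ^ 4) (fun t => u (κ⁻¹ * t)) = u := by
  have h2 : (2 : ℝ) ≤ n := by exact_mod_cast hn
  have h1 : (n : ℝ) - 1 ≠ 0 := by linarith
  have h0 : (n : ℝ) ≠ 0 := by linarith
  funext t
  rw [rescaled, neg_neg, ← Real.rpow_mul (by positivity), inv_pow, ← Real.rpow_natCast,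
    ← Real.rpow_neg hκ.le, ← Real.rpow_mul hκ.le,
    show -((4 : ℕ) : ℝ) * (-(((n : ℝ) - 1) / n) * ((n : ℝ) / (4 * ((n : ℝ) - 1)))) = 1 by
      push_cast; field_simp, Real.rpow_one, inv_mul_cancel_left₀ hκ.ne']

end GravityYM

end

/-! ### The theorem -/

theorem theorem7p2 (n : ℕ) (hn : 2 ≤ n)
    -- the compact manifold `S₀`
    (M : Type*) [TopologicalSpace M] [T2Space M] [CompactSpace M]
    [ChartedSpace (EuclideanSpace ℝ (Fin n)) M] [IsManifold (𝓡 n) ∞ M]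
    -- the compact, semi-simple, connected Lie group `𝒢`
    (𝔤 : Type*) [NormedAddCommGroup 𝔤] [NormedSpace ℝ 𝔤] [FiniteDimensional ℝ 𝔤]
    (𝒢 : Type*) [TopologicalSpace 𝒢] [CompactSpace 𝒢] [ConnectedSpace 𝒢] [T2Space 𝒢]
    [ChartedSpace 𝔤 𝒢] [Group 𝒢] [LieGroup 𝓘(ℝ, 𝔤) ∞ 𝒢]
    [LieAlgebra.IsSemisimple ℝ (GroupLieAlgebra 𝓘(ℝ, 𝔤) 𝒢)]
    -- the adjoint bundle over `S₀`
    (E : M → Type*) [TopologicalSpace (Bundle.TotalSpace 𝔤 E)]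
    [∀ x, TopologicalSpace (E x)] [∀ x, AddCommGroup (E x)] [∀ x, Module ℝ (E x)]
    [FiberBundle 𝔤 E] [VectorBundle ℝ 𝔤 E] [ContMDiffVectorBundle ∞ 𝔤 E (𝓡 n)]
    (hE : GravityYM.IsAdjointBundle 𝔤 𝒢 E)
    -- the metric, the Yang-Mills and Higgs fields, and the constants
    (B : GravityYM.Background n 𝔤 𝒢 E)
    (v : M → ℂ) (μ : ℝ) (hv : B.IsEigenpair v μ) (hμ : 0 < μ) :
    ∃ (w : ℕ → ℝ → ℂ) (Λ : ℕ → ℝ),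
      (∀ i, GravityYM.IsImplicitEigenpair n μ (w i) (Λ i)) ∧
      (∀ i, GravityYM.HasFiniteEnergy n μ (w i)) ∧
      StrictMono Λ ∧ (∀ i, Λ i < 0) ∧ Tendsto Λ atTop (𝓝 0) ∧
      (∀ i, B.IsWaveSolution (Λ i) (fun t x => w i t * v x)) ∧
      (∃ f : ℕ → GravityYM.L2,
        (∀ i, f i =ᵐ[volume.restrict (Ioi (0 : ℝ))] GravityYM.rescaled n (Λ i) (w i)) ∧
        GravityYM.IsMarkushevichBasis f) ∧
      (∃ b : UnconditionalSchauderBasis ℕ ℂ GravityYM.energySpace,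
        ∀ i, GravityYM.Represents (GravityYM.rescaled n (Λ i) (w i))
          (b i : WithLp 2 (GravityYM.L2 × GravityYM.L2))) := by
  let D := GravityYM.Model.ofDimension hn hμ
  obtain ⟨e⟩ := D.nonempty_eigenbasis
  have hn2 : (2 : ℝ) ≤ n := by exact_mod_cast hn
  have hs : (0 : ℝ) < 4 - 4 / (n : ℝ) := by
    rw [sub_pos, div_lt_iff₀ (by linarith)]
    linarith
  -- This solves λ_i = κ_i^(4-4/n). The exponent is positive, so κ_i increases to infinity with λ_i
  -- and Λ_i = -κ_i⁻⁴ increases to 0.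
  let κ : ℕ → ℝ := fun i => e.lam i ^ (4 - 4 / (n : ℝ))⁻¹
  have hκ : ∀ i, 0 < κ i := fun i => Real.rpow_pos_of_pos (e.pos i) _
  have hlam : ∀ i, e.lam i = κ i ^ (4 - 4 / (n : ℝ)) := fun i =>
    (Real.rpow_inv_rpow (e.pos i).le hs.ne').symm
  have hκmono : StrictMono κ := fun i j hij =>
    Real.rpow_lt_rpow (e.pos i).le (e.strictMono hij) (inv_pos.2 hs)
  have hκtend : Tendsto κ atTop atTop := (tendsto_rpow_atTop (inv_pos.2 hs)).comp e.tendsto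
  have hpair := fun i =>
    GravityYM.Model.isImplicitEigenpair_profile D rfl (hκ i) (hlam i) (e.eigen i)
  have hresc := fun i => GravityYM.rescaled_comp_inv_mul hn (hκ i) (D.profile (D.incl (e.basis i)))
  -- The same eigenvectors supply both bases: their images in L² for the Markushevich basis, and
  -- their preimages under `spaceEquiv` for the Schauder basis of H, where orthonormality is lost
  -- but unconditional convergence survives.
  refine ⟨fun i t => D.profile (D.incl (e.basis i)) ((κ i)⁻¹ * t), fun i => -(κ i)⁻¹ ^ 4, hpair,
    fun i => GravityYM.Model.hasFiniteEnergy_profile D rfl (hκ i) (e.eigen i), fun i j hij => ?_,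
    fun i => ?_, ?_, fun i => GravityYM.isWaveSolution_mul hv (hpair i),
    ⟨fun i => D.toL2 (e.basis i), fun i => ?_, e.isMarkushevichBasis_toL2⟩,
    GravityYM.schauderBasisMap e.basis.toUnconditionalSchauderBasis D.spaceEquiv.symm, fun i => ?_⟩
  · have h1 : (κ j)⁻¹ < (κ i)⁻¹ := inv_strictAnti₀ (hκ i) (hκmono hij)
    exact neg_lt_neg (pow_lt_pow_left₀ h1 (inv_pos.2 (hκ j)).le (by norm_num))
  · exact neg_neg_of_pos (pow_pos (inv_pos.2 (hκ i)) 4)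
  · have := ((tendsto_inv_atTop_zero.comp hκtend).pow 4).neg
    simpa using this
  · rw [hresc i]
    exact D.coeFn_toL2 (e.basis i)
  · rw [hresc i]
    exact D.represents_profile (e.eigen i)
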